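/- **Setting.** Consider a Markov decision process with state space $\mathcal X$, action space $\mathcal A$, horizon $H\ge 1$, fixed initial state $x_1$, transition kernels $P_h$ and conditional cost distributions $C_h$ on $[0,1]$ ($h=1,\dots,H$), such that the cumulative cost $\sum_h c_h$ of every policy lies in $[0,1]$ almost surely. For a policy $\pi$ let $V^\pi$ be its expected cumulative cost and $d^\pi_h$ the law of $(x_h,a_h)$ (or of $x_h$) under $\pi$. Let $\mathcal F=\mathcal F_1\times\dots\times\mathcal F_H$ be a finite class of measurable functions $f_h:\mathcal X\times\mathcal A\to[0,1]$, with $\mathcal F_{H+1}=\{0\}$. Put $\tau(f,c,x')=c+\min_{a'}f(x',a')$ and $\mathcal T^\star_hf(x,a)=\mathbb E_{c\sim C_h(x,a),\,x'\sim P_h(x,a)}[\tau(f,c,x')]$, and assume Bellman completeness: $\mathcal T^\star_h f\in\mathcal F_h$ for all $h$ and $f\in\mathcal F_{h+1}$. For $f\in\mathcal F$ let $\pi_f$ be a measurable greedy policy, $\pi_{f,h}(x)\in\arg\min_a f_h(x,a)$ (ties broken by any fixed rule), and let $\Pi$ be any set of policies that contains all $\pi_f$, $f\in\mathcal F$. **Algorithm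 (hybrid fitted-$Q$ iteration).** The learner has, for each $h$, an offline dataset of $N$ i.i.d. tuples $(x,a,c,x')$ with $(x,a)\sim\nu_h$, $c\sim C_h(x,a)$, $x'\sim P_h(x,a)$. In round $k=1,\dots,K$, starting from $f^k_{H+1}=0$, for $h=H,\dots,1$ it picks $f^k_h$ among the minimizers over $g\in\mathcal F_h$ of $\sum\ell\big(g(x,a),\tau(f^k_{h+1},c,x')\big)$, the sum being over the offline tuples of step $h$ and the tuples of step $h$ collected online in the previous rounds. Then it collects new data with $\pi^k=\pi_{f^k}$: without uniform exploration (UA), the $H$ transitions of one trajectory of $\pi^k$; with UA (then $\mathcal A$ is finite), for each $h$ separately the transition at step $h$ of a roll-in that follows $\pi^k$ before step $h$ and takes a uniformly random action at step $h$. The loss is either $\ell_{\mathrm{sq}}(\hat y,y)=(\hat y-y)^2$ or $\ell_{\mathrm{bce}}(\hat y,y)=-y\ln\hat y-(1-y)\ln(1-\hat y)$ (with $0\ln0=0$). For the bce loss assume also that the targets lie in $[0,1]$, where the loss is defined: for all $h$, $f\in\mathcal F_{h+1}$ and $(x,a)$, $\tau(f,c,x')\le1$ almost surely under $c\sim C_h(x,a)$,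 $x'\sim P_h(x,a)$. **Complexity measures.** For a class $\Psi$ of functions and a class $\mathcal M$ of distributions, $\mathrm{EluDim}_q(\Psi,\mathcal M,\varepsilon_0)$ is the supremum of the $L$ for which there are $\varepsilon\ge\varepsilon_0$ and $\mu_1,\dots,\mu_L\in\mathcal M$ such that for every $t\le L$ some $\psi\in\Psi$ has $|\mathbb E_{\mu_t}\psi|>\varepsilon$ and $\sum_{i<t}|\mathbb E_{\mu_i}\psi|^q\le\varepsilon^q$. For $D:[0,1]^2\to\mathbb R$ let $\Psi_h=\{(x,a)\mapsto D(f_h(x,a),\mathcal T^\star_hf_{h+1}(x,a)): f\in\mathcal F\}$ and $\Psi^{\mathrm V}_h=\{x\mapsto\mathbb E_{a\sim\mathrm{unif}(\mathcal A)}\psi(x,a):\psi\in\Psi_h\}$, and let $d^{\mathrm Q}=\max_h\mathrm{EluDim}_q(\Psi_h,\{d^\pi_h(x,a)\}_{\pi\in\Pi},1/K)$ and $d^{\mathrm V}=\max_h\mathrm{EluDim}_q(\Psi_h^{\mathrm V},\{d^\pi_h(x)\}_{\pi\in\Pi},1/K)$. For the squared loss take $q=2$ and $D(u,v)=(u-v)^2$;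 for the bce loss take $q=1$ and $D(u,v)=\frac12(\sqrt u-\sqrt v)^2+\frac12(\sqrt{1-u}-\sqrt{1-v})^2$, the squared Hellinger distance of Bernoulli laws. Put $d=d^{\mathrm Q}$ without UA and $d=|\mathcal A|\max(1,d^{\mathrm V})$ with UA. For a policy $\tilde\pi$ let $C^{\tilde\pi}=\max_h\|\mathrm dd_h^{\tilde\pi}/\mathrm d\nu_h\|_\infty$ (infinite if some $d_h^{\tilde\pi}\not\ll\nu_h$). **Theorem.** For every $\kappa>0$ there are constants $c>0$ and $p\in\mathbb N$, depending only on $\kappa$, such that the following holds whenever $K\ge1$ and $N\ge\kappa K$. Let $\delta\in(0,1)$ and $\beta=2\ln(H|\mathcal F|/\delta)$. With probability at least $1-\delta$, simultaneously for all comparator policies $\tilde\pi$ with $d+C^{\tilde\pi}<\infty$: 1. with $\ell=\ell_{\mathrm{sq}}$, $$\sum_{k=1}^K\big(V^{\pi^k}-V^{\tilde\pi}\big)\le c\,(1+\ln K)^p\;H\sqrt{K\,(d+C^{\tilde\pi})\,\beta};$$ 2. with $\ell=\ell_{\mathrm{bce}}$, $$\sum_{k=1}^K\big(V^{\pi^k}-V^{\tilde\pi}\big)\le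 c\,(1+\ln K)^p\Big(H\sqrt{V^{\tilde\pi}K\,(d+C^{\tilde\pi})\,\beta}+H^2(d+C^{\tilde\pi})\,\beta\Big).$$ -/

import Mathlib

open MeasureTheory ProbabilityTheory
open scoped ENNReal

universe u v w

namespace HybridRL

noncomputable section

/-- A transition tuple `((x, a), (c, x'))`: state, action, observed cost, next state. -/
abbrev Transition (X : Type u) (A : Type v) := (X × A) × ℝ × X

/-- A finite-horizon Markov decision process with a fixed initial state. Steps are indexed from `0`;
only the kernels with index `h < horizon` play a role. -/
structure MDP (X : Type u) (A : Type v) [MeasurableSpace X] [MeasurableSpace A] where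
  horizon : ℕ
  horizon_pos : 0 < horizon
  init : X
  trans : ℕ → Kernel (X × A) X
  cost : ℕ → Kernel (X × A) ℝ
  trans_markov : ∀ h, IsMarkovKernel (trans h)
  cost_markov : ∀ h, IsMarkovKernel (cost h)
  cost_mem : ∀ h z, ∀ᵐ c ∂(cost h z), c ∈ Set.Icc (0 : ℝ) 1

/-- A (stochastic, Markov, time-dependent) policy. -/
structure Policy (X : Type u) (A : Type v) [MeasurableSpace X] [MeasurableSpace A] where
  act : ℕ → Kernel X A
  act_markov : ∀ h, IsMarkovKernel (act h)

section Interaction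

variable {X : Type u} {A : Type v} [MeasurableSpace X] [MeasurableSpace A]

namespace MDP

variable (M : MDP X A)

/-- Joint law of the cost and the next state given the state-action pair at step `h`;
the two are independent given that pair. -/
def outcome (h : ℕ) : Kernel (X × A) (ℝ × X) := M.cost h ×ₖ M.trans h

/-- One step of interaction at step `h`: from the state `x`, draw the action from `act h x`,
then the cost and the next state. -/
def stepLaw (act : ℕ → Kernel X A) (h : ℕ) : Kernel X (Transition X A) :=
  (Kernel.id ×ₖ act h) ⊗ₖ Kernel.prodMkLeft X (M.outcome h)

/-- The state reached after the first `n` transitions. -/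
def endState : (n : ℕ) → (Fin n → Transition X A) → X
  | 0, _ => M.init
  | n + 1, τ => (τ (Fin.last n)).2.2

theorem measurable_endState : ∀ n, Measurable (M.endState n)
  | 0 => measurable_const
  | n + 1 => (measurable_pi_apply (Fin.last n)).snd.snd

/-- Law of the first `n` transitions when rolling in with the action kernels `act`
from the initial state. -/
def trajLaw (act : ℕ → Kernel X A) : (n : ℕ) → Measure (Fin n → Transition X A)
  | 0 => Measure.dirac Fin.elim0
  | n + 1 =>
    (trajLaw act n ⊗ₘ (M.stepLaw act n).comap (M.endState n) (M.measurable_endState n)).map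
      (fun p => Fin.snoc (α := fun _ => Transition X A) p.1 p.2)

/-- The state-action visitation distribution `d^π_h`. -/
def visit (π : Policy X A) (h : ℕ) : Measure (X × A) :=
  (M.trajLaw π.act (h + 1)).map (fun τ => (τ (Fin.last h)).1)

/-- The state visitation distribution at step `h`. -/
def stateVisit (π : Policy X A) (h : ℕ) : Measure X := (M.visit π h).map Prod.fst

/-- The value `V^π`: expected cumulative cost of `π` from the initial state. -/
def value (π : Policy X A) : ℝ :=
  ∫ τ, ∑ h, (τ h).2.1 ∂(M.trajLaw π.act M.horizon)

/-- The cumulative cost of every policy lies in `[0, 1]` almost surely. -/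
def Normalized : Prop :=
  ∀ π : Policy X A, ∀ᵐ τ ∂(M.trajLaw π.act M.horizon), ∑ h, (τ h).2.1 ∈ Set.Icc (0 : ℝ) 1

/-- The action kernels that follow `π`, except for uniformly random actions at step `h`. -/
def switchUnif (π : Policy X A) (h : ℕ) : ℕ → Kernel X A :=
  fun t => if t = h then Kernel.const X (uniformOn (Set.univ : Set A)) else π.act t

/-- Law of the data `(x_h, a_h, c_h, x_h')`, `h < horizon`, gathered in one round with `π`.
Without uniform exploration it is one trajectory of `π`. With uniform exploration there is, for each
step `h`, a separate roll-in with `π` up to `x_h`, followed by a uniformly random action. -/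
def rollIn (ua : Bool) (π : Policy X A) : Measure (Fin M.horizon → Transition X A) :=
  if ua then
    Measure.pi fun h : Fin M.horizon =>
      (M.trajLaw (switchUnif π h) ((h : ℕ) + 1)).map (fun τ => τ (Fin.last (h : ℕ)))
  else M.trajLaw π.act M.horizon

end MDP

/-- The regression target `c + min_{a'} f (x', a')`. -/
def target (f : X × A → ℝ) (o : ℝ × X) : ℝ := o.1 + ⨅ a', f (o.2, a')

/-- The Bellman optimality operator at step `h`. -/
def MDP.bellman (M : MDP X A) (h : ℕ) (f : X × A → ℝ) : X × A → ℝ :=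
  fun z => ∫ o, target f o ∂(M.outcome h z)

/-- A finite function class `F = F_0 × ⋯ × F_{H-1}` of measurable functions with values in `[0, 1]`,
with the convention that the only predictor after the last step is `0`. -/
structure FunctionClass (X : Type u) (A : Type v) [MeasurableSpace X] [MeasurableSpace A]
    (H : ℕ) where
  cls : ℕ → Finset (X × A → ℝ)
  terminal : cls H = {0}
  measurable : ∀ h < H, ∀ f ∈ cls h, Measurable f
  mem_Icc : ∀ h < H, ∀ f ∈ cls h, ∀ z, f z ∈ Set.Icc (0 : ℝ) 1

/-- The number of elements of `F = F_0 × ⋯ × F_{H-1}`. -/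
def FunctionClass.size {H : ℕ} (F : FunctionClass X A H) : ℕ :=
  ∏ h ∈ Finset.range H, (F.cls h).card

/-- Bellman completeness with respect to the Bellman optimality operator. -/
def BellmanComplete (M : MDP X A) (F : FunctionClass X A M.horizon) : Prop :=
  ∀ h < M.horizon, ∀ f ∈ F.cls (h + 1), M.bellman h f ∈ F.cls h

/-- All regression targets formed with the class lie in `[0, 1]` (they are nonnegative anyway),
the range of labels on which the binary cross-entropy loss is defined. -/
def TargetsLeOne (M : MDP X A) (F : FunctionClass X A M.horizon) : Prop :=
  ∀ h < M.horizon, ∀ f ∈ F.cls (h + 1), ∀ z, ∀ᵐ o ∂(M.outcome h z), target f o ≤ 1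

/-- A rule that turns a function of the class into a greedy action, with arbitrary (measurable)
tie-breaking. -/
structure GreedyRule {H : ℕ} (F : FunctionClass X A H) where
  sel : ℕ → (X × A → ℝ) → X → A
  measurable_sel : ∀ h f, Measurable (sel h f)
  sel_min : ∀ h < H, ∀ f ∈ F.cls h, ∀ x a, f (x, sel h f x) ≤ f (x, a)

/-- The greedy policy `π_f` of a tuple `f = (f_0, f_1, …)`. -/
def GreedyRule.policy {H : ℕ} {F : FunctionClass X A H} (G : GreedyRule F)
    (f : ℕ → X × A → ℝ) : Policy X A where
  act h := Kernel.deterministic (G.sel h (f h)) (G.measurable_sel h (f h))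
  act_markov _ := inferInstance

/-! ### Losses -/

/-- `- ln t` for `t` in `[0, 1]`, with the value `∞` at `0`. -/
def negLog (t : ℝ) : ℝ≥0∞ := if t ≤ 0 then ⊤ else ENNReal.ofReal (-Real.log t)

/-- The squared loss. -/
def sqLoss (p y : ℝ) : ℝ≥0∞ := ENNReal.ofReal ((p - y) ^ 2)

/-- The binary cross-entropy loss `- y ln p - (1 - y) ln (1 - p)` for `p, y` in `[0, 1]`,
where `0 ln 0 = 0` and `y ln 0 = - ∞` for `y > 0`. -/
def bceLoss (p y : ℝ) : ℝ≥0∞ :=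
  ENNReal.ofReal y * negLog p + ENNReal.ofReal (1 - y) * negLog (1 - p)

/-- The empirical temporal-difference loss of `g` with next-step predictor `f` on the data `D`. -/
def tdLoss (loss : ℝ → ℝ → ℝ≥0∞) {ι : Type} [Fintype ι] (D : ι → Transition X A)
    (g f : X × A → ℝ) : ℝ≥0∞ :=
  ∑ i, loss (g (D i).1) (target f (D i).2)

/-! ### Hybrid fitted Q-iteration -/

/-- A run of `K` rounds of hybrid fitted Q-iteration on a probability space `(Ω, μ)`, with `N` offline
samples per step from `ν`. The sigma-algebra `info k` is what is known before round `k`: it contains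
the offline data and the online data of the rounds before `k` (and possibly randomness used to choose
among several empirical minimizers). -/
structure FQIRun (M : MDP X A) (F : FunctionClass X A M.horizon) (G : GreedyRule F)
    (ν : Fin M.horizon → Measure (X × A)) (N K : ℕ) (ua : Bool) (loss : ℝ → ℝ → ℝ≥0∞)
    {Ω : Type w} [mΩ : MeasurableSpace Ω] (μ : Measure Ω) where
  info : Filtration ℕ mΩ
  /-- offline samples, by step and index -/
  off : Fin M.horizon → Fin N → Ω → Transition X A
  /-- online data gathered in each round -/
  on : ℕ → Ω → Fin M.horizon → Transition X A
  /-- the functions `f^k = (f^k_0, f^k_1, …)` -/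
  f : ℕ → Ω → ℕ → X × A → ℝ
  off_measurable : ∀ h i, Measurable[info 0] (off h i)
  off_law : ∀ h i, μ.map (off h i) = ν h ⊗ₘ M.outcome h
  off_indep : ∀ h, iIndepFun (off h) μ
  f_terminal : ∀ k < K, ∀ ω, f k ω M.horizon = 0
  f_mem : ∀ k < K, ∀ ω, ∀ h : Fin M.horizon, f k ω h ∈ F.cls h
  /-- `f^k_h` minimizes the loss over `F_h` on the offline data and the online data so far -/
  f_min : ∀ k < K, ∀ ω, ∀ h : Fin M.horizon, ∀ g ∈ F.cls h,
    tdLoss loss (Sum.elim (fun i : Fin N => off h i ω) (fun j : Fin k => on j ω h))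
        (f k ω h) (f k ω (h + 1)) ≤
      tdLoss loss (Sum.elim (fun i : Fin N => off h i ω) (fun j : Fin k => on j ω h))
        g (f k ω (h + 1))
  f_measurable : ∀ k < K, ∀ (h : Fin M.horizon) (g : X × A → ℝ),
    MeasurableSet[info k] {ω | f k ω h = g}
  on_measurable : ∀ k < K, Measurable[info (k + 1)] (on k)
  /-- given the past, the data of round `k` is gathered with the greedy policy of `f^k` -/
  on_law : ∀ k < K, ∀ S : Set (Fin M.horizon → Transition X A), MeasurableSet S →
    μ⟦on k ⁻¹' S | info k⟧ =ᵐ[μ] fun ω => (M.rollIn ua (G.policy (f k ω))).real S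

/-- The regret of a run against the comparator `π'`, on the outcome `ω`. -/
def FQIRun.regret {M : MDP X A} {F : FunctionClass X A M.horizon} {G : GreedyRule F}
    {ν : Fin M.horizon → Measure (X × A)} {N K : ℕ} {ua : Bool} {loss : ℝ → ℝ → ℝ≥0∞}
    {Ω : Type w} [MeasurableSpace Ω] {μ : Measure Ω} (R : FQIRun M F G ν N K ua loss μ)
    (π' : Policy X A) (ω : Ω) : ℝ :=
  ∑ k ∈ Finset.range K, (M.value (G.policy (R.f k ω)) - M.value π')

/-! ### Complexity measures -/

/-- The `ℓ_q` eluder dimension: the supremum of the lengths `L` of the sequences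
`m_0, …, m_{L-1}` in `P` for which there is `ε ≥ ε₀` such that for all `t` some `ψ ∈ Ψ` has
`|E_{m_t} ψ| > ε` and `∑_{i < t} |E_{m_i} ψ| ^ q ≤ ε ^ q`. -/
def eluderDim {S : Type*} [MeasurableSpace S] (q : ℕ) (Ψ : Set (S → ℝ)) (P : Set (Measure S))
    (ε₀ : ℝ) : ℕ∞ :=
  ⨆ L ∈ {L : ℕ | ∃ ε ≥ ε₀, ∃ m : Fin L → Measure S, (∀ t, m t ∈ P) ∧
    ∀ t, ∃ ψ ∈ Ψ, ε < |∫ s, ψ s ∂(m t)| ∧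
      ∑ i ∈ Finset.univ.filter (· < t), |∫ s, ψ s ∂(m i)| ^ q ≤ ε ^ q}, (L : ℕ∞)

/-- Squared difference. -/
def sqDist (p q : ℝ) : ℝ := (p - q) ^ 2

/-- Squared Hellinger distance of the Bernoulli distributions with means `p` and `q`. -/
def hellingerBer (p q : ℝ) : ℝ :=
  (√p - √q) ^ 2 / 2 + (√(1 - p) - √(1 - q)) ^ 2 / 2

/-- The Bellman errors at step `h`, measured by `D`, of the members of the function class. -/
def bellmanErrors (M : MDP X A) (F : FunctionClass X A M.horizon) (D : ℝ → ℝ → ℝ) (h : ℕ) :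
    Set (X × A → ℝ) :=
  {ψ | ∃ g ∈ F.cls h, ∃ f ∈ F.cls (h + 1), ψ = fun z => D (g z) (M.bellman h f z)}

/-- The Bellman errors averaged over uniformly random actions (V-type). -/
def bellmanErrorsV (M : MDP X A) (F : FunctionClass X A M.horizon) (D : ℝ → ℝ → ℝ) (h : ℕ) :
    Set (X → ℝ) :=
  {φ | ∃ ψ ∈ bellmanErrors M F D h, φ = fun x => ∫ a, ψ (x, a) ∂(uniformOn (Set.univ : Set A))}

/-- Eluder dimension of the Bellman errors, over the visitation distributions of the policies in `Pol`;
maximum over the steps. -/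
def dimQ (M : MDP X A) (F : FunctionClass X A M.horizon) (Pol : Set (Policy X A)) (q : ℕ)
    (D : ℝ → ℝ → ℝ) (ε₀ : ℝ) : ℕ∞ :=
  ⨆ h : Fin M.horizon, eluderDim q (bellmanErrors M F D h) ((fun π => M.visit π h) '' Pol) ε₀

/-- V-type eluder dimension of the Bellman errors; maximum over the steps. -/
def dimV (M : MDP X A) (F : FunctionClass X A M.horizon) (Pol : Set (Policy X A)) (q : ℕ)
    (D : ℝ → ℝ → ℝ) (ε₀ : ℝ) : ℕ∞ :=
  ⨆ h : Fin M.horizon, eluderDim q (bellmanErrorsV M F D h) ((fun π => M.stateVisit π h) '' Pol) ε₀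

/-- The dimension that enters the bound: the eluder dimension without uniform exploration, and
the number of actions times the V-type eluder dimension (counted as at least one) with it. -/
def dim (M : MDP X A) (F : FunctionClass X A M.horizon) (Pol : Set (Policy X A)) (ua : Bool)
    (q : ℕ) (D : ℝ → ℝ → ℝ) (ε₀ : ℝ) : ℕ∞ :=
  if ua then (Nat.card A : ℕ∞) * max 1 (dimV M F Pol q D ε₀) else dimQ M F Pol q D ε₀

open Classical in
/-- The coverage coefficient `C^π = max_h ‖d d^π_h / d ν_h‖_∞`, infinite if some `d^π_h` is
not absolutely continuous with respect to `ν_h`. -/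
def coverage (M : MDP X A) (ν : Fin M.horizon → Measure (X × A)) (π : Policy X A) : ℝ≥0∞ :=
  ⨆ h : Fin M.horizon,
    if M.visit π h ≪ ν h then essSup ((M.visit π h).rnDeriv (ν h)) (ν h) else ⊤

end Interaction

end

end HybridRL

/-! A greedy policy attains the minimum in its own predictors, so its value is `min_a φ_0(x_1, a)`
minus the Bellman errors summed along its own law (`value_policy_eq`); with the law of any other
policy the same expression is a lower bound for that policy's value (`le_value`). The initial state
is common, so the regret of a round is at most the absolute Bellman errors under `π^k` plus those
under the comparator (`value_sub_le`). It remains to bound, for each step, the sum over `k` of the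
mean discrepancy `D` between `f^k_h` and its backup target `T f^k_{h+1}` under these two laws.

Statistics: the backup is the conditional mean `t` of the regression label `y`. For both losses the
likelihood ratio `exp(η (loss(t, y) - loss(p, y)))` has mean at most `1 - c D(p, t)`: by Hoeffding's
lemma for the square (`lossControls_sq`), by weighted AM-GM for cross-entropy (`lossControls_bce`).
For a fixed pair `(g, f)` the product of the ratios over all data, times the exponentials of the
accumulated means of `c D`, therefore has expectation at most one (`lintegral_potential_le_one`).
Markov's inequality and a union bound apply. By completeness the backup competes with `f^k_h` in the
minimization, so the ratios multiply to at least one, and `N c E_ν D + ∑_{j<k} c E_j D ≤ ln(K H |F|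
/ δ)`, with `E_j` the mean under the data law of round `j` (`exists_event`).

Transfer: the offline term bounds `D` along the comparator by a change of measure, at the price of
the coverage. The online term says that each discrepancy function is small on the past laws; a
pigeonhole argument with the eluder dimension bounds its sum on the present laws
(`sum_le_of_eluderDim_le`). Uniform exploration costs a further factor `|A|` to return from uniform
actions to those of `π^k`.

Conversion: Cauchy-Schwarz turns discrepancies into Bellman errors. For the square this gives the
`√K` rate directly. For cross-entropy, `(p - t)^2 ≤ 4 (p + t) D`, and the means of `p` and `t` are
controlled by the value of the policy and the discrepancies (`integral_le_value`); the resulting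
inequality has the regret on both sides and is solved in `sub_le_of_le_sqrt_add_sqrt`. -/

namespace HybridRL

/-! ### Marginal laws of trajectories and of the collected data. -/

section Laws

variable {X : Type u} {A : Type v} [MeasurableSpace X] [MeasurableSpace A]

attribute [instance] MDP.trans_markov MDP.cost_markov Policy.act_markov

namespace MDP

variable (M : MDP X A)

instance isMarkovKernel_outcome (h : ℕ) : IsMarkovKernel (M.outcome h) := by
  unfold outcome; infer_instance

theorem isMarkovKernel_stepLaw (act : ℕ → Kernel X A) (h : ℕ) [IsMarkovKernel (act h)] :
    IsMarkovKernel (M.stepLaw act h) := by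
  unfold stepLaw; infer_instance

theorem measurable_snoc (n : ℕ) :
    Measurable (fun p : (Fin n → Transition X A) × Transition X A =>
      (Fin.snoc (α := fun _ => Transition X A) p.1 p.2 : Fin (n + 1) → Transition X A)) := by
  refine measurable_pi_iff.2 fun i => ?_
  refine Fin.lastCases ?_ (fun i => ?_) i
  · simpa using measurable_snd
  · simpa [Function.comp_def] using (measurable_pi_apply i).comp measurable_fst

theorem isProbabilityMeasure_trajLaw (act : ℕ → Kernel X A) [∀ h, IsMarkovKernel (act h)] :
    ∀ n, IsProbabilityMeasure (M.trajLaw act n)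
  | 0 => by unfold trajLaw; infer_instance
  | n + 1 => by
    have := isProbabilityMeasure_trajLaw act n
    have := M.isMarkovKernel_stepLaw act n
    unfold trajLaw
    exact Measure.isProbabilityMeasure_map (measurable_snoc n).aemeasurable

/-- The law of the state reached after the first `h` transitions. -/
noncomputable def stateLaw (act : ℕ → Kernel X A) (h : ℕ) : Measure X :=
  (M.trajLaw act h).map (M.endState h)

theorem stateLaw_zero (act : ℕ → Kernel X A) : M.stateLaw act 0 = Measure.dirac M.init := by
  rw [stateLaw, trajLaw]
  exact Measure.map_dirac' (M.measurable_endState 0) _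

variable (act : ℕ → Kernel X A) [∀ h, IsMarkovKernel (act h)]

instance isProbabilityMeasure_stateLaw (h : ℕ) : IsProbabilityMeasure (M.stateLaw act h) := by
  have := M.isProbabilityMeasure_trajLaw act h
  exact Measure.isProbabilityMeasure_map (M.measurable_endState h).aemeasurable

theorem trajLaw_map_last (n : ℕ) :
    (M.trajLaw act (n + 1)).map (fun τ => τ (Fin.last n)) =
      (M.stateLaw act n ⊗ₘ act n) ⊗ₘ M.outcome n := by
  have := M.isProbabilityMeasure_trajLaw act n
  have := M.isMarkovKernel_stepLaw act n
  refine Measure.ext_of_lintegral _ fun f hf => ?_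
  rw [lintegral_map hf (measurable_pi_apply _), trajLaw,
    lintegral_map (by fun_prop) (measurable_snoc n)]
  simp only [Fin.snoc_last]
  rw [Measure.lintegral_compProd (by fun_prop),
    Measure.lintegral_compProd hf, Measure.lintegral_compProd (by fun_prop), stateLaw,
    lintegral_map (by fun_prop) (M.measurable_endState n)]
  refine lintegral_congr fun τ => ?_
  rw [Kernel.comap_apply, stepLaw, Kernel.lintegral_compProd _ _ _ hf, Kernel.lintegral_prod _ _ _ (by fun_prop),
    Kernel.id_apply]
  simp only [Kernel.prodMkLeft_apply]
  have hm : Measurable fun z : X × A => ∫⁻ o, f (z, o) ∂(M.outcome n z) :=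
    Measurable.lintegral_kernel_prod_right hf
  exact lintegral_dirac' _ (f := fun b => ∫⁻ c, ∫⁻ o, f ((b, c), o) ∂(M.outcome n (b, c))
    ∂(act n (M.endState n τ))) (Measurable.lintegral_prod_right' hm)

/-- The later step is drawn from a Markov kernel, so integrating it out leaves the earlier marginals
unchanged. -/
theorem trajLaw_map_castSucc (n : ℕ) (i : Fin n) :
    (M.trajLaw act (n + 1)).map (fun τ => τ i.castSucc) =
      (M.trajLaw act n).map (fun τ => τ i) := by
  have := M.isProbabilityMeasure_trajLaw act n
  have := M.isMarkovKernel_stepLaw act n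
  refine Measure.ext_of_lintegral _ fun f hf => ?_
  rw [lintegral_map hf (measurable_pi_apply _), trajLaw,
    lintegral_map (by fun_prop) (measurable_snoc n),
    lintegral_map hf (measurable_pi_apply _)]
  simp only [Fin.snoc_castSucc]
  rw [Measure.lintegral_compProd (by fun_prop)]
  simp

/-- The law of the transition at step `i` of a trajectory. -/
theorem trajLaw_map_apply (n : ℕ) (i : Fin n) :
    (M.trajLaw act n).map (fun τ => τ i) = (M.stateLaw act i ⊗ₘ act i) ⊗ₘ M.outcome i := by
  induction n with
  | zero => exact i.elim0
  | succ n ih =>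
    refine Fin.lastCases ?_ (fun i => ?_) i
    · exact M.trajLaw_map_last act n
    · rw [trajLaw_map_castSucc, ih]; rfl

theorem stateLaw_succ (n : ℕ) : M.stateLaw act (n + 1) =
    ((M.stateLaw act n ⊗ₘ act n) ⊗ₘ M.outcome n).map (fun t => t.2.2) := by
  rw [← trajLaw_map_last, Measure.map_map (by fun_prop) (by fun_prop)]; rfl

theorem trajLaw_congr {act act' : ℕ → Kernel X A} :
    ∀ n, (∀ t < n, act t = act' t) → M.trajLaw act n = M.trajLaw act' n
  | 0, _ => rfl
  | n + 1, h => by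
    have hs : M.stepLaw act n = M.stepLaw act' n := by
      unfold stepLaw; rw [h n n.lt_succ_self]
    rw [trajLaw, trajLaw, trajLaw_congr n fun t ht => h t (ht.trans n.lt_succ_self), hs]

theorem stateLaw_congr {act act' : ℕ → Kernel X A} (n : ℕ) (h : ∀ t < n, act t = act' t) :
    M.stateLaw act n = M.stateLaw act' n := by
  unfold stateLaw; rw [M.trajLaw_congr n h]

theorem visit_eq (π : Policy X A) (h : ℕ) : M.visit π h = M.stateLaw π.act h ⊗ₘ π.act h := by
  have : (fun τ : Fin (h + 1) → Transition X A => (τ (Fin.last h)).1) =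
      Prod.fst ∘ fun τ => τ (Fin.last h) := rfl
  rw [visit, this, ← Measure.map_map measurable_fst (measurable_pi_apply _), trajLaw_map_last]
  exact Measure.fst_compProd _ _

instance isProbabilityMeasure_visit (π : Policy X A) (h : ℕ) :
    IsProbabilityMeasure (M.visit π h) := by
  rw [visit_eq]; infer_instance

theorem stateVisit_eq (π : Policy X A) (h : ℕ) : M.stateVisit π h = M.stateLaw π.act h := by
  rw [stateVisit, visit_eq]; exact Measure.fst_compProd _ _

instance isProbabilityMeasure_stateVisit (π : Policy X A) (h : ℕ) :
    IsProbabilityMeasure (M.stateVisit π h) := by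
  rw [stateVisit_eq]; infer_instance

end MDP

/-! ### Uniformly random actions. -/

section Uniform

variable [Finite A]

theorem uniformOn_univ_eq :
    uniformOn (Set.univ : Set A) = ((Nat.card A : ℝ≥0∞)⁻¹) • (Measure.count : Measure A) := by
  rw [uniformOn, ProbabilityTheory.cond, Measure.restrict_univ, Measure.count_apply MeasurableSet.univ]
  simp [Set.encard_univ, ENat.card_eq_coe_natCard]

variable [Nonempty A]

theorem count_univ_ne_zero_and_ne_top :
    (Measure.count : Measure A) Set.univ ≠ 0 ∧ (Measure.count : Measure A) Set.univ ≠ ∞ := by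
  rw [Measure.count_apply MeasurableSet.univ, Set.encard_univ, ENat.card_eq_coe_natCard]
  simp [Nat.card_ne_zero, *]

instance isProbabilityMeasure_uniformOn_univ :
    IsProbabilityMeasure (uniformOn (Set.univ : Set A)) :=
  cond_isProbabilityMeasure_of_finite count_univ_ne_zero_and_ne_top.1
    count_univ_ne_zero_and_ne_top.2

/-- Importance weighting: the mean is `1/|A|` times a sum of nonnegative terms, one of which is `g
a`. -/
theorem le_card_mul_integral_uniformOn {g : A → ℝ} (hg : Measurable g) (h0 : ∀ a, 0 ≤ g a) (a : A) :
    g a ≤ Nat.card A * ∫ a, g a ∂(uniformOn (Set.univ : Set A)) := by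
  have := Fintype.ofFinite A
  have hc : (0 : ℝ) < Nat.card A := by exact_mod_cast Nat.card_pos
  -- Singletons of `A` need not be measurable, so the counting measure is handled as a sum of Dirac
  -- masses, against which only measurability of `g` is needed.
  have hi : Integrable g (Measure.count : Measure A) := by
    rw [Measure.count, Measure.sum_fintype]
    refine integrable_finsetSum_measure.2 fun a _ => ?_
    exact (integrable_const (g a)).congr (by
      rw [Filter.EventuallyEq, ae_dirac_iff (measurableSet_eq_fun measurable_const hg)])
  rw [uniformOn_univ_eq, integral_smul_measure, Measure.count, Measure.sum_fintype,
    integral_finsetSum_measure fun a _ => ?_]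
  · simp only [integral_dirac' _ _ hg.stronglyMeasurable]
    simp only [ENNReal.toReal_inv, ENNReal.toReal_natCast, smul_eq_mul]
    rw [mul_inv_cancel_left₀ hc.ne']
    exact Finset.single_le_sum (fun i _ => h0 i) (Finset.mem_univ a)
  · rw [Measure.count, Measure.sum_fintype] at hi
    exact integrable_finsetSum_measure.1 hi a (Finset.mem_univ a)

end Uniform

namespace MDP

variable (M : MDP X A)

/-- The law of the state-action pair at step `h` in the data gathered with `π`. -/
noncomputable def dataLaw (ua : Bool) (π : Policy X A) (h : ℕ) : Measure (X × A) :=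
  if ua then M.stateLaw π.act h ⊗ₘ Kernel.const X (uniformOn (Set.univ : Set A)) else M.visit π h

theorem dataLaw_false (π : Policy X A) (h : ℕ) : M.dataLaw false π h = M.visit π h := rfl

theorem dataLaw_true (π : Policy X A) (h : ℕ) : M.dataLaw true π h =
    M.stateVisit π h ⊗ₘ Kernel.const X (uniformOn (Set.univ : Set A)) := by
  rw [stateVisit_eq]; rfl

theorem isMarkovKernel_switchUnif [Finite A] [Nonempty A] (π : Policy X A) (h t : ℕ) :
    IsMarkovKernel (switchUnif π h t) := by
  unfold switchUnif; split_ifs <;> infer_instance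

theorem isProbabilityMeasure_dataLaw [Nonempty A] {ua : Bool} (hua : ua = true → Finite A)
    (π : Policy X A) (h : ℕ) : IsProbabilityMeasure (M.dataLaw ua π h) := by
  cases ua with
  | false => rw [dataLaw_false]; infer_instance
  | true => have := hua rfl; rw [dataLaw_true]; infer_instance

theorem isProbabilityMeasure_rollIn [Nonempty A] {ua : Bool} (hua : ua = true → Finite A)
    (π : Policy X A) : IsProbabilityMeasure (M.rollIn ua π) := by
  cases ua with
  | false => exact M.isProbabilityMeasure_trajLaw π.act M.horizon
  | true =>
    have := hua rfl
    have := isMarkovKernel_switchUnif π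
    have (h : Fin M.horizon) : IsProbabilityMeasure
        ((M.trajLaw (switchUnif π h) ((h : ℕ) + 1)).map (fun τ => τ (Fin.last (h : ℕ)))) := by
      have := M.isProbabilityMeasure_trajLaw (switchUnif π h) (h + 1)
      exact Measure.isProbabilityMeasure_map (measurable_pi_apply _).aemeasurable
    simp only [rollIn, if_true]
    infer_instance

/-- The concentration argument treats one step at a time, so this marginal is all it uses of a
round. With exploration, `switchUnif π h` agrees with `π` before `h`, hence the state law is that of
`π`. -/
theorem rollIn_map_apply [Nonempty A] {ua : Bool} (hua : ua = true → Finite A)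
    (π : Policy X A) (h : Fin M.horizon) :
    (M.rollIn ua π).map (fun τ => τ h) = M.dataLaw ua π h ⊗ₘ M.outcome h := by
  cases ua with
  | false => rw [dataLaw_false, visit_eq]; exact M.trajLaw_map_apply π.act M.horizon h
  | true =>
    have := hua rfl
    have := isMarkovKernel_switchUnif π
    have (h : Fin M.horizon) : IsProbabilityMeasure
        ((M.trajLaw (switchUnif π h) ((h : ℕ) + 1)).map (fun τ => τ (Fin.last (h : ℕ)))) := by
      have := M.isProbabilityMeasure_trajLaw (switchUnif π h) (h + 1)
      exact Measure.isProbabilityMeasure_map (measurable_pi_apply _).aemeasurable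
    simp only [rollIn, if_true]
    refine ((measurePreserving_eval _ h).map_eq).trans ?_
    rw [trajLaw_map_last, M.stateLaw_congr (act' := π.act) h fun t ht => by
      simp [switchUnif, ht.ne]]
    simp [switchUnif, dataLaw]

theorem rollIn_congr {ua : Bool} {π π' : Policy X A} (hp : ∀ h < M.horizon, π.act h = π'.act h) :
    M.rollIn ua π = M.rollIn ua π' := by
  cases ua with
  | false => exact M.trajLaw_congr _ hp
  | true =>
    have (h : Fin M.horizon) : M.trajLaw (switchUnif π h) ((h : ℕ) + 1) =
        M.trajLaw (switchUnif π' h) ((h : ℕ) + 1) := by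
      refine M.trajLaw_congr _ fun t ht => ?_
      unfold switchUnif
      rw [hp t (by omega)]
    simp only [rollIn, if_true, this]

end MDP
end Laws

/-! ### Bellman errors, regret decomposition and control of predictions by values. -/

section Bellman

variable {X : Type u} {A : Type v} [MeasurableSpace X] [MeasurableSpace A] {M : MDP X A}

theorem MDP.ae_outcome_cost_mem (M : MDP X A) (h : ℕ) (z : X × A) :
    ∀ᵐ o ∂(M.outcome h z), o.1 ∈ Set.Icc (0 : ℝ) 1 := by
  have : (M.outcome h z).map Prod.fst = M.cost h z := by
    rw [MDP.outcome, Kernel.prod_apply, Measure.map_fst_prod]; simp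
  have h1 := M.cost_mem h z
  rw [← this] at h1
  exact ae_of_ae_map measurable_fst.aemeasurable h1

theorem MDP.ae_compProd_cost_mem (M : MDP X A) (h : ℕ) (m : Measure (X × A)) [SFinite m] :
    ∀ᵐ t ∂(m ⊗ₘ M.outcome h), t.2.1 ∈ Set.Icc (0 : ℝ) 1 :=
  Measure.ae_compProd_of_ae_ae
    (measurableSet_Icc.preimage (by fun_prop : Measurable fun t : Transition X A => t.2.1))
    (ae_of_all _ fun z => M.ae_outcome_cost_mem h z)

theorem MDP.integrable_cost (M : MDP X A) (h : ℕ) (m : Measure (X × A)) [IsProbabilityMeasure m] :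
    Integrable (fun t : Transition X A => t.2.1) (m ⊗ₘ M.outcome h) :=
  Integrable.of_mem_Icc 0 1 (by fun_prop) (M.ae_compProd_cost_mem h m)

variable {F : FunctionClass X A M.horizon}

theorem FunctionClass.measurable_of_mem {h : ℕ} (hh : h ≤ M.horizon) {f : X × A → ℝ}
    (hf : f ∈ F.cls h) : Measurable f := by
  rcases hh.eq_or_lt with rfl | hlt
  · rw [F.terminal, Finset.mem_singleton] at hf; subst hf; exact measurable_const
  · exact F.measurable h hlt f hf

theorem FunctionClass.mem_Icc_of_mem {h : ℕ} (hh : h ≤ M.horizon) {f : X × A → ℝ}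
    (hf : f ∈ F.cls h) (z : X × A) : f z ∈ Set.Icc (0 : ℝ) 1 := by
  rcases hh.eq_or_lt with rfl | hlt
  · rw [F.terminal, Finset.mem_singleton] at hf; subst hf; simp
  · exact F.mem_Icc h hlt f hf z

theorem FunctionClass.iInf_le_of_mem {h : ℕ} (hh : h ≤ M.horizon) {f : X × A → ℝ}
    (hf : f ∈ F.cls h) (x : X) (a : A) : ⨅ a', f (x, a') ≤ f (x, a) :=
  ciInf_le ⟨0, by rintro _ ⟨a, rfl⟩; exact (FunctionClass.mem_Icc_of_mem hh hf _).1⟩ a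

theorem GreedyRule.nonempty_action (G : GreedyRule F) : Nonempty A := ⟨G.sel 0 0 M.init⟩

theorem GreedyRule.iInf_eq (G : GreedyRule F) {h : ℕ} (hh : h < M.horizon) {f : X × A → ℝ}
    (hf : f ∈ F.cls h) (x : X) : ⨅ a, f (x, a) = f (x, G.sel h f x) := by
  have := G.nonempty_action
  exact le_antisymm (FunctionClass.iInf_le_of_mem hh.le hf x _)
    (le_ciInf fun a => G.sel_min h hh f hf x a)

/-- An infimum over an arbitrary action set may fail to be measurable; here the measurable greedy
selector attains it. At the terminal level, where the selector is unconstrained, the predictor is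
zero. -/
theorem GreedyRule.measurable_iInf (G : GreedyRule F) {h : ℕ} (hh : h ≤ M.horizon) {f : X × A → ℝ}
    (hf : f ∈ F.cls h) : Measurable fun x => ⨅ a, f (x, a) := by
  rcases hh.eq_or_lt with rfl | hlt
  · rw [F.terminal, Finset.mem_singleton] at hf; subst hf
    simp only [Pi.zero_apply]
    exact measurable_const
  · simp only [G.iInf_eq hlt hf]
    exact (FunctionClass.measurable_of_mem hh hf).comp
      (measurable_id.prodMk (G.measurable_sel h f))

theorem GreedyRule.iInf_mem_Icc (G : GreedyRule F) {h : ℕ} (hh : h ≤ M.horizon) {f : X × A → ℝ}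
    (hf : f ∈ F.cls h) (x : X) : ⨅ a, f (x, a) ∈ Set.Icc (0 : ℝ) 1 := by
  have := G.nonempty_action
  exact ⟨le_ciInf fun a => (FunctionClass.mem_Icc_of_mem hh hf _).1,
    (FunctionClass.iInf_le_of_mem hh hf x (Classical.arbitrary A)).trans
      (FunctionClass.mem_Icc_of_mem hh hf _).2⟩

theorem GreedyRule.measurable_target (G : GreedyRule F) {h : ℕ} (hh : h ≤ M.horizon)
    {f : X × A → ℝ} (hf : f ∈ F.cls h) : Measurable (target f) :=
  measurable_fst.add ((G.measurable_iInf hh hf).comp measurable_snd)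

theorem GreedyRule.ae_target_mem (G : GreedyRule F) {h : ℕ} (hh : h ≤ M.horizon)
    {f : X × A → ℝ} (hf : f ∈ F.cls h) (j : ℕ) (z : X × A) :
    ∀ᵐ o ∂(M.outcome j z), target f o ∈ Set.Icc (0 : ℝ) 2 := by
  filter_upwards [M.ae_outcome_cost_mem j z] with o ho
  have := G.iInf_mem_Icc hh hf o.2
  simp only [target, Set.mem_Icc] at *
  constructor <;> linarith [this.1, this.2, ho.1, ho.2]

theorem integrable_of_mem_Icc {S : Type*} [MeasurableSpace S] {m : Measure S} [IsFiniteMeasure m]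
    {f : S → ℝ} (hf : Measurable f) {a b : ℝ} (h : ∀ s, f s ∈ Set.Icc a b) : Integrable f m :=
  Integrable.of_mem_Icc a b hf.aemeasurable (ae_of_all _ h)

/-- The expected cost at step `h`. -/
noncomputable def MDP.stepCost (M : MDP X A) (π : Policy X A) (h : ℕ) : ℝ :=
  ∫ t, t.2.1 ∂(M.visit π h ⊗ₘ M.outcome h)

theorem MDP.stepCost_nonneg (M : MDP X A) (π : Policy X A) (h : ℕ) : 0 ≤ M.stepCost π h :=
  integral_nonneg_of_ae ((M.ae_compProd_cost_mem h _).mono fun _ ht => ht.1)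

theorem MDP.trajLaw_map_apply' (M : MDP X A) (π : Policy X A) (h : Fin M.horizon) :
    (M.trajLaw π.act M.horizon).map (fun τ => τ h) = M.visit π h ⊗ₘ M.outcome h := by
  rw [M.trajLaw_map_apply π.act M.horizon h, visit_eq]

theorem MDP.value_eq (M : MDP X A) (π : Policy X A) :
    M.value π = ∑ h ∈ Finset.range M.horizon, M.stepCost π h := by
  have hm : ∀ h : Fin M.horizon, Measurable fun τ : Fin M.horizon → Transition X A => τ h :=
    fun h => measurable_pi_apply h
  rw [MDP.value, integral_finsetSum, ← Fin.sum_univ_eq_sum_range]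
  · refine Finset.sum_congr rfl fun h _ => ?_
    rw [MDP.stepCost, ← trajLaw_map_apply', integral_map (hm h).aemeasurable]
    exact (by fun_prop : Measurable fun t : Transition X A => t.2.1).aestronglyMeasurable
  · intro h _
    have := M.integrable_cost h (M.visit π h)
    rw [← trajLaw_map_apply'] at this
    exact this.comp_measurable (hm h)

theorem MDP.value_nonneg (M : MDP X A) (π : Policy X A) : 0 ≤ M.value π := by
  rw [value_eq]; exact Finset.sum_nonneg fun h _ => M.stepCost_nonneg π h

/-- The telescoping step: the next-state term is integrated against the state law of step `h + 1`,
where the next Bellman error is measured. -/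
theorem GreedyRule.integral_bellman (G : GreedyRule F) {h : ℕ} (hh : h < M.horizon)
    {f : X × A → ℝ} (hf : f ∈ F.cls (h + 1)) (π : Policy X A) :
    ∫ z, M.bellman h f z ∂(M.visit π h) =
      M.stepCost π h + ∫ x, ⨅ a, f (x, a) ∂(M.stateLaw π.act (h + 1)) := by
  have hm := G.measurable_iInf hh hf
  have hi : Integrable (fun t : Transition X A => ⨅ a, f (t.2.2, a)) (M.visit π h ⊗ₘ M.outcome h) :=
    integrable_of_mem_Icc (hm.comp (by fun_prop : Measurable fun t : Transition X A => t.2.2))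
      fun t => G.iInf_mem_Icc hh hf t.2.2
  have hc := M.integrable_cost h (M.visit π h)
  have e1 : ∫ z, M.bellman h f z ∂(M.visit π h) =
      ∫ t, (t.2.1 + ⨅ a, f (t.2.2, a)) ∂(M.visit π h ⊗ₘ M.outcome h) :=
    (Measure.integral_compProd (hc.add hi)).symm
  rw [e1, integral_add hc hi, MDP.stateLaw_succ, ← MDP.visit_eq, MDP.stepCost,
    integral_map (by fun_prop) hm.aestronglyMeasurable]

theorem GreedyRule.integral_iInf_le (G : GreedyRule F) {h : ℕ} (hh : h ≤ M.horizon)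
    {f : X × A → ℝ} (hf : f ∈ F.cls h) (π : Policy X A) :
    ∫ x, ⨅ a, f (x, a) ∂(M.stateLaw π.act h) ≤ ∫ z, f z ∂(M.visit π h) := by
  rw [← M.stateVisit_eq, MDP.stateVisit,
    integral_map measurable_fst.aemeasurable (G.measurable_iInf hh hf).aestronglyMeasurable]
  have hm := G.measurable_iInf hh hf
  refine integral_mono (integrable_of_mem_Icc (hm.comp measurable_fst) fun z => G.iInf_mem_Icc hh hf z.1)
    (integrable_of_mem_Icc (FunctionClass.measurable_of_mem hh hf)
      (FunctionClass.mem_Icc_of_mem hh hf)) fun z => FunctionClass.iInf_le_of_mem hh hf z.1 z.2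

theorem GreedyRule.integral_policy (G : GreedyRule F) {φ : ℕ → X × A → ℝ} {h : ℕ}
    (hh : h < M.horizon) (hf : φ h ∈ F.cls h) :
    ∫ z, φ h z ∂(M.visit (G.policy φ) h) =
      ∫ x, ⨅ a, φ h (x, a) ∂(M.stateLaw (G.policy φ).act h) := by
  rw [MDP.visit_eq, Measure.integral_compProd (integrable_of_mem_Icc
    (FunctionClass.measurable_of_mem hh.le hf) (FunctionClass.mem_Icc_of_mem hh.le hf))]
  refine integral_congr_ae (ae_of_all _ fun x => ?_)
  simp only [GreedyRule.policy, Kernel.deterministic_apply, G.iInf_eq hh hf]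
  rw [integral_dirac']
  exact ((FunctionClass.measurable_of_mem hh.le hf).comp measurable_prodMk_left).stronglyMeasurable

/-- The Bellman error of `φ` at step `h`. -/
noncomputable def MDP.bellmanError (M : MDP X A) (φ : ℕ → X × A → ℝ) (h : ℕ) (z : X × A) : ℝ :=
  φ h z - M.bellman h (φ (h + 1)) z

variable {φ : ℕ → X × A → ℝ}

/-- Completeness makes the backup a member of the class, which supplies its measurability (and,
below, its range). -/
theorem BellmanComplete.measurable_bellmanError (hF : BellmanComplete M F)
    (hφ : ∀ h ≤ M.horizon, φ h ∈ F.cls h) {h : ℕ} (hh : h < M.horizon) :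
    Measurable (M.bellmanError φ h) :=
  (FunctionClass.measurable_of_mem hh.le (hφ h hh.le)).sub
    (FunctionClass.measurable_of_mem hh.le (hF h hh _ (hφ _ hh)))

theorem BellmanComplete.bellmanError_mem (hF : BellmanComplete M F)
    (hφ : ∀ h ≤ M.horizon, φ h ∈ F.cls h) {h : ℕ} (hh : h < M.horizon) (z : X × A) :
    M.bellmanError φ h z ∈ Set.Icc (-1 : ℝ) 1 := by
  have h1 := FunctionClass.mem_Icc_of_mem hh.le (hφ h hh.le) z
  have h2 := FunctionClass.mem_Icc_of_mem hh.le (hF h hh _ (hφ _ hh)) z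
  simp only [MDP.bellmanError, Set.mem_Icc] at *
  constructor <;> linarith [h1.1, h1.2, h2.1, h2.2]

theorem BellmanComplete.integral_bellmanError (hF : BellmanComplete M F)
    (hφ : ∀ h ≤ M.horizon, φ h ∈ F.cls h) {h : ℕ} (hh : h < M.horizon) (π : Policy X A) :
    ∫ z, M.bellmanError φ h z ∂(M.visit π h) =
      ∫ z, φ h z ∂(M.visit π h) - ∫ z, M.bellman h (φ (h + 1)) z ∂(M.visit π h) :=
  integral_sub
    (integrable_of_mem_Icc (FunctionClass.measurable_of_mem hh.le (hφ h hh.le))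
      (FunctionClass.mem_Icc_of_mem hh.le (hφ h hh.le)))
    (integrable_of_mem_Icc (FunctionClass.measurable_of_mem hh.le (hF h hh _ (hφ _ hh)))
      (FunctionClass.mem_Icc_of_mem hh.le (hF h hh _ (hφ _ hh))))

/-- Telescoping over the steps. The inequality comes from replacing the action of `π` by the
minimizing one, which can only lower the prediction. -/
theorem BellmanComplete.le_value (hF : BellmanComplete M F) (G : GreedyRule F)
    (hφ : ∀ h ≤ M.horizon, φ h ∈ F.cls h) (π : Policy X A) :
    ∫ x, ⨅ a, φ 0 (x, a) ∂(M.stateLaw π.act 0) -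
      ∑ h ∈ Finset.range M.horizon, ∫ z, M.bellmanError φ h z ∂(M.visit π h) ≤ M.value π := by
  have key : ∀ h < M.horizon, (∫ x, ⨅ a, φ h (x, a) ∂(M.stateLaw π.act h)) -
      (∫ x, ⨅ a, φ (h + 1) (x, a) ∂(M.stateLaw π.act (h + 1))) -
      ∫ z, M.bellmanError φ h z ∂(M.visit π h) ≤ M.stepCost π h := by
    intro h hh
    rw [hF.integral_bellmanError hφ hh, G.integral_bellman hh (hφ _ hh)]
    linarith [G.integral_iInf_le hh.le (hφ h hh.le) π]
  have hs := Finset.sum_le_sum fun h (hh : h ∈ Finset.range M.horizon) =>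
    key h (Finset.mem_range.1 hh)
  rw [Finset.sum_sub_distrib, Finset.sum_range_sub', ← M.value_eq] at hs
  have h0 : φ M.horizon = 0 := by
    have := hφ _ le_rfl
    rwa [F.terminal, Finset.mem_singleton] at this
  simpa [h0] using hs

/-- The same telescoping sum, exact because the greedy action attains the minimum at every step. -/
theorem BellmanComplete.value_policy_eq (hF : BellmanComplete M F) (G : GreedyRule F)
    (hφ : ∀ h ≤ M.horizon, φ h ∈ F.cls h) :
    M.value (G.policy φ) = ∫ x, ⨅ a, φ 0 (x, a) ∂(M.stateLaw (G.policy φ).act 0) -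
      ∑ h ∈ Finset.range M.horizon, ∫ z, M.bellmanError φ h z ∂(M.visit (G.policy φ) h) := by
  have key : ∀ h < M.horizon, (∫ x, ⨅ a, φ h (x, a) ∂(M.stateLaw (G.policy φ).act h)) -
      (∫ x, ⨅ a, φ (h + 1) (x, a) ∂(M.stateLaw (G.policy φ).act (h + 1))) -
      ∫ z, M.bellmanError φ h z ∂(M.visit (G.policy φ) h) = M.stepCost (G.policy φ) h := by
    intro h hh
    rw [hF.integral_bellmanError hφ hh, G.integral_bellman hh (hφ _ hh),
      G.integral_policy hh (hφ h hh.le)]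
    ring
  have hs := Finset.sum_congr rfl fun h (hh : h ∈ Finset.range M.horizon) =>
    key h (Finset.mem_range.1 hh)
  rw [Finset.sum_sub_distrib, Finset.sum_range_sub', ← M.value_eq] at hs
  have h0 : φ M.horizon = 0 := by
    have := hφ _ le_rfl
    rwa [F.terminal, Finset.mem_singleton] at this
  rw [← hs]
  simp [h0]

/-- The suboptimality of a greedy policy is bounded by the Bellman errors along that policy and
along the comparator. -/
theorem BellmanComplete.value_sub_le (hF : BellmanComplete M F) (G : GreedyRule F)
    (hφ : ∀ h ≤ M.horizon, φ h ∈ F.cls h) (π : Policy X A) :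
    M.value (G.policy φ) - M.value π ≤
      ∑ h ∈ Finset.range M.horizon, ∫ z, |M.bellmanError φ h z| ∂(M.visit (G.policy φ) h) +
      ∑ h ∈ Finset.range M.horizon, ∫ z, |M.bellmanError φ h z| ∂(M.visit π h) := by
  have h1 := hF.value_policy_eq G hφ
  have h2 := hF.le_value G hφ π
  -- Both policies start at the same point mass, so the initial predictions cancel.
  rw [MDP.stateLaw_zero] at h1 h2
  have h3 : -∑ h ∈ Finset.range M.horizon, ∫ z, M.bellmanError φ h z ∂(M.visit (G.policy φ) h) ≤
      ∑ h ∈ Finset.range M.horizon, ∫ z, |M.bellmanError φ h z| ∂(M.visit (G.policy φ) h) := by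
    rw [← Finset.sum_neg_distrib]
    exact Finset.sum_le_sum fun h _ => (neg_le_abs _).trans (abs_integral_le_integral_abs)
  have h4 : ∑ h ∈ Finset.range M.horizon, ∫ z, M.bellmanError φ h z ∂(M.visit π h) ≤
      ∑ h ∈ Finset.range M.horizon, ∫ z, |M.bellmanError φ h z| ∂(M.visit π h) :=
    Finset.sum_le_sum fun h _ => (le_abs_self _).trans (abs_integral_le_integral_abs)
  linarith

/-- The mean of the Bellman discrepancy at step `h` along a policy. -/
noncomputable def MDP.discrepancy (M : MDP X A) (D : ℝ → ℝ → ℝ) (φ : ℕ → X × A → ℝ) (π : Policy X A)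
    (h : ℕ) : ℝ :=
  ∫ z, D (φ h z) (M.bellman h (φ (h + 1)) z) ∂(M.visit π h)

/-- If `D` controls the increment of the predictions multiplicatively, the means of the predictions
and of their Bellman backups are controlled by the value of the policy. -/
theorem BellmanComplete.integral_le_value (hF : BellmanComplete M F) (G : GreedyRule F)
    (hφ : ∀ h ≤ M.horizon, φ h ∈ F.cls h) {D : ℝ → ℝ → ℝ} (hDm : Measurable (Function.uncurry D))
    (hD : ∀ p ∈ Set.Icc (0 : ℝ) 1, ∀ t ∈ Set.Icc (0 : ℝ) 1, D p t ∈ Set.Icc (0 : ℝ) 1)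
    (hD' : ∀ p ∈ Set.Icc (0 : ℝ) 1, ∀ t ∈ Set.Icc (0 : ℝ) 1,
      p ≤ (1 + 1 / M.horizon) * t + 4 * M.horizon * D p t)
    (π : Policy X A) {h : ℕ} (hh : h < M.horizon) :
    ∫ z, φ h z ∂(M.visit π h) + ∫ z, M.bellman h (φ (h + 1)) z ∂(M.visit π h) ≤
      6 * (M.value π + 4 * M.horizon * ∑ j ∈ Finset.range M.horizon, M.discrepancy D φ π j) := by
  set α : ℝ := 1 + 1 / M.horizon with hα
  have hH : (0 : ℝ) < M.horizon := by exact_mod_cast M.horizon_pos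
  have hα1 : 1 ≤ α := by rw [hα]; have := one_div_pos.2 hH; linarith
  have hm : ∀ h < M.horizon, Measurable fun z => D (φ h z) (M.bellman h (φ (h + 1)) z) :=
    fun h hh => hDm.comp ((FunctionClass.measurable_of_mem hh.le (hφ h hh.le)).prodMk
      (FunctionClass.measurable_of_mem hh.le (hF h hh _ (hφ _ hh))))
  have hmem : ∀ h < M.horizon, ∀ z, D (φ h z) (M.bellman h (φ (h + 1)) z) ∈ Set.Icc (0 : ℝ) 1 :=
    fun h hh z => hD _ (FunctionClass.mem_Icc_of_mem hh.le (hφ h hh.le) z) _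
      (FunctionClass.mem_Icc_of_mem hh.le (hF h hh _ (hφ _ hh)) z)
  have hd0 : ∀ h < M.horizon, 0 ≤ M.discrepancy D φ π h :=
    fun h hh => integral_nonneg fun z => (hmem h hh z).1
  have hstep : ∀ h < M.horizon, ∫ z, φ h z ∂(M.visit π h) ≤
      α * ∫ z, M.bellman h (φ (h + 1)) z ∂(M.visit π h) + 4 * M.horizon * M.discrepancy D φ π h := by
    intro h hh
    have hi1 : Integrable (φ h) (M.visit π h) :=
      integrable_of_mem_Icc (FunctionClass.measurable_of_mem hh.le (hφ h hh.le))
        (FunctionClass.mem_Icc_of_mem hh.le (hφ h hh.le))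
    have hi2 : Integrable (M.bellman h (φ (h + 1))) (M.visit π h) :=
      integrable_of_mem_Icc (FunctionClass.measurable_of_mem hh.le (hF h hh _ (hφ _ hh)))
        (FunctionClass.mem_Icc_of_mem hh.le (hF h hh _ (hφ _ hh)))
    have hi3 : Integrable (fun z => D (φ h z) (M.bellman h (φ (h + 1)) z)) (M.visit π h) :=
      integrable_of_mem_Icc (hm h hh) (hmem h hh)
    rw [MDP.discrepancy, ← integral_const_mul, ← integral_const_mul,
      ← integral_add (hi2.const_mul _) (hi3.const_mul _)]
    exact integral_mono hi1 ((hi2.const_mul _).add (hi3.const_mul _)) fun z =>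
      hD' _ (FunctionClass.mem_Icc_of_mem hh.le (hφ h hh.le) z) _
        (FunctionClass.mem_Icc_of_mem hh.le (hF h hh _ (hφ _ hh)) z)
  have hbell : ∀ h < M.horizon, ∫ z, M.bellman h (φ (h + 1)) z ∂(M.visit π h) ≤
      M.stepCost π h + ∫ z, φ (h + 1) z ∂(M.visit π (h + 1)) := by
    intro h hh
    rw [G.integral_bellman hh (hφ _ hh)]
    linarith [G.integral_iInf_le hh (hφ (h + 1) hh) π]
  have h0 : φ M.horizon = 0 := by
    have := hφ _ le_rfl
    rwa [F.terminal, Finset.mem_singleton] at this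
  -- Backward induction with `n` steps left. Each step multiplies by `α = 1 + 1/H`, so the total
  -- factor stays below `e < 3`; this is why `D` is required to control increments up to exactly
  -- such a relative error.
  have hrec : ∀ n, ∀ h, h + n = M.horizon → ∫ z, φ h z ∂(M.visit π h) ≤
      α ^ n * ∑ j ∈ Finset.Ico h M.horizon,
        (M.stepCost π j + 4 * M.horizon * M.discrepancy D φ π j) := by
    intro n
    induction n with
    | zero =>
      intro h hn
      have : h = M.horizon := by omega
      subst this
      simp [h0]
    | succ n ih =>
      intro h hn
      have hlt : h < M.horizon := by omega
      have i1 := ih (h + 1) (by omega)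
      have i2 := hstep h hlt
      have i3 := mul_le_mul_of_nonneg_left (hbell h hlt) (zero_le_one.trans hα1)
      have i4 := mul_le_mul_of_nonneg_left i1 (zero_le_one.trans hα1)
      rw [Finset.sum_eq_sum_Ico_succ_bot hlt]
      have hp : 1 ≤ α ^ n := one_le_pow₀ hα1
      have hc := M.stepCost_nonneg π h
      have hd : 0 ≤ 4 * M.horizon * M.discrepancy D φ π h := mul_nonneg (by positivity) (hd0 h hlt)
      have j1 : α * M.stepCost π h ≤ α ^ (n + 1) * M.stepCost π h :=
        mul_le_mul_of_nonneg_right (by rw [pow_succ]; nlinarith) hc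
      have j2 : 4 * M.horizon * M.discrepancy D φ π h ≤
          α ^ (n + 1) * (4 * M.horizon * M.discrepancy D φ π h) :=
        le_mul_of_one_le_left hd (one_le_pow₀ hα1)
      have j3 : α ^ (n + 1) = α * α ^ n := pow_succ' α n
      rw [mul_add, mul_add]
      rw [j3] at j1 j2 ⊢
      linarith
  have hα3 : ∀ n ≤ M.horizon, α ^ n ≤ 3 := by
    intro n hn
    refine (pow_le_pow_right₀ hα1 hn).trans ?_
    have h1 : α ≤ Real.exp (1 / M.horizon) := by
      rw [hα, add_comm]; exact Real.add_one_le_exp _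
    refine (pow_le_pow_left₀ (by linarith) h1 _).trans ?_
    rw [← Real.exp_nat_mul, mul_one_div_cancel hH.ne']
    linarith [Real.exp_one_lt_d9]
  have hfin : ∀ h ≤ M.horizon, ∫ z, φ h z ∂(M.visit π h) ≤
      3 * ∑ j ∈ Finset.Ico h M.horizon,
        (M.stepCost π j + 4 * M.horizon * M.discrepancy D φ π j) := by
    intro h hh
    refine (hrec (M.horizon - h) h (by omega)).trans ?_
    refine mul_le_mul_of_nonneg_right (hα3 _ (by omega)) (Finset.sum_nonneg fun j hj => ?_)
    have := M.stepCost_nonneg π j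
    have := hd0 j (Finset.mem_Ico.1 hj).2
    positivity
  have hsum : ∀ h ≤ M.horizon, ∑ j ∈ Finset.Ico h M.horizon,
        (M.stepCost π j + 4 * M.horizon * M.discrepancy D φ π j) ≤
      M.value π + 4 * M.horizon * ∑ j ∈ Finset.range M.horizon, M.discrepancy D φ π j := by
    intro h hh
    rw [M.value_eq, Finset.mul_sum, ← Finset.sum_add_distrib]
    refine Finset.sum_le_sum_of_subset_of_nonneg
      (fun j hj => Finset.mem_range.2 (Finset.mem_Ico.1 hj).2) fun j hj _ => ?_
    have := M.stepCost_nonneg π j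
    have := hd0 j (Finset.mem_range.1 hj)
    positivity
  have f1 := hfin h hh.le
  have f2 := hfin (h + 1) hh
  have f3 := hbell h hh
  have f4 := hsum h hh.le
  rw [Finset.sum_eq_sum_Ico_succ_bot hh] at f1 f4
  have hc := M.stepCost_nonneg π h
  have hd : 0 ≤ 4 * M.horizon * M.discrepancy D φ π h := mul_nonneg (by positivity) (hd0 h hh)
  linarith

end Bellman

/-! ### Exponential moments of the excess losses. -/

section Loss

/-- The likelihood ratio of the prediction `p` against the prediction `t` at the label `y`. -/
noncomputable def lossRatio (loss : ℝ → ℝ → ℝ≥0∞) (η p t y : ℝ) : ℝ≥0∞ :=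
  -- This is `exp(-∞)`; without the case split `toReal` would read an infinite loss as zero.
  if loss p y = ⊤ then 0
  else ENNReal.ofReal (Real.exp (η * ((loss t y).toReal - (loss p y).toReal)))

/-- The excess loss over the conditional mean of labels in `[0, b]` controls the discrepancy `D`,
through the exponential moment of the negative excess loss. -/
structure LossControls (loss : ℝ → ℝ → ℝ≥0∞) (D : ℝ → ℝ → ℝ) (η c b : ℝ) : Prop where
  eta_pos : 0 < η
  c_pos : 0 < c
  c_le_one : c ≤ 1
  measurable_loss : Measurable (Function.uncurry loss)
  measurable_D : Measurable (Function.uncurry D)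
  D_mem : ∀ p ∈ Set.Icc (0 : ℝ) 1, ∀ t ∈ Set.Icc (0 : ℝ) 1, D p t ∈ Set.Icc (0 : ℝ) 1
  ae_ne_top : ∀ ρ : Measure ℝ, IsProbabilityMeasure ρ → (∀ᵐ y ∂ρ, y ∈ Set.Icc 0 b) →
    ∫ y, y ∂ρ ∈ Set.Icc (0 : ℝ) 1 → ∀ᵐ y ∂ρ, loss (∫ y, y ∂ρ) y ≠ ⊤
  lintegral_le : ∀ ρ : Measure ℝ, IsProbabilityMeasure ρ → (∀ᵐ y ∂ρ, y ∈ Set.Icc 0 b) →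
    ∫ y, y ∂ρ ∈ Set.Icc (0 : ℝ) 1 → ∀ p ∈ Set.Icc (0 : ℝ) 1,
    ∫⁻ y, lossRatio loss η p (∫ y, y ∂ρ) y ∂ρ ≤ ENNReal.ofReal (1 - c * D p (∫ y, y ∂ρ))

theorem LossControls.measurable_lossRatio {loss : ℝ → ℝ → ℝ≥0∞} {D : ℝ → ℝ → ℝ} {η c b : ℝ}
    (hL : LossControls loss D η c b) :
    Measurable fun q : ℝ × ℝ × ℝ => lossRatio loss η q.1 q.2.1 q.2.2 := by
  have h1 : Measurable fun q : ℝ × ℝ × ℝ => loss q.1 q.2.2 :=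
    hL.measurable_loss.comp (by fun_prop : Measurable fun q : ℝ × ℝ × ℝ => (q.1, q.2.2))
  have h2 : Measurable fun q : ℝ × ℝ × ℝ => loss q.2.1 q.2.2 :=
    hL.measurable_loss.comp (by fun_prop : Measurable fun q : ℝ × ℝ × ℝ => (q.2.1, q.2.2))
  unfold lossRatio
  exact Measurable.ite (h1 (measurableSet_singleton _)) measurable_const
    (ENNReal.measurable_ofReal.comp
      (Real.measurable_exp.comp ((h2.ennreal_toReal.sub h1.ennreal_toReal).const_mul η)))

theorem exp_neg_le_one_sub_half {x : ℝ} (h0 : 0 ≤ x) (h1 : x ≤ 1) : Real.exp (-x) ≤ 1 - x / 2 := by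
  have h := Real.add_one_le_exp x
  rw [Real.exp_neg, inv_le_comm₀ (Real.exp_pos x) (by linarith)]
  refine le_trans ?_ h
  rw [inv_le_iff_one_le_mul₀ (by linarith)]
  nlinarith

/-- Expanding around the mean `t`, the exponent is `-(p - t)^2/4 + (p - t)(y - t)/2`. Hoeffding's
lemma returns `(p - t)^2/8` from the centered part, leaving `exp(-(p - t)^2/8) ≤ 1 - (p - t)^2/16`.
-/
theorem lossControls_sq : LossControls sqLoss sqDist (1 / 4) (1 / 16) 2 where
  eta_pos := by norm_num
  c_pos := by norm_num
  c_le_one := by norm_num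
  measurable_loss := by unfold sqLoss Function.uncurry; fun_prop
  measurable_D := by unfold sqDist Function.uncurry; fun_prop
  D_mem p hp t ht := by
    simp only [sqDist, Set.mem_Icc] at *
    constructor <;> nlinarith [hp.1, hp.2, ht.1, ht.2]
  ae_ne_top ρ _ _ _ := ae_of_all _ fun y => by simp [sqLoss]
  lintegral_le ρ _ hρ ht p hp := by
    set t := ∫ y, y ∂ρ with htdef
    have hrat : ∀ y, lossRatio sqLoss (1 / 4) p t y =
        ENNReal.ofReal (Real.exp (-(p - t) ^ 2 / 4) * Real.exp ((p - t) / 2 * (y - t))) := by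
      intro y
      rw [lossRatio, if_neg (by simp [sqLoss]), ← Real.exp_add, sqLoss, sqLoss,
        ENNReal.toReal_ofReal (sq_nonneg _), ENNReal.toReal_ofReal (sq_nonneg _)]
      congr 2; ring
    simp only [hrat]
    -- Labels range over `[0, 2]` (a cost plus a prediction), so the variance proxy is `((2 -
    -- 0)/2)^2 = 1`.
    have hsub := hasSubgaussianMGF_of_mem_Icc (μ := ρ) (X := fun y => y) (a := 0) (b := 2)
      aemeasurable_id hρ
    have hmgf := hsub.mgf_le ((p - t) / 2)
    have hint := (hsub.integrable_exp_mul ((p - t) / 2)).const_mul (Real.exp (-(p - t) ^ 2 / 4))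
    rw [← htdef] at hmgf hint
    rw [← ofReal_integral_eq_lintegral_ofReal hint (ae_of_all _ fun y => by positivity)]
    refine ENNReal.ofReal_le_ofReal ?_
    rw [integral_const_mul]
    have hmgf' : ∫ y, Real.exp ((p - t) / 2 * (y - t)) ∂ρ ≤ Real.exp ((p - t) ^ 2 / 8) := by
      refine hmgf.trans (Real.exp_le_exp.2 (le_of_eq ?_))
      simp; ring
    refine (mul_le_mul_of_nonneg_left hmgf' (Real.exp_pos _).le).trans ?_
    rw [← Real.exp_add, sqDist]
    have hsq : (p - t) ^ 2 ≤ 1 := by nlinarith [hp.1, hp.2, ht.1, ht.2]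
    have := exp_neg_le_one_sub_half (x := (p - t) ^ 2 / 8) (by positivity) (by linarith)
    calc Real.exp (-(p - t) ^ 2 / 4 + (p - t) ^ 2 / 8) = Real.exp (-((p - t) ^ 2 / 8)) := by
          congr 1; ring
      _ ≤ _ := by linarith

/-- One minus the Bhattacharyya coefficient, the form in which the mean of the likelihood ratio
appears. -/
theorem hellingerBer_eq {p t : ℝ} (hp : p ∈ Set.Icc (0 : ℝ) 1) (ht : t ∈ Set.Icc (0 : ℝ) 1) :
    hellingerBer p t = 1 - (√p * √t + √(1 - p) * √(1 - t)) := by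
  have h1 := Real.sq_sqrt hp.1
  have h2 := Real.sq_sqrt ht.1
  have h3 := Real.sq_sqrt (sub_nonneg.2 hp.2)
  have h4 := Real.sq_sqrt (sub_nonneg.2 ht.2)
  unfold hellingerBer; nlinarith

theorem negLog_of_pos {t : ℝ} (ht : 0 < t) : negLog t = ENNReal.ofReal (-Real.log t) :=
  if_neg ht.not_ge

theorem measurable_negLog : Measurable negLog :=
  Measurable.ite measurableSet_Iic measurable_const (by fun_prop)

theorem bceLoss_eq {p y : ℝ} (hp : p ∈ Set.Ioo (0 : ℝ) 1) (hy : y ∈ Set.Icc (0 : ℝ) 1) :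
    bceLoss p y = ENNReal.ofReal (-(y * Real.log p + (1 - y) * Real.log (1 - p))) := by
  have h1 : Real.log p ≤ 0 := Real.log_nonpos hp.1.le hp.2.le
  have h2 : Real.log (1 - p) ≤ 0 := Real.log_nonpos (by linarith [hp.2]) (by linarith [hp.1])
  rw [bceLoss, negLog_of_pos hp.1, negLog_of_pos (by linarith [hp.2]),
    ← ENNReal.ofReal_mul hy.1, ← ENNReal.ofReal_mul (by linarith [hy.2]), ← ENNReal.ofReal_add]
  · congr 1; ring
  · exact mul_nonneg hy.1 (by linarith)
  · exact mul_nonneg (by linarith [hy.2]) (by linarith)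

theorem bceLoss_toReal {p y : ℝ} (hp : p ∈ Set.Ioo (0 : ℝ) 1) (hy : y ∈ Set.Icc (0 : ℝ) 1) :
    (bceLoss p y).toReal = -(y * Real.log p + (1 - y) * Real.log (1 - p)) := by
  have h1 : Real.log p ≤ 0 := Real.log_nonpos hp.1.le hp.2.le
  have h2 : Real.log (1 - p) ≤ 0 := Real.log_nonpos (by linarith [hp.2]) (by linarith [hp.1])
  rw [bceLoss_eq hp hy, ENNReal.toReal_ofReal]
  nlinarith [hy.1, hy.2, mul_nonneg hy.1 (neg_nonneg.2 h1),
    mul_nonneg (sub_nonneg.2 hy.2) (neg_nonneg.2 h2)]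

theorem bceLoss_one_sub (p y : ℝ) : bceLoss (1 - p) (1 - y) = bceLoss p y := by
  simp [bceLoss, add_comm]

theorem lossRatio_bce_one_sub (η p t y : ℝ) :
    lossRatio bceLoss η (1 - p) (1 - t) (1 - y) = lossRatio bceLoss η p t y := by
  simp [lossRatio, bceLoss_one_sub]

/-- At the boundary prediction `0` a label `y > 0` has infinite loss and the ratio vanishes; at `y =
0` there is equality. -/
theorem lossRatio_bce_zero {t y : ℝ} (ht : t ∈ Set.Ioo (0 : ℝ) 1) (hy : y ∈ Set.Icc (0 : ℝ) 1) :
    lossRatio bceLoss (1 / 2) 0 t y ≤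
      ENNReal.ofReal (y * (√0 / √t) + (1 - y) * (√(1 - 0) / √(1 - t))) := by
  have h1t : 0 < 1 - t := by linarith [ht.2]
  rcases hy.1.eq_or_lt with rfl | hy0
  · have h0 : bceLoss 0 0 = 0 := by simp [bceLoss, negLog]
    rw [lossRatio, if_neg (by simp [h0]), h0, bceLoss_toReal ht hy]
    refine ENNReal.ofReal_le_ofReal (le_of_eq ?_)
    simp only [zero_mul, zero_add, sub_zero, one_mul, ENNReal.toReal_zero, Real.sqrt_one]
    rw [mul_neg, Real.exp_neg, one_div (√(1 - t)), Real.sqrt_eq_rpow, Real.rpow_def_of_pos h1t]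
    congr 2; ring
  · have : bceLoss 0 y = ⊤ := by
      simp [bceLoss, negLog, ENNReal.mul_top, hy0]
    simp [lossRatio, this]

/-- With `η = 1/2` the ratio is a geometric mean of `√(p/t)` and `√((1-p)/(1-t))` with weights `y`
and `1 - y`. The arithmetic mean is affine in `y`, so fractional labels behave like Bernoulli labels
with the same mean. -/
theorem lossRatio_bce_le {p t y : ℝ} (hp : p ∈ Set.Icc (0 : ℝ) 1) (ht : t ∈ Set.Ioo (0 : ℝ) 1)
    (hy : y ∈ Set.Icc (0 : ℝ) 1) :
    lossRatio bceLoss (1 / 2) p t y ≤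
      ENNReal.ofReal (y * (√p / √t) + (1 - y) * (√(1 - p) / √(1 - t))) := by
  have h1t : 0 < 1 - t := by linarith [ht.2]
  rcases hp.1.eq_or_lt with rfl | hp0
  · exact lossRatio_bce_zero ht hy
  rcases hp.2.eq_or_lt with rfl | hp1
  -- The boundary `p = 1` is the boundary `p = 0` after exchanging the two outcomes.
  · have h := lossRatio_bce_zero (t := 1 - t) (y := 1 - y) ⟨h1t, by linarith [ht.1]⟩
      ⟨by linarith [hy.2], by linarith [hy.1]⟩
    have h' := lossRatio_bce_one_sub (1 / 2) 1 t y
    rw [sub_self] at h'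
    rw [h', add_comm] at h
    simpa using h
  · have h1p : 0 < 1 - p := by linarith
    rw [lossRatio, if_neg (by rw [bceLoss_eq ⟨hp0, hp1⟩ hy]; simp),
      bceLoss_toReal ht hy, bceLoss_toReal ⟨hp0, hp1⟩ hy]
    refine ENNReal.ofReal_le_ofReal ?_
    have key := Real.geom_mean_le_arith_mean2_weighted (w₁ := y) (w₂ := 1 - y)
      (p₁ := √p / √t) (p₂ := √(1 - p) / √(1 - t)) hy.1 (by linarith [hy.2]) (by positivity)
      (by positivity) (by ring)
    refine le_trans (le_of_eq ?_) key
    have hl : ∀ s : ℝ, 0 < s → Real.log (√s) = Real.log s / 2 := fun s hs => Real.log_sqrt hs.le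
    have q1 := Real.sqrt_pos.2 hp0
    have q2 := Real.sqrt_pos.2 ht.1
    have q3 := Real.sqrt_pos.2 h1p
    have q4 := Real.sqrt_pos.2 h1t
    rw [Real.rpow_def_of_pos (div_pos q1 q2), Real.rpow_def_of_pos (div_pos q3 q4), ← Real.exp_add,
      Real.log_div q1.ne' q2.ne', Real.log_div q3.ne' q4.ne', hl _ hp0, hl _ ht.1, hl _ h1p, hl _ h1t]
    congr 1; ring

theorem ae_eq_zero_of_integral_eq_zero {ρ : Measure ℝ} [IsProbabilityMeasure ρ]
    (hρ : ∀ᵐ y ∂ρ, y ∈ Set.Icc (0 : ℝ) 1) (h : ∫ y, y ∂ρ = 0) : ∀ᵐ y ∂ρ, y = 0 :=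
  (integral_eq_zero_iff_of_nonneg_ae (hρ.mono fun _ hy => hy.1)
    (Integrable.of_mem_Icc 0 1 aemeasurable_id hρ)).1 h

theorem ae_eq_one_of_integral_eq_one {ρ : Measure ℝ} [IsProbabilityMeasure ρ]
    (hρ : ∀ᵐ y ∂ρ, y ∈ Set.Icc (0 : ℝ) 1) (h : ∫ y, y ∂ρ = 1) : ∀ᵐ y ∂ρ, y = 1 := by
  have hi : Integrable (fun y : ℝ => y) ρ := Integrable.of_mem_Icc 0 1 aemeasurable_id hρ
  have h0 : ∫ y, (1 - y) ∂ρ = 0 := by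
    rw [integral_sub (integrable_const _) hi, h]; simp
  have := (integral_eq_zero_iff_of_nonneg_ae (hρ.mono fun _ hy => sub_nonneg.2 hy.2)
    ((integrable_const _).sub hi)).1 h0
  filter_upwards [this] with y hy
  simp only [Pi.zero_apply] at hy
  linarith

/-- Averaging the affine bound of `lossRatio_bce_le` over labels of mean `t` gives `√p√t +
√(1-p)√(1-t)`, which is one minus the squared Hellinger distance. -/
theorem lossControls_bce : LossControls bceLoss hellingerBer (1 / 2) 1 1 where
  eta_pos := by norm_num
  c_pos := by norm_num
  c_le_one := by norm_num
  measurable_loss := by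
    have := measurable_negLog
    unfold bceLoss Function.uncurry; fun_prop
  measurable_D := by unfold hellingerBer Function.uncurry; fun_prop
  D_mem p hp t ht := by
    constructor
    · unfold hellingerBer; positivity
    · rw [hellingerBer_eq hp ht]
      have : 0 ≤ √p * √t + √(1 - p) * √(1 - t) := by positivity
      linarith
  ae_ne_top ρ _ hρ ht := by
    rcases ht.1.eq_or_lt with h0 | h0
    · filter_upwards [ae_eq_zero_of_integral_eq_zero hρ h0.symm] with y hy
      simp [← h0, hy, bceLoss, negLog]
    rcases ht.2.eq_or_lt with h1 | h1
    · filter_upwards [ae_eq_one_of_integral_eq_one hρ h1] with y hy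
      simp [h1, hy, bceLoss, negLog]
    · filter_upwards [hρ] with y hy
      rw [bceLoss_eq ⟨h0, h1⟩ hy]; simp
  lintegral_le ρ _ hρ ht p hp := by
    rw [hellingerBer_eq hp ht]
    -- If the mean is `0` or `1` the label is almost surely constant, and the ratio is computed
    -- directly; the affine bound would divide by `√t` or `√(1-t)`.
    rcases ht.1.eq_or_lt with h0 | h0
    · rw [← h0, lintegral_congr_ae (g := fun _ => lossRatio bceLoss (1 / 2) p 0 0)]
      · rw [lintegral_const, measure_univ, mul_one, lossRatio]
        split_ifs with hb
        · exact zero_le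
        refine ENNReal.ofReal_le_ofReal ?_
        have hp1 : 0 < 1 - p := by
          by_contra hcon
          exact hb (by simp [bceLoss, negLog, show 1 - p ≤ 0 by linarith])
        have h1 : bceLoss p 0 = ENNReal.ofReal (-Real.log (1 - p)) := by
          simp [bceLoss, negLog_of_pos hp1]
        have h2 : bceLoss 0 0 = 0 := by simp [bceLoss, negLog]
        have h3 : Real.log (1 - p) ≤ 0 := Real.log_nonpos hp1.le (by linarith [hp.1])
        rw [h1, h2, ENNReal.toReal_ofReal (by linarith)]
        simp only [ENNReal.toReal_zero, Real.sqrt_zero, mul_zero, zero_add, sub_zero, Real.sqrt_one]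
        rw [Real.sqrt_eq_rpow, Real.rpow_def_of_pos hp1]
        refine le_of_eq ?_
        ring_nf
      · filter_upwards [ae_eq_zero_of_integral_eq_zero hρ h0.symm] with y hy
        rw [hy]
    rcases ht.2.eq_or_lt with h1 | h1
    · rw [h1, lintegral_congr_ae (g := fun _ => lossRatio bceLoss (1 / 2) p 1 1)]
      · rw [lintegral_const, measure_univ, mul_one, lossRatio]
        split_ifs with hb
        · exact zero_le
        refine ENNReal.ofReal_le_ofReal ?_
        have hp1 : 0 < p := by
          by_contra hcon
          exact hb (by simp [bceLoss, negLog, show p ≤ 0 by linarith])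
        have e1 : bceLoss p 1 = ENNReal.ofReal (-Real.log p) := by
          simp [bceLoss, negLog_of_pos hp1]
        have e2 : bceLoss 1 1 = 0 := by simp [bceLoss, negLog]
        have e3 : Real.log p ≤ 0 := Real.log_nonpos hp1.le hp.2
        rw [e1, e2, ENNReal.toReal_ofReal (by linarith)]
        simp only [ENNReal.toReal_zero, Real.sqrt_zero, mul_zero, add_zero, sub_self, Real.sqrt_one]
        rw [Real.sqrt_eq_rpow, Real.rpow_def_of_pos hp1]
        refine le_of_eq ?_
        ring_nf
      · filter_upwards [ae_eq_one_of_integral_eq_one hρ h1] with y hy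
        rw [hy]
    · set t := ∫ y, y ∂ρ with htdef
      have hi : Integrable (fun y : ℝ => y) ρ := Integrable.of_mem_Icc 0 1 aemeasurable_id hρ
      have hi' : Integrable (fun y : ℝ => y * (√p / √t) + (1 - y) * (√(1 - p) / √(1 - t))) ρ :=
        (hi.mul_const _).add (((integrable_const _).sub hi).mul_const _)
      calc ∫⁻ y, lossRatio bceLoss (1 / 2) p t y ∂ρ
          ≤ ∫⁻ y, ENNReal.ofReal (y * (√p / √t) + (1 - y) * (√(1 - p) / √(1 - t))) ∂ρ :=
            lintegral_mono_ae (hρ.mono fun y hy => lossRatio_bce_le hp ⟨h0, h1⟩ hy)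
        _ = ENNReal.ofReal (∫ y, (y * (√p / √t) + (1 - y) * (√(1 - p) / √(1 - t))) ∂ρ) := by
            rw [ofReal_integral_eq_lintegral_ofReal hi']
            filter_upwards [hρ] with y hy
            have h1 := hy.1
            have h2 : 0 ≤ 1 - y := by linarith [hy.2]
            simp only [Pi.zero_apply]
            positivity
        _ ≤ _ := by
            refine ENNReal.ofReal_le_ofReal (le_of_eq ?_)
            have hi1 : Integrable (fun y : ℝ => 1 - y) ρ := (integrable_const _).sub hi
            rw [integral_add (hi.mul_const _) (hi1.mul_const _),
              integral_mul_const, integral_mul_const, integral_sub (integrable_const _) hi, ← htdef]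
            have q2 := Real.sqrt_pos.2 h0
            have q4 := Real.sqrt_pos.2 (sub_pos.2 h1)
            have e2 := Real.sq_sqrt ht.1
            have e4 := Real.sq_sqrt (sub_nonneg.2 ht.2)
            have e5 : t * (√p / √t) = √p * √t := by
              field_simp; rw [e2]; ring
            have e6 : (1 - t) * (√(1 - p) / √(1 - t)) = √(1 - p) * √(1 - t) := by
              field_simp; rw [e4]; ring
            simp only [integral_const, probReal_univ, smul_eq_mul, one_mul]
            rw [e5, e6]; ring

/-- The increment of the predictions, in terms of the Hellinger distance. -/
theorem le_one_add_mul_add_hellingerBer {n : ℝ} (hn : 1 ≤ n) {p t : ℝ}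
    (hp : p ∈ Set.Icc (0 : ℝ) 1) (ht : t ∈ Set.Icc (0 : ℝ) 1) :
    p ≤ (1 + 1 / n) * t + 4 * n * hellingerBer p t := by
  have h1 := Real.sq_sqrt hp.1
  have h2 := Real.sq_sqrt ht.1
  have hD : (√p - √t) ^ 2 / 2 ≤ hellingerBer p t := by
    unfold hellingerBer
    have : 0 ≤ (√(1 - p) - √(1 - t)) ^ 2 / 2 := by positivity
    linarith
  set a := √p with ha
  set b := √t with hb
  have hn0 : 0 < n := by linarith
  have h3 : 4 * n * ((a - b) ^ 2 / 2) ≤ 4 * n * hellingerBer p t :=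
    mul_le_mul_of_nonneg_left hD (by positivity)
  have h4 : 0 ≤ (n * (a - b) - b) ^ 2 / n := by positivity
  have h5 : (n * (a - b) - b) ^ 2 / n = n * (a - b) ^ 2 - 2 * b * (a - b) + 1 / n * b ^ 2 := by
    field_simp; ring
  have h6 := mul_nonneg (sub_nonneg.2 hn) (sq_nonneg (a - b))
  have h7 : p = b ^ 2 + 2 * b * (a - b) + (a - b) ^ 2 := by rw [← h1]; ring
  rw [h2] at h5 h7
  linarith

/-- Factor `p - t` through square roots. The weight `p + t` is what makes the final bound scale with
the value of the comparator. -/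
theorem sq_sub_le_hellingerBer {p t : ℝ} (hp : p ∈ Set.Icc (0 : ℝ) 1) (ht : t ∈ Set.Icc (0 : ℝ) 1) :
    (p - t) ^ 2 ≤ hellingerBer p t * (4 * (p + t)) := by
  have h1 := Real.sq_sqrt hp.1
  have h2 := Real.sq_sqrt ht.1
  have hD : (√p - √t) ^ 2 / 2 ≤ hellingerBer p t := by
    unfold hellingerBer
    have : 0 ≤ (√(1 - p) - √(1 - t)) ^ 2 / 2 := by positivity
    linarith
  have h3 : (p - t) ^ 2 = (√p - √t) ^ 2 * (√p + √t) ^ 2 := by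
    conv_lhs => rw [← h1, ← h2]
    ring
  have h4 : (√p + √t) ^ 2 ≤ 2 * (p + t) := by nlinarith [sq_nonneg (√p - √t)]
  rw [h3]
  calc (√p - √t) ^ 2 * (√p + √t) ^ 2 ≤ (√p - √t) ^ 2 * (2 * (p + t)) := by gcongr
    _ = (√p - √t) ^ 2 / 2 * (4 * (p + t)) := by ring
    _ ≤ _ := by
      refine mul_le_mul_of_nonneg_right hD ?_
      linarith [hp.1, ht.1]

end Loss

/-! ### The likelihood-ratio process of a fixed pair of predictors. -/

section Concentration

/-- Integration of a function of `Y` against a weight depending on `Z`, when `κ` is the conditional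
law of `Y` given `Z`. -/
theorem lintegral_mul_of_condLaw {Ω Ω' T : Type*} [MeasurableSpace Ω] [MeasurableSpace Ω']
    [MeasurableSpace T] {μ : Measure Ω} [IsProbabilityMeasure μ] {Z : Ω → Ω'} (hZ : Measurable Z)
    {Y : Ω → T} (hY : Measurable Y) (κ : Kernel Ω' T) [IsMarkovKernel κ]
    (h : ∀ s, MeasurableSet s → ∀ t, MeasurableSet t →
      μ (Z ⁻¹' s ∩ Y ⁻¹' t) = ∫⁻ ω in Z ⁻¹' s, κ (Z ω) t ∂μ)
    {u : Ω' → ℝ≥0∞} (hu : Measurable u) {v : T → ℝ≥0∞} (hv : Measurable v) :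
    ∫⁻ ω, u (Z ω) * v (Y ω) ∂μ = ∫⁻ ω, u (Z ω) * ∫⁻ y, v y ∂(κ (Z ω)) ∂μ := by
  have hprob : IsProbabilityMeasure (μ.map Z) := Measure.isProbabilityMeasure_map hZ.aemeasurable
  have heq : μ.map (fun ω => (Z ω, Y ω)) = μ.map Z ⊗ₘ κ := by
    have : IsProbabilityMeasure (μ.map fun ω => (Z ω, Y ω)) :=
      Measure.isProbabilityMeasure_map (hZ.prodMk hY).aemeasurable
    refine Measure.ext_prod fun {s t} hs ht => ?_
    rw [Measure.map_apply (hZ.prodMk hY) (hs.prod ht), Measure.compProd_apply_prod hs ht,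
      setLIntegral_map hs (κ.measurable_coe ht) hZ, ← h s hs t ht]
    rfl
  calc ∫⁻ ω, u (Z ω) * v (Y ω) ∂μ
      = ∫⁻ p, u p.1 * v p.2 ∂(μ.map fun ω => (Z ω, Y ω)) := by
        rw [lintegral_map (by fun_prop) (hZ.prodMk hY)]
    _ = ∫⁻ z, u z * ∫⁻ y, v y ∂(κ z) ∂(μ.map Z) := by
        rw [heq, Measure.lintegral_compProd (by fun_prop)]
        exact lintegral_congr fun z => lintegral_const_mul (u z) hv
    _ = _ := by
        rw [lintegral_map (f := fun z => u z * ∫⁻ y, v y ∂(κ z)) (hu.mul hv.lintegral_kernel) hZ]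

/-- Finiteness of the losses of `t` passes to those of `p` through the comparison of sums; the
product is then the exponential of `η` times a nonnegative loss gap. -/
theorem one_le_prod_lossRatio {ι : Type*} [Fintype ι] {loss : ℝ → ℝ → ℝ≥0∞} {η : ℝ} (hη : 0 ≤ η)
    {p t y : ι → ℝ} (ht : ∀ i, loss (t i) (y i) ≠ ⊤)
    (hle : ∑ i, loss (p i) (y i) ≤ ∑ i, loss (t i) (y i)) :
    1 ≤ ∏ i, lossRatio loss η (p i) (t i) (y i) := by
  have htop : ∑ i, loss (t i) (y i) ≠ ⊤ := ENNReal.sum_ne_top.2 fun i _ => ht i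
  have hp : ∀ i, loss (p i) (y i) ≠ ⊤ := fun i =>
    ENNReal.sum_ne_top.1 (ne_top_of_le_ne_top htop hle) i (Finset.mem_univ i)
  have hreal := ENNReal.toReal_mono htop hle
  rw [ENNReal.toReal_sum fun i _ => hp i, ENNReal.toReal_sum fun i _ => ht i] at hreal
  simp only [lossRatio, if_neg (hp _)]
  rw [← ENNReal.ofReal_prod_of_nonneg fun i _ => (Real.exp_pos _).le, ← Real.exp_sum,
    ← Finset.mul_sum, Finset.sum_sub_distrib, ENNReal.one_le_ofReal, Real.one_le_exp_iff]
  exact mul_nonneg hη (sub_nonneg.2 hreal)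

variable {X : Type u} {A : Type v} [MeasurableSpace X] [MeasurableSpace A] {M : MDP X A}
  {F : FunctionClass X A M.horizon}

/-- The ratio of the prediction of `g` against the Bellman backup of `f`, on a transition. -/
noncomputable def tdRatio (loss : ℝ → ℝ → ℝ≥0∞) (η : ℝ) (M : MDP X A) (h : ℕ) (g f : X × A → ℝ)
    (τ : Transition X A) : ℝ≥0∞ :=
  lossRatio loss η (g τ.1) (M.bellman h f τ.1) (target f τ.2)

variable {loss : ℝ → ℝ → ℝ≥0∞} {D : ℝ → ℝ → ℝ} {η c b : ℝ}

theorem LossControls.measurable_tdRatio (hL : LossControls loss D η c b)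
    (hF : BellmanComplete M F) (G : GreedyRule F) {h : ℕ} (hh : h < M.horizon)
    {g f : X × A → ℝ} (hg : g ∈ F.cls h) (hf : f ∈ F.cls (h + 1)) :
    Measurable (tdRatio loss η M h g f) :=
  hL.measurable_lossRatio.comp
    (((FunctionClass.measurable_of_mem hh.le hg).comp measurable_fst).prodMk
      (((FunctionClass.measurable_of_mem hh.le (hF h hh f hf)).comp measurable_fst).prodMk
        ((G.measurable_target hh hf).comp measurable_snd)))

theorem LossControls.discrepancy_mem (hL : LossControls loss D η c b)
    (hF : BellmanComplete M F) {h : ℕ} (hh : h < M.horizon)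
    {g f : X × A → ℝ} (hg : g ∈ F.cls h) (hf : f ∈ F.cls (h + 1)) (z : X × A) :
    D (g z) (M.bellman h f z) ∈ Set.Icc (0 : ℝ) 1 :=
  hL.D_mem _ (FunctionClass.mem_Icc_of_mem hh.le hg z) _
    (FunctionClass.mem_Icc_of_mem hh.le (hF h hh f hf) z)

theorem LossControls.measurable_discrepancy (hL : LossControls loss D η c b)
    (hF : BellmanComplete M F) {h : ℕ} (hh : h < M.horizon)
    {g f : X × A → ℝ} (hg : g ∈ F.cls h) (hf : f ∈ F.cls (h + 1)) :
    Measurable fun z => D (g z) (M.bellman h f z) :=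
  hL.measurable_D.comp ((FunctionClass.measurable_of_mem hh.le hg).prodMk
    (FunctionClass.measurable_of_mem hh.le (hF h hh f hf)))

theorem MDP.integral_map_target {h : ℕ} (z : X × A) {f : X × A → ℝ} (hm : Measurable (target f)) :
    ∫ y, y ∂((M.outcome h z).map (target f)) = M.bellman h f z :=
  integral_map hm.aemeasurable aestronglyMeasurable_id

/-- The conditional bound `1 - c D` is affine in `D`, so it can be averaged over `m` before `1 - x ≤
exp(-x)` is applied. A pointwise bound `exp(-c D)` would not suffice, as Jensen's inequality goes
the wrong way. -/
theorem LossControls.lintegral_tdRatio_le (hL : LossControls loss D η c b)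
    (hF : BellmanComplete M F) (G : GreedyRule F) {h : ℕ} (hh : h < M.horizon)
    {g f : X × A → ℝ} (hg : g ∈ F.cls h) (hf : f ∈ F.cls (h + 1))
    (hT : ∀ z, ∀ᵐ o ∂(M.outcome h z), target f o ∈ Set.Icc 0 b)
    (m : Measure (X × A)) [IsProbabilityMeasure m] :
    ∫⁻ τ, tdRatio loss η M h g f τ ∂(m ⊗ₘ M.outcome h) ≤
      ENNReal.ofReal (Real.exp (-(c * ∫ z, D (g z) (M.bellman h f z) ∂m))) := by
  have hm := G.measurable_target hh hf
  rw [Measure.lintegral_compProd (hL.measurable_tdRatio hF G hh hg hf)]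
  have hD := hL.discrepancy_mem hF hh hg hf
  have hi : Integrable (fun z => D (g z) (M.bellman h f z)) m :=
    integrable_of_mem_Icc (hL.measurable_discrepancy hF hh hg hf) hD
  calc ∫⁻ z, ∫⁻ o, tdRatio loss η M h g f (z, o) ∂(M.outcome h z) ∂m
      ≤ ∫⁻ z, ENNReal.ofReal (1 - c * D (g z) (M.bellman h f z)) ∂m := by
        refine lintegral_mono fun z => ?_
        have hmean := M.integral_map_target (h := h) z hm
        have hmem : M.bellman h f z ∈ Set.Icc (0 : ℝ) 1 :=
          FunctionClass.mem_Icc_of_mem hh.le (hF h hh f hf) z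
        have key := hL.lintegral_le ((M.outcome h z).map (target f))
          (Measure.isProbabilityMeasure_map hm.aemeasurable)
          ((ae_map_iff hm.aemeasurable measurableSet_Icc).2 (hT z)) (by rwa [hmean]) (g z)
          (FunctionClass.mem_Icc_of_mem hh.le hg z)
        rw [hmean, lintegral_map (f := fun y => lossRatio loss η (g z) (M.bellman h f z) y)
          (hL.measurable_lossRatio.comp (by fun_prop :
            Measurable fun y : ℝ => (g z, M.bellman h f z, y))) hm] at key
        exact key
    _ = ENNReal.ofReal (∫ z, (1 - c * D (g z) (M.bellman h f z)) ∂m) := by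
        have hi' : Integrable (fun z => 1 - c * D (g z) (M.bellman h f z)) m :=
          (integrable_const _).sub (hi.const_mul c)
        rw [ofReal_integral_eq_lintegral_ofReal hi']
        refine ae_of_all _ fun z => ?_
        have := mul_le_mul hL.c_le_one (hD z).2 (hD z).1 zero_le_one
        simp only [Pi.zero_apply]
        linarith
    _ ≤ _ := by
        refine ENNReal.ofReal_le_ofReal ?_
        rw [integral_sub (integrable_const _) (hi.const_mul c), integral_const_mul]
        simp only [integral_const, probReal_univ, smul_eq_mul, one_mul]
        linarith [Real.add_one_le_exp (-(c * ∫ z, D (g z) (M.bellman h f z) ∂m))]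

theorem LossControls.ae_ne_top_of_compProd (hL : LossControls loss D η c b)
    (hF : BellmanComplete M F) (G : GreedyRule F) {h : ℕ} (hh : h < M.horizon)
    {f : X × A → ℝ} (hf : f ∈ F.cls (h + 1))
    (hT : ∀ z, ∀ᵐ o ∂(M.outcome h z), target f o ∈ Set.Icc 0 b)
    (m : Measure (X × A)) [IsProbabilityMeasure m] :
    ∀ᵐ τ ∂(m ⊗ₘ M.outcome h), loss (M.bellman h f τ.1) (target f τ.2) ≠ ⊤ := by
  have hm := G.measurable_target hh hf
  have hb := FunctionClass.measurable_of_mem hh.le (hF h hh f hf)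
  refine Measure.ae_compProd_of_ae_ae ?_ (ae_of_all _ fun z => ?_)
  · have : Measurable fun τ : Transition X A => loss (M.bellman h f τ.1) (target f τ.2) :=
      hL.measurable_loss.comp ((hb.comp measurable_fst).prodMk (hm.comp measurable_snd))
    exact (this (measurableSet_singleton _)).compl
  · have hmean := M.integral_map_target (h := h) z hm
    have key := hL.ae_ne_top ((M.outcome h z).map (target f))
      (Measure.isProbabilityMeasure_map hm.aemeasurable)
      ((ae_map_iff hm.aemeasurable measurableSet_Icc).2 (hT z))
      (by rw [hmean]; exact FunctionClass.mem_Icc_of_mem hh.le (hF h hh f hf) z)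
    rw [hmean] at key
    exact ae_of_ae_map hm.aemeasurable key

theorem MDP.dataLaw_congr {ua : Bool} {π π' : Policy X A} {h : ℕ}
    (hp : ∀ t ≤ h, π.act t = π'.act t) : M.dataLaw ua π h = M.dataLaw ua π' h := by
  have := M.stateLaw_congr (act := π.act) (act' := π'.act) h fun t ht => hp t ht.le
  cases ua with
  | false => rw [dataLaw_false, dataLaw_false, visit_eq, visit_eq, this, hp h le_rfl]
  | true => simp [dataLaw, this]

/-! ### The exponential process along a run. -/

namespace FQIRun

variable {G : GreedyRule F} {ν : Fin M.horizon → Measure (X × A)} {N K : ℕ} {ua : Bool}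
  {Ω : Type w} [mΩ : MeasurableSpace Ω] {μ : Measure Ω}

variable (R : FQIRun M F G ν N K ua loss μ)

theorem f_mem_cls {k : ℕ} (hk : k < K) (ω : Ω) : ∀ h ≤ M.horizon, R.f k ω h ∈ F.cls h := by
  intro h hh
  rcases hh.eq_or_lt with rfl | hlt
  · rw [R.f_terminal k hk, F.terminal]; simp
  · exact R.f_mem k hk ω ⟨h, hlt⟩

/-- Every function of the predictors of a round is known before the round. -/
theorem measurable_comp_f {k : ℕ} (hk : k < K) {β : Type*} [MeasurableSpace β]
    (Φ : (Fin M.horizon → X × A → ℝ) → β) :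
    Measurable[R.info k] fun ω => Φ fun h => R.f k ω h := by
  classical
  intro S _
  -- The predictors take finitely many values, so the preimage is a finite union of known events and
  -- `Φ` may be arbitrary.
  have : (fun ω => Φ fun h => R.f k ω h) ⁻¹' S =
      ⋃ φ ∈ (Fintype.piFinset fun h : Fin M.horizon => F.cls h).filter (fun φ => Φ φ ∈ S),
        ⋂ h : Fin M.horizon, {ω | R.f k ω h = φ h} := by
    ext ω
    simp only [Set.mem_preimage, Set.mem_iUnion, Set.mem_iInter, Set.mem_ofPred_eq,
      Finset.mem_filter, Fintype.mem_piFinset, exists_prop]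
    constructor
    · exact fun h => ⟨_, ⟨fun h => R.f_mem k hk ω h, h⟩, fun _ => rfl⟩
    · rintro ⟨φ, ⟨_, h2⟩, h3⟩
      rwa [funext h3]
  rw [this]
  exact Finset.measurableSet_biUnion _ fun φ _ =>
    MeasurableSet.iInter fun h => R.f_measurable k hk h (φ h)

/-- Extend a tuple of predictors by zero after the last step. -/
noncomputable def extend (φ : Fin M.horizon → X × A → ℝ) (h : ℕ) : X × A → ℝ :=
  if hh : h < M.horizon then φ ⟨h, hh⟩ else 0

/-- Nothing is known about `R.f k ω` beyond the horizon, not even measurability; replacing that tail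
by zero makes the relevant laws functions of a finite tuple. -/
theorem policy_extend_act (k : ℕ) (ω : Ω) {h : ℕ} (hh : h < M.horizon) :
    (G.policy (R.f k ω)).act h = (G.policy (extend (M := M) fun h => R.f k ω h)).act h := by
  simp [GreedyRule.policy, extend, hh]

theorem measurable_integral_dataLaw {k : ℕ} (hk : k < K) (h : Fin M.horizon) (ψ : X × A → ℝ) :
    Measurable[R.info k] fun ω => ∫ z, ψ z ∂(M.dataLaw ua (G.policy (R.f k ω)) h) := by
  have h1 (ω : Ω) : M.dataLaw ua (G.policy (R.f k ω)) h =
      M.dataLaw ua (G.policy (extend (M := M) fun h => R.f k ω h)) h :=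
    MDP.dataLaw_congr fun t ht => R.policy_extend_act k ω (ht.trans_lt h.2)
  simp only [h1]
  exact R.measurable_comp_f hk
    (fun φ => ∫ z, ψ z ∂(M.dataLaw ua (G.policy (extend φ)) h))

theorem lintegral_mul_on [IsProbabilityMeasure μ] (hua : ua = true → Finite A) {k : ℕ} (hk : k < K) {Z : Ω → ℝ≥0∞}
    (hZ : Measurable[R.info k] Z) (h : Fin M.horizon) {v : Transition X A → ℝ≥0∞}
    (hv : Measurable v) :
    ∫⁻ ω, Z ω * v (R.on k ω h) ∂μ =
      ∫⁻ ω, Z ω * ∫⁻ τ, v τ ∂(M.dataLaw ua (G.policy (R.f k ω)) h ⊗ₘ M.outcome h) ∂μ := by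
  have := G.nonempty_action
  have hcongr (ω : Ω) : M.rollIn ua (G.policy (R.f k ω)) =
      M.rollIn ua (G.policy (extend (M := M) fun h => R.f k ω h)) :=
    M.rollIn_congr fun t ht => R.policy_extend_act k ω ht
  let κ : @Kernel Ω (Fin M.horizon → Transition X A) (R.info k) _ :=
    @Kernel.mk Ω (Fin M.horizon → Transition X A) (R.info k) _
      (fun ω => M.rollIn ua (G.policy (R.f k ω))) (by
        simp only [hcongr]
        exact R.measurable_comp_f hk fun φ => M.rollIn ua (G.policy (extend φ)))
  have hκ : @IsMarkovKernel Ω _ (R.info k) _ κ :=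
    @IsMarkovKernel.mk Ω _ (R.info k) _ κ
      fun ω => M.isProbabilityMeasure_rollIn hua (G.policy (R.f k ω))
  have hon : Measurable (R.on k) := (R.on_measurable k hk).mono (R.info.le _) le_rfl
  have hle := R.info.le k
  have hmap (ω : Ω) : ∫⁻ τ, v τ ∂(M.dataLaw ua (G.policy (R.f k ω)) h ⊗ₘ M.outcome h) =
      ∫⁻ τ, v (τ h) ∂(M.rollIn ua (G.policy (R.f k ω))) := by
    rw [← M.rollIn_map_apply hua, lintegral_map hv (measurable_pi_apply h)]
  simp only [hmap]
  -- The conditioning variable is the identity from `Ω` to `Ω` with the coarser sigma-algebra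
  -- `R.info k`.
  refine @lintegral_mul_of_condLaw Ω Ω (Fin M.horizon → Transition X A) mΩ (R.info k) _ μ _
    (fun ω => ω) (fun s hs => hle s hs) (R.on k) hon κ hκ ?_ Z hZ (fun τ => v (τ h))
    (hv.comp (measurable_pi_apply h))
  intro s hs t ht
  have hlaw := R.on_law k hk t ht
  have hs' := hle s hs
  have ht' : MeasurableSet (R.on k ⁻¹' t) := hon ht
  have hreal : ∫ ω in s, (M.rollIn ua (G.policy (R.f k ω))).real t ∂μ =
      μ.real (s ∩ R.on k ⁻¹' t) := by
    rw [← setIntegral_congr_ae hs' (hlaw.mono fun ω hω _ => hω),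
      setIntegral_condExp hle ((integrable_const (1 : ℝ)).indicator ht') hs,
      setIntegral_indicator ht']
    simp
  have hprob (ω : Ω) : IsProbabilityMeasure (M.rollIn ua (G.policy (R.f k ω))) :=
    M.isProbabilityMeasure_rollIn hua (G.policy (R.f k ω))
  have hm : Measurable fun ω => (M.rollIn ua (G.policy (R.f k ω))).real t := by
    refine Measurable.mono ?_ hle le_rfl
    simp only [hcongr]
    exact R.measurable_comp_f hk fun φ => (M.rollIn ua (G.policy (extend φ))).real t
  have hint : Integrable (fun ω => (M.rollIn ua (G.policy (R.f k ω))).real t) (μ.restrict s) :=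
    integrable_of_mem_Icc (a := 0) (b := 1) hm fun ω => ⟨measureReal_nonneg, measureReal_le_one⟩
  have hof := ofReal_integral_eq_lintegral_ofReal hint (ae_of_all _ fun ω => measureReal_nonneg)
  rw [hreal, ofReal_measureReal] at hof
  have e (ω : Ω) : ENNReal.ofReal ((M.rollIn ua (G.policy (R.f k ω))).real t) =
      M.rollIn ua (G.policy (R.f k ω)) t := ofReal_measureReal
  simp only [e] at hof
  exact hof

variable (D η c)

/-- The exponential process that controls the discrepancy of the pair `(g, f)` at step `h`. -/
noncomputable def potential (h : Fin M.horizon) (g f : X × A → ℝ) (k : ℕ) (ω : Ω) : ℝ≥0∞ :=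
  (∏ i, tdRatio loss η M h g f (R.off h i ω)) *
      ENNReal.ofReal (Real.exp (N * (c * ∫ z, D (g z) (M.bellman h f z) ∂(ν h)))) *
    ∏ j ∈ Finset.range k, (tdRatio loss η M h g f (R.on j ω h) *
      ENNReal.ofReal (Real.exp (c * ∫ z, D (g z) (M.bellman h f z)
        ∂(M.dataLaw ua (G.policy (R.f j ω)) h))))

variable {D η c}

theorem measurable_potential (hL : LossControls loss D η c b) (hF : BellmanComplete M F)
    {h : Fin M.horizon} {g f : X × A → ℝ} (hg : g ∈ F.cls h) (hf : f ∈ F.cls (h + 1))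
    {k : ℕ} (hk : k ≤ K) : Measurable[R.info k] (R.potential D η c h g f k) := by
  have hw := hL.measurable_tdRatio hF G h.2 hg hf
  refine Measurable.mul (Measurable.mul ?_ measurable_const) ?_
  · exact Finset.measurable_prod _ fun i _ =>
      (hw.comp (R.off_measurable h i)).mono (R.info.mono k.zero_le) le_rfl
  · refine Finset.measurable_prod _ fun j hj => Measurable.mul ?_ ?_
    · have hjk : j < k := Finset.mem_range.1 hj
      exact (hw.comp ((measurable_pi_apply h).comp (R.on_measurable j (hjk.trans_le hk)))).mono
        (R.info.mono hjk) le_rfl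
    · have hjk : j < k := Finset.mem_range.1 hj
      have := (R.measurable_integral_dataLaw (hjk.trans_le hk) h
        fun z => D (g z) (M.bellman h f z)).mono (R.info.mono hjk.le) le_rfl
      exact ENNReal.measurable_ofReal.comp (Real.measurable_exp.comp (this.const_mul c))

/-- A supermartingale argument: independence makes the offline factor have mean at most one, and,
given the past, the mean of each new ratio is at most the inverse of its exponential compensator. -/
theorem lintegral_potential_le_one [IsProbabilityMeasure μ] (hL : LossControls loss D η c b) (hF : BellmanComplete M F)
    (hua : ua = true → Finite A) [∀ h, IsProbabilityMeasure (ν h)]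
    {h : Fin M.horizon} {g f : X × A → ℝ} (hg : g ∈ F.cls h) (hf : f ∈ F.cls (h + 1))
    (hT : ∀ z, ∀ᵐ o ∂(M.outcome h z), target f o ∈ Set.Icc 0 b) :
    ∀ {k : ℕ}, k ≤ K → ∫⁻ ω, R.potential D η c h g f k ω ∂μ ≤ 1 := by
  have hw := hL.measurable_tdRatio hF G h.2 hg hf
  have := G.nonempty_action
  intro k
  induction k with
  | zero =>
    intro _
    have hoff : ∀ i, Measurable (R.off h i) := fun i =>
      (R.off_measurable h i).mono (R.info.le 0) le_rfl
    simp only [potential, Finset.range_zero, Finset.prod_empty, mul_one]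
    have hprod := lintegral_prod_eq_prod_lintegral_of_indepFun Finset.univ _
      ((R.off_indep h).comp (fun _ => tdRatio loss η M h g f) fun _ => hw)
      fun i => hw.comp (hoff i)
    simp only [Function.comp_apply] at hprod
    rw [lintegral_mul_const _ (by fun_prop), hprod]
    have hi : ∀ i, ∫⁻ ω, tdRatio loss η M h g f (R.off h i ω) ∂μ ≤
        ENNReal.ofReal (Real.exp (-(c * ∫ z, D (g z) (M.bellman h f z) ∂(ν h)))) := by
      intro i
      have e : ∫⁻ ω, tdRatio loss η M h g f (R.off h i ω) ∂μ =
          ∫⁻ τ, tdRatio loss η M h g f τ ∂(μ.map (R.off h i)) :=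
        (lintegral_map hw (hoff i)).symm
      rw [e, R.off_law h i]
      exact hL.lintegral_tdRatio_le hF G h.2 hg hf hT (ν h)
    calc _ ≤ (∏ _i : Fin N,
          ENNReal.ofReal (Real.exp (-(c * ∫ z, D (g z) (M.bellman h f z) ∂(ν h))))) *
          ENNReal.ofReal (Real.exp (N * (c * ∫ z, D (g z) (M.bellman h f z) ∂(ν h)))) := by
          gcongr with i
          exact hi i
      _ = 1 := by
          rw [Finset.prod_const, Finset.card_univ, Fintype.card_fin,
            ← ENNReal.ofReal_pow (Real.exp_pos _).le, ← Real.exp_nat_mul,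
            ← ENNReal.ofReal_mul (Real.exp_pos _).le, ← Real.exp_add]
          simp
  | succ k ih =>
    intro hk
    have hk' : k < K := hk
    refine le_trans ?_ (ih hk'.le)
    have hE := R.measurable_integral_dataLaw hk' h fun z => D (g z) (M.bellman h f z)
    have hZ : Measurable[R.info k] fun ω => R.potential D η c h g f k ω *
        ENNReal.ofReal (Real.exp (c * ∫ z, D (g z) (M.bellman h f z)
          ∂(M.dataLaw ua (G.policy (R.f k ω)) h))) :=
      (R.measurable_potential hL hF hg hf hk'.le).mul
        (ENNReal.measurable_ofReal.comp (Real.measurable_exp.comp (hE.const_mul c)))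
    calc ∫⁻ ω, R.potential D η c h g f (k + 1) ω ∂μ
        = ∫⁻ ω, (R.potential D η c h g f k ω *
            ENNReal.ofReal (Real.exp (c * ∫ z, D (g z) (M.bellman h f z)
              ∂(M.dataLaw ua (G.policy (R.f k ω)) h)))) *
            tdRatio loss η M h g f (R.on k ω h) ∂μ := by
          refine lintegral_congr fun ω => ?_
          rw [potential, Finset.prod_range_succ, potential]
          ring
      _ ≤ ∫⁻ ω, R.potential D η c h g f k ω ∂μ := by
          rw [R.lintegral_mul_on hua hk' hZ h hw]
          refine lintegral_mono fun ω => ?_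
          have := M.isProbabilityMeasure_dataLaw hua (G.policy (R.f k ω)) h
          have hle := hL.lintegral_tdRatio_le hF G h.2 hg hf hT
            (M.dataLaw ua (G.policy (R.f k ω)) h)
          refine (mul_le_mul_right hle _).trans (le_of_eq ?_)
          rw [mul_assoc, ← ENNReal.ofReal_mul (Real.exp_pos _).le, ← Real.exp_add]
          simp

theorem ae_off_ne_top (hL : LossControls loss D η c b) (hF : BellmanComplete M F)
    [∀ h, IsProbabilityMeasure (ν h)] {h : Fin M.horizon} {f : X × A → ℝ} (hf : f ∈ F.cls (h + 1))
    (hT : ∀ z, ∀ᵐ o ∂(M.outcome h z), target f o ∈ Set.Icc 0 b) (i : Fin N) :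
    ∀ᵐ ω ∂μ, loss (M.bellman h f (R.off h i ω).1) (target f (R.off h i ω).2) ≠ ⊤ := by
  have h1 := hL.ae_ne_top_of_compProd hF G h.2 hf hT (ν h)
  rw [← R.off_law h i] at h1
  exact ae_of_ae_map ((R.off_measurable h i).mono (R.info.le 0) le_rfl).aemeasurable h1

theorem ae_on_ne_top [IsProbabilityMeasure μ] (hL : LossControls loss D η c b) (hF : BellmanComplete M F)
    (hua : ua = true → Finite A) {h : Fin M.horizon} {f : X × A → ℝ} (hf : f ∈ F.cls (h + 1))
    (hT : ∀ z, ∀ᵐ o ∂(M.outcome h z), target f o ∈ Set.Icc 0 b) {k : ℕ} (hk : k < K) :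
    ∀ᵐ ω ∂μ, loss (M.bellman h f (R.on k ω h).1) (target f (R.on k ω h).2) ≠ ⊤ := by
  have := G.nonempty_action
  have hon : Measurable (R.on k) := (R.on_measurable k hk).mono (R.info.le _) le_rfl
  have hb := FunctionClass.measurable_of_mem h.2.le (hF h h.2 f hf)
  have hm : Measurable fun τ : Transition X A => loss (M.bellman h f τ.1) (target f τ.2) :=
    hL.measurable_loss.comp ((hb.comp measurable_fst).prodMk
      ((G.measurable_target h.2 hf).comp measurable_snd))
  set B := {τ : Transition X A | loss (M.bellman h f τ.1) (target f τ.2) = ⊤} with hB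
  have hBm : MeasurableSet B := hm (measurableSet_singleton _)
  -- The constant weight and the indicator of the infinite-loss set reduce the claim to a null set
  -- under each conditional law.
  have key := R.lintegral_mul_on hua hk (Z := fun _ => 1) measurable_const h
    (v := B.indicator 1) (measurable_one.indicator hBm)
  simp only [one_mul] at key
  have hz (ω : Ω) : ∫⁻ τ, B.indicator 1 τ
      ∂(M.dataLaw ua (G.policy (R.f k ω)) h ⊗ₘ M.outcome h) = 0 := by
    have := M.isProbabilityMeasure_dataLaw hua (G.policy (R.f k ω)) h
    have h1 := hL.ae_ne_top_of_compProd hF G h.2 hf hT (M.dataLaw ua (G.policy (R.f k ω)) h)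
    rw [lintegral_indicator_one hBm]
    rw [ae_iff] at h1
    simpa [hB] using h1
  simp only [hz, lintegral_zero] at key
  have hv : Measurable fun ω => B.indicator (1 : Transition X A → ℝ≥0∞) (R.on k ω h) :=
    (measurable_one.indicator hBm).comp ((measurable_pi_apply h).comp hon)
  rw [lintegral_eq_zero_iff hv] at key
  filter_upwards [key] with ω hω hcon
  have : R.on k ω h ∈ B := hcon
  simp [this] at hω

end FQIRun

end Concentration

/-! ### Pigeonhole for the eluder dimension. -/

section Eluder

/-- Greedy colouring: if every one of the `⌊B/ε⌋ + 1` colours already carried weight above `ε` for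
the new index, the total would exceed `B`. -/
theorem exists_coloring {x : ℕ → ℕ → ℝ} (hx : ∀ k i, 0 ≤ x k i) {B ε : ℝ} (hε : 0 < ε)
    {S : Finset ℕ} (hB : ∀ k ∈ S, ∑ i ∈ Finset.range k, x k i ≤ B) (n : ℕ) :
    ∃ col : ℕ → Fin (⌊B / ε⌋₊ + 1), ∀ k ∈ S, k < n →
      ∑ i ∈ S.filter (fun i => i < k ∧ col i = col k), x k i ≤ ε := by
  classical
  induction n with
  | zero => exact ⟨fun _ => 0, fun k _ hk => absurd hk k.not_lt_zero⟩
  | succ n ih =>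
    obtain ⟨col, hcol⟩ := ih
    by_cases hn : n ∈ S
    · obtain ⟨j, hj⟩ : ∃ j, ∑ i ∈ S.filter (fun i => i < n ∧ col i = j), x n i ≤ ε := by
        by_contra! hcon
        have h1 : ∑ j, ∑ i ∈ S.filter (fun i => i < n ∧ col i = j), x n i ≤ B := by
          have : ∀ j, S.filter (fun i => i < n ∧ col i = j) =
              (S.filter (· < n)).filter (fun i => col i = j) := fun j =>
            (Finset.filter_filter _ _ _).symm
          simp only [this]
          rw [Finset.sum_fiberwise]
          exact (Finset.sum_le_sum_of_subset_of_nonneg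
            (fun i hi => Finset.mem_range.2 (Finset.mem_filter.1 hi).2) fun i _ _ => hx n i).trans
            (hB n hn)
        have h2 : ∑ _j : Fin (⌊B / ε⌋₊ + 1), ε ≤
            ∑ j, ∑ i ∈ S.filter (fun i => i < n ∧ col i = j), x n i :=
          Finset.sum_le_sum fun j _ => (hcon j).le
        have h3 := (div_lt_iff₀ hε).1 (Nat.lt_floor_add_one (B / ε))
        simp at h2
        linarith
      refine ⟨Function.update col n j, fun k hk hkn => ?_⟩
      have hne : ∀ i, i < k → i ≠ n := fun i hi => by omega
      have hfil : ∀ j', S.filter (fun i => i < k ∧ Function.update col n j i = j') =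
          S.filter (fun i => i < k ∧ col i = j') := fun j' => by
        refine Finset.filter_congr fun i _ => and_congr_right fun hi => ?_
        rw [Function.update_of_ne (hne i hi)]
      rw [hfil]
      rcases (Nat.lt_succ_iff.1 hkn).eq_or_lt with rfl | hlt
      · rwa [Function.update_self]
      · rw [Function.update_of_ne hlt.ne]
        exact hcol k hk hlt
    · refine ⟨col, fun k hk hkn => hcol k hk ?_⟩
      rcases (Nat.lt_succ_iff.1 hkn).eq_or_lt with rfl | hlt
      · exact absurd hk hn
      · exact hlt

/-- Each colour class has small weight on its own past, so the hypothesis on subsets bounds it by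
`d`. -/
theorem card_le_mul_of_forall_subset {x : ℕ → ℕ → ℝ} (hx : ∀ k i, 0 ≤ x k i) {B ε : ℝ}
    (hε : 0 < ε) {S : Finset ℕ} (hB : ∀ k ∈ S, ∑ i ∈ Finset.range k, x k i ≤ B) {d : ℕ}
    (hd : ∀ T ⊆ S, (∀ k ∈ T, ∑ i ∈ T.filter (· < k), x k i ≤ ε) → T.card ≤ d) :
    S.card ≤ (⌊B / ε⌋₊ + 1) * d := by
  classical
  obtain ⟨n, hn⟩ : ∃ n, ∀ k ∈ S, k < n :=
    ⟨S.sup id + 1, fun k hk => Nat.lt_succ_of_le (Finset.le_sup (f := id) hk)⟩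
  obtain ⟨col, hcol⟩ := exists_coloring hx hε hB n
  rw [Finset.card_eq_sum_card_fiberwise (f := col) (t := Finset.univ) fun _ _ => by simp]
  refine (Finset.sum_le_card_nsmul _ _ d fun j _ => ?_).trans (by simp)
  refine hd _ (Finset.filter_subset _ _) fun k hk => ?_
  obtain ⟨hkS, hkj⟩ := Finset.mem_filter.1 hk
  convert hcol k hkS (hn k hkS) using 2
  ext i
  simp only [Finset.mem_filter, hkj]
  tauto

variable {S : Type*} [MeasurableSpace S] {q : ℕ} {Ψ : Set (S → ℝ)} {P : Set (Measure S)} {ε₀ : ℝ}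

/-- An `ℓ_1` constraint with level `ε` implies the `ℓ_q` constraint, since every summand is at most
`ε`. Hence one pigeonhole argument serves both `q = 1` and `q = 2`. -/
theorem card_le_of_eluderDim_le (hq : q ≠ 0) {d : ℕ} (hd : eluderDim q Ψ P ε₀ ≤ d) {ε : ℝ}
    (hε : ε₀ ≤ ε) {m : ℕ → Measure S} {ψ : ℕ → S → ℝ} {T : Finset ℕ}
    (hm : ∀ k ∈ T, m k ∈ P) (hψ : ∀ k ∈ T, ψ k ∈ Ψ) (h1 : ∀ k ∈ T, ε < |∫ s, ψ k s ∂(m k)|)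
    (h2 : ∀ k ∈ T, ∑ i ∈ T.filter (· < k), |∫ s, ψ k s ∂(m i)| ≤ ε) : T.card ≤ d := by
  classical
  let e := T.orderEmbOfFin rfl
  have he : ∀ i, e i ∈ T := T.orderEmbOfFin_mem rfl
  have hmem : T.card ∈ {L : ℕ | ∃ ε ≥ ε₀, ∃ m : Fin L → Measure S, (∀ t, m t ∈ P) ∧
      ∀ t, ∃ ψ ∈ Ψ, ε < |∫ s, ψ s ∂(m t)| ∧
        ∑ i ∈ Finset.univ.filter (· < t), |∫ s, ψ s ∂(m i)| ^ q ≤ ε ^ q} := by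
    refine ⟨ε, hε, fun t => m (e t), fun t => hm _ (he t), fun t =>
      ⟨ψ (e t), hψ _ (he t), h1 _ (he t), ?_⟩⟩
    have hsum : ∑ i ∈ Finset.univ.filter (· < t), |∫ s, ψ (e t) s ∂(m (e i))| ^ q =
        ∑ i ∈ T.filter (· < e t), |∫ s, ψ (e t) s ∂(m i)| ^ q := by
      refine Finset.sum_nbij (fun i => e i) ?_ e.injective.injOn ?_ fun _ _ => rfl
      · intro i hi
        exact Finset.mem_filter.2 ⟨he i, e.lt_iff_lt.2 (Finset.mem_filter.1 hi).2⟩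
      · intro k hk
        obtain ⟨hkT, hkt⟩ := Finset.mem_filter.1 hk
        have : k ∈ Set.range e := by rw [Finset.range_orderEmbOfFin]; exact hkT
        obtain ⟨i, rfl⟩ := this
        exact ⟨i, by simpa using e.lt_iff_lt.1 hkt, rfl⟩
    rw [hsum]
    have hle := h2 _ (he t)
    have hε0 : 0 ≤ ε := (Finset.sum_nonneg fun i _ => abs_nonneg _).trans hle
    calc ∑ i ∈ T.filter (· < e t), |∫ s, ψ (e t) s ∂(m i)| ^ q
        ≤ ∑ i ∈ T.filter (· < e t), |∫ s, ψ (e t) s ∂(m i)| * ε ^ (q - 1) := by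
          refine Finset.sum_le_sum fun i hi => ?_
          rw [← mul_pow_sub_one hq]
          refine mul_le_mul_of_nonneg_left (pow_le_pow_left₀ (abs_nonneg _) ?_ _) (abs_nonneg _)
          exact (Finset.single_le_sum (f := fun i => |∫ s, ψ (e t) s ∂(m i)|)
            (fun i _ => abs_nonneg _) hi).trans hle
      _ ≤ ε * ε ^ (q - 1) := by
          rw [← Finset.sum_mul]
          exact mul_le_mul_of_nonneg_right hle (by positivity)
      _ = ε ^ q := mul_pow_sub_one hq ε
  have : (T.card : ℕ∞) ≤ eluderDim q Ψ P ε₀ := by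
    unfold eluderDim
    exact le_iSup₂ (f := fun (L : ℕ) (_ : L ∈ {L : ℕ | ∃ ε ≥ ε₀, ∃ m : Fin L → Measure S,
      (∀ t, m t ∈ P) ∧ ∀ t, ∃ ψ ∈ Ψ, ε < |∫ s, ψ s ∂(m t)| ∧
        ∑ i ∈ Finset.univ.filter (· < t), |∫ s, ψ s ∂(m i)| ^ q ≤ ε ^ q}) => (L : ℕ∞)) T.card hmem
  exact_mod_cast this.trans hd

/-- A discrete layer-cake formula. The thresholds start at `1/K`, the smallest scale the eluder
dimension sees. -/
theorem le_inv_add_inv_mul_card {K : ℕ} (hK : 0 < K) {a : ℝ} (h1 : a ≤ 1) :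
    a ≤ (K : ℝ)⁻¹ + (K : ℝ)⁻¹ *
      ((Finset.range K).filter fun m : ℕ => ((m : ℝ) + 1) / K < a).card := by
  have hK' : (0 : ℝ) < K := by exact_mod_cast hK
  have hsub : Finset.range (⌈a * K⌉₊ - 1) ⊆
      (Finset.range K).filter fun m : ℕ => ((m : ℝ) + 1) / K < a := by
    intro m hm
    have hm' : m + 1 < ⌈a * K⌉₊ := by have := Finset.mem_range.1 hm; omega
    have h2 := Nat.lt_ceil.1 hm'
    push_cast at h2
    refine Finset.mem_filter.2 ⟨Finset.mem_range.2 ?_, (div_lt_iff₀ hK').2 h2⟩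
    have : (m : ℝ) + 1 < K := h2.trans_le (mul_le_of_le_one_left hK'.le h1)
    have : m + 1 < K := by exact_mod_cast this
    omega
  have hc := Finset.card_le_card hsub
  rw [Finset.card_range] at hc
  have h3 : a * K ≤ ((Finset.range K).filter fun m : ℕ => ((m : ℝ) + 1) / K < a).card + 1 := by
    refine (Nat.le_ceil _).trans ?_
    have : ⌈a * K⌉₊ ≤ ((Finset.range K).filter fun m : ℕ => ((m : ℝ) + 1) / K < a).card + 1 := by omega
    exact_mod_cast this
  have h4 : (K : ℝ)⁻¹ * (a * K) = a := by field_simp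
  rw [← h4]
  conv_rhs => rw [h4]
  have := mul_le_mul_of_nonneg_left h3 (inv_nonneg.2 hK'.le)
  linarith

/-- The pigeonhole bound for the eluder dimension. -/
theorem sum_le_of_eluderDim_le (hq : q ≠ 0) {d K : ℕ} (hK : 0 < K)
    (hd : eluderDim q Ψ P (1 / (K : ℝ)) ≤ d) {B : ℝ} (hB0 : 0 ≤ B)
    {m : ℕ → Measure S} {ψ : ℕ → S → ℝ} (hm : ∀ k < K, m k ∈ P) (hψ : ∀ k < K, ψ k ∈ Ψ)
    (h1 : ∀ k < K, |∫ s, ψ k s ∂(m k)| ≤ 1)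
    (hB : ∀ k < K, ∑ i ∈ Finset.range k, |∫ s, ψ k s ∂(m i)| ≤ B) :
    ∑ k ∈ Finset.range K, |∫ s, ψ k s ∂(m k)| ≤ 1 + d + d * (B * (1 + Real.log K)) := by
  classical
  have hK' : (0 : ℝ) < K := by exact_mod_cast hK
  have hcount : ∀ j ∈ Finset.range K, (((Finset.range K).filter fun k =>
      ((j : ℝ) + 1) / K < |∫ s, ψ k s ∂(m k)|).card : ℝ) ≤ (B * K * ((j : ℝ) + 1)⁻¹ + 1) * d := by
    intro j _
    have hε : 0 < ((j : ℝ) + 1) / K := by positivity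
    set T := (Finset.range K).filter fun k => ((j : ℝ) + 1) / K < |∫ s, ψ k s ∂(m k)| with hT
    have hTK : ∀ k ∈ T, k < K := fun k hk => Finset.mem_range.1 (Finset.mem_filter.1 hk).1
    have hcard : T.card ≤ (⌊B / (((j : ℝ) + 1) / K)⌋₊ + 1) * d := by
      refine card_le_mul_of_forall_subset (x := fun k i => |∫ s, ψ k s ∂(m i)|)
        (fun _ _ => abs_nonneg _) hε (fun k hk => hB k (hTK k hk)) fun T' hT' hsum => ?_
      refine card_le_of_eluderDim_le hq hd ?_ (fun k hk => hm k (hTK k (hT' hk)))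
        (fun k hk => hψ k (hTK k (hT' hk))) (fun k hk => (Finset.mem_filter.1 (hT' hk)).2) hsum
      exact div_le_div_of_nonneg_right (by simp) hK'.le
    have hfl : (⌊B / (((j : ℝ) + 1) / K)⌋₊ : ℝ) ≤ B * K * ((j : ℝ) + 1)⁻¹ := by
      refine (Nat.floor_le (by positivity)).trans (le_of_eq ?_)
      field_simp
    calc (T.card : ℝ) ≤ ((⌊B / (((j : ℝ) + 1) / K)⌋₊ + 1) * d : ℕ) := by exact_mod_cast hcard
      _ = ((⌊B / (((j : ℝ) + 1) / K)⌋₊ : ℝ) + 1) * d := by push_cast; ring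
      _ ≤ _ := by gcongr
  have hharm : ∑ j ∈ Finset.range K, ((j : ℝ) + 1)⁻¹ ≤ 1 + Real.log K := by
    have := harmonic_le_one_add_log K
    simpa [harmonic] using this
  have hL : 0 ≤ 1 + Real.log K := by
    have := Real.log_natCast_nonneg K
    linarith
  -- Exchanging the sums leaves the number of rounds above each threshold, at most `d (B K / (j + 1)
  -- + 1)`; the harmonic sum produces the logarithm.
  calc ∑ k ∈ Finset.range K, |∫ s, ψ k s ∂(m k)|
      ≤ ∑ k ∈ Finset.range K, ((K : ℝ)⁻¹ + (K : ℝ)⁻¹ * ((Finset.range K).filter fun j : ℕ =>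
          ((j : ℝ) + 1) / K < |∫ s, ψ k s ∂(m k)|).card) :=
        Finset.sum_le_sum fun k hk => le_inv_add_inv_mul_card hK (h1 k (Finset.mem_range.1 hk))
    _ = 1 + (K : ℝ)⁻¹ * ∑ j ∈ Finset.range K, (((Finset.range K).filter fun k =>
          ((j : ℝ) + 1) / K < |∫ s, ψ k s ∂(m k)|).card : ℝ) := by
        rw [Finset.sum_add_distrib, ← Finset.mul_sum]
        congr 1
        · simp [hK'.ne']
        · simp only [Finset.card_filter, Nat.cast_sum]
          rw [Finset.sum_comm]
    _ ≤ 1 + (K : ℝ)⁻¹ * ∑ j ∈ Finset.range K, (B * K * ((j : ℝ) + 1)⁻¹ + 1) * d := by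
        gcongr with j hj
        exact hcount j hj
    _ = 1 + d + d * (B * ∑ j ∈ Finset.range K, ((j : ℝ) + 1)⁻¹) := by
        rw [← Finset.sum_mul, Finset.sum_add_distrib, ← Finset.mul_sum]
        simp only [Finset.sum_const, Finset.card_range, nsmul_eq_mul, mul_one]
        field_simp
        ring
    _ ≤ _ := by gcongr

end Eluder

/-! ### Changes of measure: coverage and uniform actions. -/

section Coverage

variable {X : Type u} {A : Type v} [MeasurableSpace X] [MeasurableSpace A] {M : MDP X A}
  {ν : Fin M.horizon → Measure (X × A)} [∀ h, IsProbabilityMeasure (ν h)]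

theorem integral_visit_le_coverage {π : Policy X A} (hC : coverage M ν π ≠ ⊤) (h : Fin M.horizon)
    {ψ : X × A → ℝ} (hm : Measurable ψ) (hψ : ∀ z, ψ z ∈ Set.Icc (0 : ℝ) 1) :
    ∫ z, ψ z ∂(M.visit π h) ≤ (coverage M ν π).toReal * ∫ z, ψ z ∂(ν h) := by
  classical
  have hle : (if M.visit π h ≪ ν h then essSup ((M.visit π h).rnDeriv (ν h)) (ν h) else ⊤) ≤
      coverage M ν π := by
    unfold coverage
    convert le_iSup (f := fun h : Fin M.horizon =>
      if M.visit π h ≪ ν h then essSup ((M.visit π h).rnDeriv (ν h)) (ν h) else ⊤) h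
  have hac : M.visit π h ≪ ν h := by
    by_contra hcon
    rw [if_neg hcon, top_le_iff] at hle
    exact hC hle
  rw [if_pos hac] at hle
  have hae : ∀ᵐ z ∂(ν h), (M.visit π h).rnDeriv (ν h) z ≤ coverage M ν π :=
    (ENNReal.ae_le_essSup _).mono fun z hz => hz.trans hle
  have hlin : ∫⁻ z, ENNReal.ofReal (ψ z) ∂(M.visit π h) ≤
      coverage M ν π * ∫⁻ z, ENNReal.ofReal (ψ z) ∂(ν h) := by
    rw [← Measure.withDensity_rnDeriv_eq _ _ hac,
      lintegral_withDensity_eq_lintegral_mul _ (Measure.measurable_rnDeriv _ _)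
        hm.ennreal_ofReal, ← lintegral_const_mul _ hm.ennreal_ofReal]
    exact lintegral_mono_ae (hae.mono fun z hz => mul_le_mul_left hz _)
  have hi1 : Integrable ψ (M.visit π h) := integrable_of_mem_Icc hm hψ
  have hi2 : Integrable ψ (ν h) := integrable_of_mem_Icc hm hψ
  rw [← ofReal_integral_eq_lintegral_ofReal hi1 (ae_of_all _ fun z => (hψ z).1),
    ← ofReal_integral_eq_lintegral_ofReal hi2 (ae_of_all _ fun z => (hψ z).1)] at hlin
  have h0 : 0 ≤ ∫ z, ψ z ∂(ν h) := integral_nonneg fun z => (hψ z).1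
  rw [← ENNReal.ofReal_toReal hC, ← ENNReal.ofReal_mul ENNReal.toReal_nonneg,
    ENNReal.ofReal_le_ofReal_iff (mul_nonneg ENNReal.toReal_nonneg h0)] at hlin
  exact hlin

/-- Test the change of measure on the constant `1`. This absorbs the additive constant of the
pigeonhole bound when the dimension is zero. -/
theorem one_le_coverage {π : Policy X A} (hC : coverage M ν π ≠ ⊤) :
    1 ≤ (coverage M ν π).toReal := by
  have := integral_visit_le_coverage hC ⟨0, M.horizon_pos⟩ (ψ := fun _ => 1) measurable_const
    fun _ => ⟨zero_le_one, le_rfl⟩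
  simpa using this

variable [Finite A]

theorem MDP.integral_dataLaw_true (π : Policy X A) (h : ℕ) {ψ : X × A → ℝ} (hm : Measurable ψ)
    (hψ : ∀ z, ψ z ∈ Set.Icc (0 : ℝ) 1) :
    ∫ z, ψ z ∂(M.dataLaw true π h) =
      ∫ x, ∫ a, ψ (x, a) ∂(uniformOn (Set.univ : Set A)) ∂(M.stateVisit π h) := by
  rw [dataLaw_true, Measure.integral_compProd (integrable_of_mem_Icc hm hψ)]
  rfl

variable [Nonempty A]

theorem MDP.integral_visit_le_card_mul (π : Policy X A) (h : ℕ) {ψ : X × A → ℝ} (hm : Measurable ψ)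
    (hψ : ∀ z, ψ z ∈ Set.Icc (0 : ℝ) 1) :
    ∫ z, ψ z ∂(M.visit π h) ≤ Nat.card A *
      ∫ x, ∫ a, ψ (x, a) ∂(uniformOn (Set.univ : Set A)) ∂(M.stateVisit π h) := by
  have hmi : Measurable fun x => ∫ a, ψ (x, a) ∂(uniformOn (Set.univ : Set A)) :=
    (hm.stronglyMeasurable.integral_prod_right').measurable
  have hmem : ∀ x, ∫ a, ψ (x, a) ∂(uniformOn (Set.univ : Set A)) ∈ Set.Icc (0 : ℝ) 1 := by
    intro x
    have hi : Integrable (fun a => ψ (x, a)) (uniformOn (Set.univ : Set A)) :=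
      integrable_of_mem_Icc (hm.comp measurable_prodMk_left) fun a => hψ (x, a)
    refine ⟨integral_nonneg fun a => (hψ (x, a)).1, ?_⟩
    have := integral_mono hi (integrable_const (1 : ℝ)) fun a => (hψ (x, a)).2
    simpa using this
  rw [stateVisit, integral_map measurable_fst.aemeasurable hmi.aestronglyMeasurable,
    ← integral_const_mul]
  refine integral_mono (integrable_of_mem_Icc hm hψ)
    ((integrable_of_mem_Icc (hmi.comp measurable_fst) fun z => hmem z.1).const_mul _) fun z => ?_
  exact le_card_mul_integral_uniformOn (hm.comp measurable_prodMk_left)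
    (fun a => (hψ (z.1, a)).1) z.2

end Coverage

/-! ### The high-probability event. -/

section Event

variable {X : Type u} {A : Type v} [MeasurableSpace X] [MeasurableSpace A]

/-- Only consecutive pairs enter the union bound, so a single factor `|F|` is enough. At the last
step the successor class is a singleton. -/
theorem FunctionClass.card_mul_card_le {H : ℕ} (F : FunctionClass X A H)
    (hne : ∀ h < H, (F.cls h).Nonempty) {h : ℕ} (hh : h < H) :
    (F.cls h).card * (F.cls (h + 1)).card ≤ F.size := by
  have h1 : ∀ j ∈ Finset.range H, 1 ≤ (F.cls j).card := fun j hj =>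
    Finset.card_pos.2 (hne j (Finset.mem_range.1 hj))
  rcases (Nat.succ_le_of_lt hh).eq_or_lt with heq | hlt
  · have : (F.cls (h + 1)).card = 1 := by
      rw [show h + 1 = H from heq, F.terminal]; rfl
    rw [this, mul_one]
    exact Finset.single_le_prod' (f := fun j => (F.cls j).card) h1 (Finset.mem_range.2 hh)
  · have hsub : ({h, h + 1} : Finset ℕ) ⊆ Finset.range H := by
      intro j hj
      simp only [Finset.mem_insert, Finset.mem_singleton] at hj
      exact Finset.mem_range.2 (by omega)
    have := Finset.prod_le_prod_of_subset_of_one_le' (f := fun j => (F.cls j).card) hsub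
      fun j hj _ => h1 j hj
    rwa [Finset.prod_pair (by omega)] at this

theorem FunctionClass.size_pos {H : ℕ} (F : FunctionClass X A H)
    (hne : ∀ h < H, (F.cls h).Nonempty) : 0 < F.size :=
  Finset.prod_pos fun j hj => Finset.card_pos.2 (hne j (Finset.mem_range.1 hj))

variable {M : MDP X A} {F : FunctionClass X A M.horizon} {loss : ℝ → ℝ → ℝ≥0∞} {D : ℝ → ℝ → ℝ}
  {η c b : ℝ} {G : GreedyRule F} {ν : Fin M.horizon → Measure (X × A)} {N K : ℕ} {ua : Bool}
  {Ω : Type w} [mΩ : MeasurableSpace Ω] {μ : Measure Ω}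

theorem FQIRun.nonempty_cls [IsProbabilityMeasure μ] (R : FQIRun M F G ν N K ua loss μ)
    (hK : 0 < K) : ∀ h < M.horizon, (F.cls h).Nonempty := by
  obtain ⟨ω⟩ := μ.nonempty_of_neZero
  exact fun h hh => ⟨_, R.f_mem 0 hK ω ⟨h, hh⟩⟩

/-- The predictors of a run fit the backups of their successors on the data at least as well as
the backups themselves, so the likelihood ratio of the data is at least one. -/
theorem FQIRun.one_le_prod_tdRatio (R : FQIRun M F G ν N K ua loss μ)
    (hL : LossControls loss D η c b) (hF : BellmanComplete M F) {k : ℕ} (hk : k < K) {ω : Ω}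
    {h : Fin M.horizon}
    (hoff : ∀ i, loss (M.bellman h (R.f k ω (h + 1)) (R.off h i ω).1)
      (target (R.f k ω (h + 1)) (R.off h i ω).2) ≠ ⊤)
    (hon : ∀ j < K, loss (M.bellman h (R.f k ω (h + 1)) (R.on j ω h).1)
      (target (R.f k ω (h + 1)) (R.on j ω h).2) ≠ ⊤) :
    1 ≤ (∏ i, tdRatio loss η M h (R.f k ω h) (R.f k ω (h + 1)) (R.off h i ω)) *
      ∏ j ∈ Finset.range k, tdRatio loss η M h (R.f k ω h) (R.f k ω (h + 1)) (R.on j ω h) := by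
  have hmin := R.f_min k hk ω h _ (hF h h.2 _ (R.f_mem_cls hk ω (h + 1) h.2))
  unfold tdLoss at hmin
  have key := one_le_prod_lossRatio hL.eta_pos.le ?_ hmin
  · rw [Fintype.prod_sum_type] at key
    rw [Finset.prod_range]
    exact key
  · rintro (i | j)
    · exact hoff i
    · exact hon j (j.2.trans hk)

/-- The ratios multiply to at least one, so dropping them from the potential leaves the exponential
of the accumulated means. -/
theorem FQIRun.sum_le_log_of_potential_lt (R : FQIRun M F G ν N K ua loss μ)
    (hL : LossControls loss D η c b) (hF : BellmanComplete M F) {k : ℕ} (hk : k < K) {ω : Ω}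
    {h : Fin M.horizon}
    (hoff : ∀ i, loss (M.bellman h (R.f k ω (h + 1)) (R.off h i ω).1)
      (target (R.f k ω (h + 1)) (R.off h i ω).2) ≠ ⊤)
    (hon : ∀ j < K, loss (M.bellman h (R.f k ω (h + 1)) (R.on j ω h).1)
      (target (R.f k ω (h + 1)) (R.on j ω h).2) ≠ ⊤) {a : ℝ} (ha : 0 < a)
    (hlt : R.potential D η c h (R.f k ω h) (R.f k ω (h + 1)) k ω < ENNReal.ofReal a) :
    N * (c * ∫ z, D (R.f k ω h z) (M.bellman h (R.f k ω (h + 1)) z) ∂(ν h)) +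
      ∑ j ∈ Finset.range k, c * ∫ z, D (R.f k ω h z) (M.bellman h (R.f k ω (h + 1)) z)
        ∂(M.dataLaw ua (G.policy (R.f j ω)) h) ≤ Real.log a := by
  have h1 := R.one_le_prod_tdRatio hL hF hk hoff hon
  set E₀ := N * (c * ∫ z, D (R.f k ω h z) (M.bellman h (R.f k ω (h + 1)) z) ∂(ν h)) with hE₀
  have h2 : ENNReal.ofReal (Real.exp (E₀ +
      ∑ j ∈ Finset.range k, c * ∫ z, D (R.f k ω h z) (M.bellman h (R.f k ω (h + 1)) z)
        ∂(M.dataLaw ua (G.policy (R.f j ω)) h))) ≤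
      R.potential D η c h (R.f k ω h) (R.f k ω (h + 1)) k ω := by
    rw [potential, Finset.prod_mul_distrib, mul_mul_mul_comm,
      ← ENNReal.ofReal_prod_of_nonneg fun _ _ => (Real.exp_pos _).le, ← Real.exp_sum,
      ← ENNReal.ofReal_mul (Real.exp_pos _).le, ← Real.exp_add]
    exact le_mul_of_one_le_left (zero_le) h1
  have h3 := (ENNReal.ofReal_lt_ofReal_iff ha).1 (h2.trans_lt hlt)
  exact ((Real.lt_log_iff_exp_lt ha).2 h3).le

/-- With high probability, the discrepancies of the predictors are small on the data gathered so
far, simultaneously for all rounds and steps. -/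
theorem FQIRun.exists_event [IsProbabilityMeasure μ] (R : FQIRun M F G ν N K ua loss μ)
    (hL : LossControls loss D η c b) (hF : BellmanComplete M F) (hua : ua = true → Finite A)
    [∀ h, IsProbabilityMeasure (ν h)]
    (hT : ∀ h < M.horizon, ∀ f ∈ F.cls (h + 1), ∀ z, ∀ᵐ o ∂(M.outcome h z),
      target f o ∈ Set.Icc 0 b) (hK : 0 < K) {δ : ℝ} (hδ : 0 < δ) :
    ∃ S : Set Ω, ENNReal.ofReal (1 - δ) ≤ μ S ∧ ∀ ω ∈ S, ∀ k < K, ∀ h : Fin M.horizon,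
      N * (c * ∫ z, D (R.f k ω h z) (M.bellman h (R.f k ω (h + 1)) z) ∂(ν h)) +
      ∑ j ∈ Finset.range k, c * ∫ z, D (R.f k ω h z) (M.bellman h (R.f k ω (h + 1)) z)
        ∂(M.dataLaw ua (G.policy (R.f j ω)) h) ≤
          Real.log (K * (M.horizon * F.size / δ)) := by
  classical
  have hne := R.nonempty_cls hK
  have hsize : (0 : ℝ) < F.size := by exact_mod_cast F.size_pos hne
  have hH : (0 : ℝ) < M.horizon := by exact_mod_cast M.horizon_pos
  have hK' : (0 : ℝ) < K := by exact_mod_cast hK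
  -- There are at most `K H |F|` triples of round, step and pair; Markov's bound `1/a` for each adds
  -- up to `δ`.
  set a : ℝ := K * (M.horizon * F.size / δ) with ha
  have ha0 : 0 < a := by positivity
  let bad : Set Ω := ⋃ k ∈ Finset.range K, ⋃ h ∈ (Finset.univ : Finset (Fin M.horizon)),
    ⋃ p ∈ F.cls h ×ˢ F.cls (h + 1), {ω | ENNReal.ofReal a ≤ R.potential D η c h p.1 p.2 k ω}
  have hbad : μ bad ≤ ENNReal.ofReal δ := by
    have hone : ∀ k ∈ Finset.range K, ∀ h : Fin M.horizon, ∀ p ∈ F.cls h ×ˢ F.cls (h + 1),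
        μ {ω | ENNReal.ofReal a ≤ R.potential D η c h p.1 p.2 k ω} ≤ ENNReal.ofReal a⁻¹ := by
      intro k hk h p hp
      obtain ⟨hp1, hp2⟩ := Finset.mem_product.1 hp
      have hkK := (Finset.mem_range.1 hk).le
      have hmeas := (R.measurable_potential hL hF hp1 hp2 hkK).mono (R.info.le k) le_rfl
      refine (meas_ge_le_lintegral_div hmeas.aemeasurable (by simpa using ha0)
        ENNReal.ofReal_ne_top).trans ?_
      rw [ENNReal.ofReal_inv_of_pos ha0, ← one_div]
      exact ENNReal.div_le_div_right
        (R.lintegral_potential_le_one hL hF hua hp1 hp2 (hT h h.2 _ hp2) hkK) _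
    calc μ bad ≤ ∑ k ∈ Finset.range K, ∑ h : Fin M.horizon, ∑ p ∈ F.cls h ×ˢ F.cls (h + 1),
          μ {ω | ENNReal.ofReal a ≤ R.potential D η c h p.1 p.2 k ω} := by
          refine (measure_biUnion_finset_le _ _).trans (Finset.sum_le_sum fun k _ => ?_)
          refine (measure_biUnion_finset_le _ _).trans (Finset.sum_le_sum fun h _ => ?_)
          exact measure_biUnion_finset_le _ _
      _ ≤ ∑ k ∈ Finset.range K, ∑ h : Fin M.horizon, ∑ p ∈ F.cls h ×ˢ F.cls (h + 1),
          ENNReal.ofReal a⁻¹ :=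
          Finset.sum_le_sum fun k hk => Finset.sum_le_sum fun h _ => Finset.sum_le_sum fun p hp =>
            hone k hk h p hp
      _ ≤ ∑ k ∈ Finset.range K, ∑ h : Fin M.horizon, F.size * ENNReal.ofReal a⁻¹ := by
          refine Finset.sum_le_sum fun k _ => Finset.sum_le_sum fun h _ => ?_
          rw [Finset.sum_const, nsmul_eq_mul, Finset.card_product]
          gcongr
          exact_mod_cast F.card_mul_card_le hne h.2
      _ = ENNReal.ofReal (K * (M.horizon * (F.size * a⁻¹))) := by
          rw [ENNReal.ofReal_mul hK'.le, ENNReal.ofReal_mul hH.le, ENNReal.ofReal_mul hsize.le]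
          simp
      _ = ENNReal.ofReal δ := by
          congr 1
          rw [ha]
          field_simp
  have hfin : ∀ᵐ ω ∂μ, ∀ h : Fin M.horizon, ∀ f ∈ F.cls (h + 1),
      (∀ i, loss (M.bellman h f (R.off h i ω).1) (target f (R.off h i ω).2) ≠ ⊤) ∧
      ∀ j : Fin K, loss (M.bellman h f (R.on j ω h).1) (target f (R.on j ω h).2) ≠ ⊤ := by
    refine ae_all_iff.2 fun h => (Filter.eventually_all_finset _).2 fun f hf => Filter.Eventually.and
      (ae_all_iff.2 fun i => R.ae_off_ne_top hL hF hf (hT h h.2 f hf) i)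
      (ae_all_iff.2 fun j => R.ae_on_ne_top hL hF hua hf (hT h h.2 f hf) j.2)
  set good : Set Ω := {ω | ∀ h : Fin M.horizon, ∀ f ∈ F.cls (h + 1),
      (∀ i, loss (M.bellman h f (R.off h i ω).1) (target f (R.off h i ω).2) ≠ ⊤) ∧
      ∀ j : Fin K, loss (M.bellman h f (R.on j ω h).1) (target f (R.on j ω h).2) ≠ ⊤} with hgood
  refine ⟨badᶜ ∩ good, ?_, ?_⟩
  · have h1 : μ (badᶜ ∩ good)ᶜ ≤ ENNReal.ofReal δ := by
      rw [Set.compl_inter, compl_compl]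
      refine (measure_union_le _ _).trans ?_
      have : μ goodᶜ = 0 := hfin
      rw [this, add_zero]
      exact hbad
    have h2 : 1 ≤ μ (badᶜ ∩ good) + μ (badᶜ ∩ good)ᶜ := by
      rw [← measure_univ (μ := μ), ← Set.union_compl_self (badᶜ ∩ good)]
      exact measure_union_le _ _
    rw [ENNReal.ofReal_sub 1 hδ.le, ENNReal.ofReal_one, tsub_le_iff_right]
    exact h2.trans (by gcongr)
  · rintro ω ⟨hω1, hω2⟩ k hk h
    have hf1 := R.f_mem_cls hk ω h h.2.le
    have hf2 := R.f_mem_cls hk ω (h + 1) h.2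
    obtain ⟨hoff, hon⟩ := hω2 h _ hf2
    refine R.sum_le_log_of_potential_lt hL hF hk hoff (fun j hj => hon ⟨j, hj⟩) ha0 ?_
    by_contra hcon
    refine hω1 ?_
    simp only [bad, Set.mem_iUnion]
    exact ⟨k, Finset.mem_range.2 hk, h, Finset.mem_univ h, (R.f k ω h, R.f k ω (h + 1)),
      Finset.mem_product.2 ⟨hf1, hf2⟩, not_lt.1 hcon⟩

end Event

/-! ### From discrepancies to regret. -/

section Regret

/-- Cauchy-Schwarz through the discriminant: `f x^2 - 2 r x + g` is pointwise nonnegative, hence so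
is its integral for every `x`. -/
theorem sq_integral_le_integral_mul_integral {S : Type*} [MeasurableSpace S] {m : Measure S}
    {r f g : S → ℝ} (hr : Integrable r m) (hf : Integrable f m) (hg : Integrable g m)
    (hf0 : ∀ s, 0 ≤ f s) (hg0 : ∀ s, 0 ≤ g s) (h : ∀ s, r s ^ 2 ≤ f s * g s) :
    (∫ s, r s ∂m) ^ 2 ≤ (∫ s, f s ∂m) * ∫ s, g s ∂m := by
  have key : ∀ x : ℝ, 0 ≤ (∫ s, f s ∂m) * (x * x) + (-2 * ∫ s, r s ∂m) * x + ∫ s, g s ∂m := by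
    intro x
    have e : (∫ s, f s ∂m) * (x * x) + (-2 * ∫ s, r s ∂m) * x + ∫ s, g s ∂m =
        ∫ s, (f s * (x * x) + -2 * r s * x + g s) ∂m := by
      have hi : Integrable (fun s => f s * (x * x) + -2 * r s * x) m :=
        (hf.mul_const _).add ((hr.const_mul _).mul_const _)
      rw [integral_add hi hg,
        integral_add (hf.mul_const _) ((hr.const_mul _).mul_const _), integral_mul_const,
        integral_mul_const, integral_const_mul]
    rw [e]
    refine integral_nonneg fun s => ?_
    have h1 := h s
    have h2 : discrim (f s) (-2 * r s) (g s) ≤ 0 := by unfold discrim; nlinarith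
    simp only [Pi.zero_apply]
    rcases (hf0 s).eq_or_lt with h0 | h0
    · have : r s = 0 := by
        rw [← h0, zero_mul] at h1
        exact pow_eq_zero_iff two_ne_zero |>.1 (le_antisymm h1 (sq_nonneg _))
      rw [← h0, this]
      simpa using hg0 s
    · have : 0 ≤ (f s * x - r s) ^ 2 / f s + (f s * g s - r s ^ 2) / f s :=
        add_nonneg (by positivity) (div_nonneg (by linarith) h0.le)
      have e2 : (f s * x - r s) ^ 2 / f s + (f s * g s - r s ^ 2) / f s =
          f s * (x * x) + -2 * r s * x + g s := by
        field_simp; ring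
      linarith
  have := discrim_le_zero key
  unfold discrim at this
  nlinarith

variable {X : Type u} {A : Type v} [MeasurableSpace X] [MeasurableSpace A] {M : MDP X A}
  {F : FunctionClass X A M.horizon} {loss : ℝ → ℝ → ℝ≥0∞} {D : ℝ → ℝ → ℝ}
  {η c b : ℝ}

/-- Cauchy-Schwarz twice, in the integral and in the double sum. The weight `W` is `1` for the
square and `4 (p + t)` for the Hellinger distance. -/
theorem BellmanComplete.sq_sum_integral_abs_le (hF : BellmanComplete M F)
    (hL : LossControls loss D η c b) {W : ℝ → ℝ → ℝ} (hWm : Measurable (Function.uncurry W))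
    {w : ℝ} (hW : ∀ p ∈ Set.Icc (0 : ℝ) 1, ∀ t ∈ Set.Icc (0 : ℝ) 1, W p t ∈ Set.Icc 0 w)
    (hDW : ∀ p ∈ Set.Icc (0 : ℝ) 1, ∀ t ∈ Set.Icc (0 : ℝ) 1, (p - t) ^ 2 ≤ D p t * W p t)
    {K : ℕ} {φ : ℕ → ℕ → X × A → ℝ} (hφ : ∀ k < K, ∀ h ≤ M.horizon, φ k h ∈ F.cls h)
    (p : ℕ → Policy X A) :
    (∑ k ∈ Finset.range K, ∑ h ∈ Finset.range M.horizon,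
      ∫ z, |M.bellmanError (φ k) h z| ∂(M.visit (p k) h)) ^ 2 ≤
    (∑ k ∈ Finset.range K, ∑ h ∈ Finset.range M.horizon, M.discrepancy D (φ k) (p k) h) *
      ∑ k ∈ Finset.range K, ∑ h ∈ Finset.range M.horizon, M.discrepancy W (φ k) (p k) h := by
  simp only [← Finset.sum_product']
  have hmem1 : ∀ k < K, ∀ h < M.horizon, ∀ z, φ k h z ∈ Set.Icc (0 : ℝ) 1 := fun k hk h hh =>
    FunctionClass.mem_Icc_of_mem hh.le (hφ k hk h hh.le)
  have hmem2 : ∀ k < K, ∀ h < M.horizon, ∀ z, M.bellman h (φ k (h + 1)) z ∈ Set.Icc (0 : ℝ) 1 :=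
    fun k hk h hh => FunctionClass.mem_Icc_of_mem hh.le (hF h hh _ (hφ k hk _ hh))
  have hDmem : ∀ k < K, ∀ h < M.horizon, ∀ z,
      D (φ k h z) (M.bellman h (φ k (h + 1)) z) ∈ Set.Icc (0 : ℝ) 1 := fun k hk h hh z =>
    hL.D_mem _ (hmem1 k hk h hh z) _ (hmem2 k hk h hh z)
  have hWmem : ∀ k < K, ∀ h < M.horizon, ∀ z,
      W (φ k h z) (M.bellman h (φ k (h + 1)) z) ∈ Set.Icc 0 w := fun k hk h hh z =>
    hW _ (hmem1 k hk h hh z) _ (hmem2 k hk h hh z)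
  refine Finset.sum_sq_le_sum_mul_sum_of_sq_le_mul _ ?_ ?_ ?_ <;> rintro ⟨k, h⟩ hkh <;>
    obtain ⟨hk, hh⟩ := Finset.mem_product.1 hkh <;> rw [Finset.mem_range] at hk hh
  · exact integral_nonneg fun z => (hDmem k hk h hh z).1
  · exact integral_nonneg fun z => (hWmem k hk h hh z).1
  · have hme := hF.measurable_bellmanError (hφ k hk) hh
    have hm1 := FunctionClass.measurable_of_mem hh.le (hφ k hk h hh.le)
    have hm2 := FunctionClass.measurable_of_mem hh.le (hF h hh _ (hφ k hk (h + 1) hh))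
    refine sq_integral_le_integral_mul_integral
      (integrable_of_mem_Icc hme (hF.bellmanError_mem (hφ k hk) hh)).abs
      (integrable_of_mem_Icc (hL.measurable_D.comp (hm1.prodMk hm2)) (hDmem k hk h hh))
      (integrable_of_mem_Icc (hWm.comp (hm1.prodMk hm2)) (hWmem k hk h hh))
      (fun z => (hDmem k hk h hh z).1) (fun z => (hWmem k hk h hh z).1) fun z => ?_
    rw [sq_abs]
    exact hDW _ (hmem1 k hk h hh z) _ (hmem2 k hk h hh z)

theorem discrepancy_nonneg (hF : BellmanComplete M F) (hL : LossControls loss D η c b)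
    {φ : ℕ → X × A → ℝ} (hφ : ∀ h ≤ M.horizon, φ h ∈ F.cls h) (π : Policy X A) {h : ℕ}
    (hh : h < M.horizon) : 0 ≤ M.discrepancy D φ π h :=
  integral_nonneg fun z => (hL.discrepancy_mem hF hh (hφ h hh.le) (hφ (h + 1) hh) z).1

theorem BellmanComplete.sum_integral_abs_le_sq (hF : BellmanComplete M F)
    {K : ℕ} {φ : ℕ → ℕ → X × A → ℝ} (hφ : ∀ k < K, ∀ h ≤ M.horizon, φ k h ∈ F.cls h)
    (p : ℕ → Policy X A) {ρ : ℝ}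
    (hρ : ∀ h < M.horizon, ∑ k ∈ Finset.range K, M.discrepancy sqDist (φ k) (p k) h ≤ ρ) :
    ∑ k ∈ Finset.range K, ∑ h ∈ Finset.range M.horizon,
      ∫ z, |M.bellmanError (φ k) h z| ∂(M.visit (p k) h) ≤ M.horizon * √(K * ρ) := by
  have key := hF.sq_sum_integral_abs_le lossControls_sq (W := fun _ _ => 1) measurable_const (w := 1)
    (fun _ _ _ _ => ⟨zero_le_one, le_rfl⟩) (fun p _ t _ => by simp [sqDist]) hφ p
  have h1 : ∑ k ∈ Finset.range K, ∑ h ∈ Finset.range M.horizon,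
      M.discrepancy sqDist (φ k) (p k) h ≤ M.horizon * ρ := by
    rw [Finset.sum_comm]
    refine (Finset.sum_le_card_nsmul _ _ ρ fun h hh => hρ h (Finset.mem_range.1 hh)).trans ?_
    simp
  have h2 : ∑ k ∈ Finset.range K, ∑ h ∈ Finset.range M.horizon,
      M.discrepancy (fun _ _ => 1) (φ k) (p k) h = K * M.horizon := by
    simp [MDP.discrepancy]
  rw [h2] at key
  have h3 := key.trans (mul_le_mul_of_nonneg_right h1 (by positivity : (0 : ℝ) ≤ K * M.horizon))
  refine (Real.le_sqrt_of_sq_le h3).trans (le_of_eq ?_)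
  rw [show (M.horizon : ℝ) * ρ * (K * M.horizon) = (M.horizon : ℝ) ^ 2 * (K * ρ) by ring,
    Real.sqrt_mul (by positivity), Real.sqrt_sq (by positivity)]

/-- The mean of the weight `4 (p + t)` is bounded through `integral_le_value`, so the values of the
policies replace the worst-case count `K`. -/
theorem BellmanComplete.sum_integral_abs_le_bce (hF : BellmanComplete M F) (G : GreedyRule F)
    {K : ℕ} {φ : ℕ → ℕ → X × A → ℝ} (hφ : ∀ k < K, ∀ h ≤ M.horizon, φ k h ∈ F.cls h)
    (p : ℕ → Policy X A) {ρ : ℝ}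
    (hρ : ∀ h < M.horizon, ∑ k ∈ Finset.range K, M.discrepancy hellingerBer (φ k) (p k) h ≤ ρ) :
    ∑ k ∈ Finset.range K, ∑ h ∈ Finset.range M.horizon,
      ∫ z, |M.bellmanError (φ k) h z| ∂(M.visit (p k) h) ≤
      √(24 * ((M.horizon : ℝ) ^ 2 * ρ) * (∑ k ∈ Finset.range K, M.value (p k) +
        4 * ((M.horizon : ℝ) ^ 2 * ρ))) := by
  have hH1 : (1 : ℝ) ≤ M.horizon := by exact_mod_cast M.horizon_pos
  have key := hF.sq_sum_integral_abs_le lossControls_bce (W := fun p t => 4 * (p + t))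
    (by unfold Function.uncurry; fun_prop) (w := 8)
    (fun p hp t ht => ⟨by linarith [hp.1, ht.1], by linarith [hp.2, ht.2]⟩)
    (fun p hp t ht => sq_sub_le_hellingerBer hp ht) hφ p
  have h1 : ∑ k ∈ Finset.range K, ∑ h ∈ Finset.range M.horizon,
      M.discrepancy hellingerBer (φ k) (p k) h ≤ M.horizon * ρ := by
    rw [Finset.sum_comm]
    refine (Finset.sum_le_card_nsmul _ _ ρ fun h hh => hρ h (Finset.mem_range.1 hh)).trans ?_
    simp
  have h0 : 0 ≤ ∑ k ∈ Finset.range K, ∑ h ∈ Finset.range M.horizon,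
      M.discrepancy hellingerBer (φ k) (p k) h :=
    Finset.sum_nonneg fun k hk => Finset.sum_nonneg fun h hh => discrepancy_nonneg hF
      lossControls_bce (hφ k (Finset.mem_range.1 hk)) (p k) (Finset.mem_range.1 hh)
  have hV : 0 ≤ ∑ k ∈ Finset.range K, M.value (p k) :=
    Finset.sum_nonneg fun k _ => M.value_nonneg (p k)
  have h2 : ∑ k ∈ Finset.range K, ∑ h ∈ Finset.range M.horizon,
      M.discrepancy (fun p t => 4 * (p + t)) (φ k) (p k) h ≤
      24 * M.horizon * (∑ k ∈ Finset.range K, M.value (p k) + 4 * ((M.horizon : ℝ) ^ 2 * ρ)) := by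
    calc _ ≤ ∑ k ∈ Finset.range K, ∑ _h ∈ Finset.range M.horizon, 4 * (6 * (M.value (p k) +
          4 * M.horizon * ∑ j ∈ Finset.range M.horizon,
            M.discrepancy hellingerBer (φ k) (p k) j)) := by
          refine Finset.sum_le_sum fun k hk => Finset.sum_le_sum fun h hh => ?_
          have hh := Finset.mem_range.1 hh
          have hφ := hφ k (Finset.mem_range.1 hk)
          have hi1 : Integrable (φ k h) (M.visit (p k) h) :=
            integrable_of_mem_Icc (FunctionClass.measurable_of_mem hh.le (hφ h hh.le))
              (FunctionClass.mem_Icc_of_mem hh.le (hφ h hh.le))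
          have hi2 : Integrable (M.bellman h (φ k (h + 1))) (M.visit (p k) h) :=
            integrable_of_mem_Icc (FunctionClass.measurable_of_mem hh.le (hF h hh _ (hφ _ hh)))
              (FunctionClass.mem_Icc_of_mem hh.le (hF h hh _ (hφ _ hh)))
          rw [MDP.discrepancy, integral_const_mul, integral_add hi1 hi2]
          exact mul_le_mul_of_nonneg_left (hF.integral_le_value G hφ lossControls_bce.measurable_D
            lossControls_bce.D_mem (fun p hp t ht => le_one_add_mul_add_hellingerBer hH1 hp ht)
            (p k) hh) (by norm_num)
      _ = 24 * M.horizon * (∑ k ∈ Finset.range K, M.value (p k) + 4 * (M.horizon *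
          ∑ k ∈ Finset.range K, ∑ h ∈ Finset.range M.horizon,
            M.discrepancy hellingerBer (φ k) (p k) h)) := by
          simp only [Finset.sum_const, Finset.card_range, nsmul_eq_mul]
          simp only [← Finset.mul_sum, Finset.sum_add_distrib]
          ring
      _ ≤ _ := by
          have : (M.horizon : ℝ) * ∑ k ∈ Finset.range K, ∑ h ∈ Finset.range M.horizon,
              M.discrepancy hellingerBer (φ k) (p k) h ≤ (M.horizon : ℝ) ^ 2 * ρ := by
            rw [pow_two, mul_assoc]
            exact mul_le_mul_of_nonneg_left h1 (by positivity)
          gcongr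
  refine Real.le_sqrt_of_sq_le (key.trans ?_)
  have hρ0 : 0 ≤ (M.horizon : ℝ) * ρ := h0.trans h1
  refine (mul_le_mul_of_nonneg_left h2 h0).trans ?_
  have hnn : 0 ≤ 24 * (M.horizon : ℝ) * (∑ k ∈ Finset.range K, M.value (p k) +
      4 * ((M.horizon : ℝ) ^ 2 * ρ)) := by
    have : 0 ≤ (M.horizon : ℝ) ^ 2 * ρ := by
      rw [pow_two, mul_assoc]; positivity
    positivity
  refine (mul_le_mul_of_nonneg_right h1 hnn).trans (le_of_eq ?_)
  ring

/-- Solving the self-bounding inequality for the regret. -/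
theorem sub_le_of_le_sqrt_add_sqrt {x y P : ℝ} (hy : 0 ≤ y) (hP : 0 ≤ P)
    (h : x - y ≤ √(24 * P * (x + 4 * P)) + √(24 * P * (y + 4 * P))) :
    x - y ≤ 20 * √(P * y) + 200 * P := by
  -- If the claim fails then `x ≥ y`, the first root dominates, and `(x - y)^2 ≤ 96 P (x + 4P)`
  -- contradicts the assumed size of `x - y`.
  by_contra! hcon
  have hs : 0 ≤ √(P * y) := Real.sqrt_nonneg _
  have hs2 : √(P * y) ^ 2 = P * y := Real.sq_sqrt (mul_nonneg hP hy)
  set s := √(P * y) with hsdef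
  have hxy : y ≤ x := by nlinarith
  have h1 : √(24 * P * (y + 4 * P)) ≤ √(24 * P * (x + 4 * P)) := by gcongr
  have h2 : x - y ≤ 2 * √(24 * P * (x + 4 * P)) := by linarith
  have hd0 : 0 ≤ x - y := sub_nonneg.2 hxy
  have h3 : (x - y) ^ 2 ≤ 96 * P * (x + 4 * P) := by
    have := pow_le_pow_left₀ hd0 h2 2
    rw [mul_pow, Real.sq_sqrt (by have : 0 ≤ x := hy.trans hxy; positivity)] at this
    linarith
  have h4 : (20 * s + 200 * P) * (x - y) ≤ (x - y) ^ 2 := by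
    rw [pow_two]; exact mul_le_mul_of_nonneg_right hcon.le hd0
  have h5 : 0 < x - y := by nlinarith
  nlinarith [mul_nonneg hs hP, mul_nonneg hs hd0, mul_nonneg hP hd0,
    mul_le_mul_of_nonneg_left hcon.le hs, mul_le_mul_of_nonneg_left hcon.le hP,
    mul_pos h5 h5]

variable {G : GreedyRule F} {ν : Fin M.horizon → Measure (X × A)} {N K : ℕ} {ua : Bool}
  {Ω : Type w} [mΩ : MeasurableSpace Ω] {μ : Measure Ω}

theorem FQIRun.regret_le (R : FQIRun M F G ν N K ua loss μ) (hF : BellmanComplete M F)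
    (π' : Policy X A) (ω : Ω) : R.regret π' ω ≤
      ∑ k ∈ Finset.range K, ∑ h ∈ Finset.range M.horizon,
        ∫ z, |M.bellmanError (R.f k ω) h z| ∂(M.visit (G.policy (R.f k ω)) h) +
      ∑ k ∈ Finset.range K, ∑ h ∈ Finset.range M.horizon,
        ∫ z, |M.bellmanError (R.f k ω) h z| ∂(M.visit π' h) := by
  rw [regret, ← Finset.sum_add_distrib]
  exact Finset.sum_le_sum fun k hk =>
    hF.value_sub_le G (R.f_mem_cls (Finset.mem_range.1 hk) ω) π'

/-- In a singleton class, completeness forces each predictor to equal its backup. This case is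
separate because `β` may then be arbitrarily close to zero. -/
theorem FQIRun.regret_nonpos_of_size_eq_one (R : FQIRun M F G ν N K ua loss μ)
    (hF : BellmanComplete M F) (hsize : F.size = 1) (π' : Policy X A) (ω : Ω) :
    R.regret π' ω ≤ 0 := by
  have hz : ∀ k < K, ∀ h < M.horizon, ∀ z, M.bellmanError (R.f k ω) h z = 0 := by
    intro k hk h hh z
    have hcard : (F.cls h).card = 1 := by
      have := Finset.dvd_prod_of_mem (fun j => (F.cls j).card) (Finset.mem_range.2 hh)
      exact Nat.dvd_one.1 (hsize ▸ this)
    have hφ := R.f_mem_cls hk ω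
    have := Finset.card_le_one.1 hcard.le _ (hφ h hh.le) _ (hF h hh _ (hφ (h + 1) hh))
    rw [MDP.bellmanError, this, sub_self]
  refine (R.regret_le hF π' ω).trans (le_of_eq ?_)
  have h0 : ∀ p : ℕ → Policy X A, ∑ k ∈ Finset.range K, ∑ h ∈ Finset.range M.horizon,
      ∫ z, |M.bellmanError (R.f k ω) h z| ∂(M.visit (p k) h) = 0 := fun p =>
    Finset.sum_eq_zero fun k hk => Finset.sum_eq_zero fun h hh => by
      simp [hz k (Finset.mem_range.1 hk) h (Finset.mem_range.1 hh)]
  rw [h0 fun k => G.policy (R.f k ω), h0 fun _ => π', add_zero]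

/-- Every round has offline error at most `ℓ/(cN)`; change measure by the coverage and use `K/N ≤
1/κ`. -/
theorem FQIRun.sum_discrepancy_comparator_le (R : FQIRun M F G ν N K ua loss μ)
    (hL : LossControls loss D η c b) (hF : BellmanComplete M F) [∀ h, IsProbabilityMeasure (ν h)]
    {κ : ℝ} (hκ : 0 < κ) (hK : 0 < K) (hN : κ * K ≤ N) {ℓ : ℝ} {ω : Ω}
    (hE : ∀ k < K, ∀ h : Fin M.horizon,
      N * (c * ∫ z, D (R.f k ω h z) (M.bellman h (R.f k ω (h + 1)) z) ∂(ν h)) +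
      ∑ j ∈ Finset.range k, c * ∫ z, D (R.f k ω h z) (M.bellman h (R.f k ω (h + 1)) z)
        ∂(M.dataLaw ua (G.policy (R.f j ω)) h) ≤ ℓ)
    {π' : Policy X A} (hC : coverage M ν π' ≠ ⊤) {h : ℕ} (hh : h < M.horizon) :
    ∑ k ∈ Finset.range K, M.discrepancy D (R.f k ω) π' h ≤
      κ⁻¹ * ((coverage M ν π').toReal * (ℓ / c)) := by
  have hK' : (0 : ℝ) < K := by exact_mod_cast hK
  have hN0 : (0 : ℝ) < N := (mul_pos hκ hK').trans_le hN
  have hc := hL.c_pos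
  have hk : ∀ k ∈ Finset.range K, M.discrepancy D (R.f k ω) π' h ≤
      (coverage M ν π').toReal * (ℓ / c) / N := by
    intro k hk
    have hk := Finset.mem_range.1 hk
    have hφ := R.f_mem_cls hk ω
    have hmem := hL.discrepancy_mem hF hh (hφ h hh.le) (hφ (h + 1) hh)
    have h1 := hE k hk ⟨h, hh⟩
    have h2 : 0 ≤ ∑ j ∈ Finset.range k, c * ∫ z, D (R.f k ω h z) (M.bellman h (R.f k ω (h + 1)) z)
        ∂(M.dataLaw ua (G.policy (R.f j ω)) h) :=
      Finset.sum_nonneg fun j _ => mul_nonneg hc.le (integral_nonneg fun z => (hmem z).1)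
    have h3 : ∫ z, D (R.f k ω h z) (M.bellman h (R.f k ω (h + 1)) z) ∂(ν ⟨h, hh⟩) ≤ ℓ / c / N := by
      rw [le_div_iff₀ hN0, le_div_iff₀ hc]
      simp only at h1
      linarith
    refine (integral_visit_le_coverage hC ⟨h, hh⟩
      (hL.measurable_discrepancy hF hh (hφ h hh.le) (hφ (h + 1) hh)) hmem).trans ?_
    rw [mul_div_assoc]
    exact mul_le_mul_of_nonneg_left h3 ENNReal.toReal_nonneg
  refine (Finset.sum_le_card_nsmul _ _ _ hk).trans ?_
  have hℓ : 0 ≤ ℓ := by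
    refine le_trans ?_ (hE 0 hK ⟨h, hh⟩)
    have hφ := R.f_mem_cls hK ω
    rw [Finset.range_zero, Finset.sum_empty, add_zero]
    exact mul_nonneg hN0.le (mul_nonneg hc.le (integral_nonneg fun z =>
      (hL.discrepancy_mem hF hh (hφ h hh.le) (hφ (h + 1) hh) z).1))
  rw [Finset.card_range, nsmul_eq_mul]
  have hKN : (K : ℝ) / N ≤ κ⁻¹ := by
    rw [div_le_iff₀ hN0, inv_mul_eq_div, le_div_iff₀ hκ]; linarith
  have hnn : 0 ≤ (coverage M ν π').toReal * (ℓ / c) :=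
    mul_nonneg ENNReal.toReal_nonneg (div_nonneg hℓ hc.le)
  calc (K : ℝ) * ((coverage M ν π').toReal * (ℓ / c) / N) =
        K / N * ((coverage M ν π').toReal * (ℓ / c)) := by ring
    _ ≤ _ := mul_le_mul_of_nonneg_right hKN hnn

/-- The bound on past data laws feeds the pigeonhole lemma. With exploration it is applied to the
action-averaged errors, and the actions of `π^k` are recovered at cost `|A|`. -/
theorem FQIRun.sum_discrepancy_policy_le (R : FQIRun M F G ν N K ua loss μ)
    (hL : LossControls loss D η c b) (hF : BellmanComplete M F) (hua : ua = true → Finite A)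
    (hK : 0 < K) {Pol : Set (Policy X A)}
    (hPol : ∀ f : ℕ → X × A → ℝ, (∀ h < M.horizon, f h ∈ F.cls h) → G.policy f ∈ Pol)
    {q : ℕ} (hq : q ≠ 0) {d : ℕ} (hd : dim M F Pol ua q D (1 / (K : ℝ)) = d)
    {B : ℝ} {ω : Ω} (hB0 : 0 ≤ B)
    (hE : ∀ k < K, ∀ h < M.horizon, ∑ j ∈ Finset.range k,
      ∫ z, D (R.f k ω h z) (M.bellman h (R.f k ω (h + 1)) z)
        ∂(M.dataLaw ua (G.policy (R.f j ω)) h) ≤ B)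
    {B' : ℝ} (hB' : 1 ≤ B') (hBB' : B * (1 + Real.log K) ≤ B') {h : ℕ} (hh : h < M.horizon) :
    ∑ k ∈ Finset.range K, M.discrepancy D (R.f k ω) (G.policy (R.f k ω)) h ≤
      3 * (max 1 (d : ℝ) * B') := by
  have hA := G.nonempty_action
  have hmem : ∀ k < K, ∀ z, D (R.f k ω h z) (M.bellman h (R.f k ω (h + 1)) z) ∈ Set.Icc (0 : ℝ) 1 :=
    fun k hk => hL.discrepancy_mem hF hh (R.f_mem_cls hk ω h hh.le) (R.f_mem_cls hk ω (h + 1) hh)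
  have hmeas : ∀ k < K, Measurable fun z => D (R.f k ω h z) (M.bellman h (R.f k ω (h + 1)) z) :=
    fun k hk => hL.measurable_discrepancy hF hh (R.f_mem_cls hk ω h hh.le)
      (R.f_mem_cls hk ω (h + 1) hh)
  have hΨ : ∀ k < K, (fun z => D (R.f k ω h z) (M.bellman h (R.f k ω (h + 1)) z)) ∈
      bellmanErrors M F D h := fun k hk =>
    ⟨_, R.f_mem_cls hk ω h hh.le, _, R.f_mem_cls hk ω (h + 1) hh, rfl⟩
  have hpol : ∀ k < K, G.policy (R.f k ω) ∈ Pol := fun k hk =>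
    hPol _ fun h hh => R.f_mem_cls hk ω h hh.le
  cases ua with
  | false =>
    have hdim : eluderDim q (bellmanErrors M F D h) ((fun π => M.visit π h) '' Pol)
        (1 / (K : ℝ)) ≤ d := by
      rw [← hd]
      exact le_iSup (fun h : Fin M.horizon => eluderDim q (bellmanErrors M F D h)
        ((fun π => M.visit π h) '' Pol) (1 / (K : ℝ))) ⟨h, hh⟩
    have habs : ∀ k < K, ∀ π : Policy X A, |∫ z, D (R.f k ω h z)
        (M.bellman h (R.f k ω (h + 1)) z) ∂(M.visit π h)| = M.discrepancy D (R.f k ω) π h :=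
      fun k hk π => abs_of_nonneg (integral_nonneg fun z => (hmem k hk z).1)
    have key := sum_le_of_eluderDim_le hq hK hdim hB0
      (m := fun k => M.visit (G.policy (R.f k ω)) h)
      (ψ := fun k z => D (R.f k ω h z) (M.bellman h (R.f k ω (h + 1)) z))
      (fun k hk => ⟨_, hpol k hk, rfl⟩) hΨ
      (fun k hk => by
        rw [habs k hk]
        have hi := integral_mono (μ := M.visit (G.policy (R.f k ω)) h)
          (integrable_of_mem_Icc (hmeas k hk) (hmem k hk)) (integrable_const (1 : ℝ))
          fun z => (hmem k hk z).2
        simpa [MDP.discrepancy] using hi)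
      (fun k hk => by
        simp only [habs k hk]
        exact hE k hk h hh)
    rw [Finset.sum_congr rfl fun k hk => habs k (Finset.mem_range.1 hk) _] at key
    refine key.trans ?_
    have h1 : (1 : ℝ) ≤ max 1 (d : ℝ) := le_max_left _ _
    have h2 : (d : ℝ) ≤ max 1 (d : ℝ) := le_max_right _ _
    have h3 : (d : ℝ) * (B * (1 + Real.log K)) ≤ max 1 (d : ℝ) * B' :=
      (mul_le_mul_of_nonneg_left hBB' (Nat.cast_nonneg d)).trans
        (mul_le_mul_of_nonneg_right h2 (by linarith))
    have h4 : max 1 (d : ℝ) ≤ max 1 (d : ℝ) * B' := le_mul_of_one_le_right (by linarith) hB'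
    linarith
  | true =>
    have hfin := hua rfl
    have hdd : (Nat.card A : ℕ∞) * max 1 (dimV M F Pol q D (1 / (K : ℝ))) = d := hd
    have hcard : (Nat.card A : ℕ∞) ≠ 0 := by
      simp [Nat.card_ne_zero, hA, hfin]
    have hetop : max 1 (dimV M F Pol q D (1 / (K : ℝ))) ≠ ⊤ := by
      intro hcon
      rw [hcon, ENat.mul_top hcard] at hdd
      exact ENat.natCast_ne_top d hdd.symm
    obtain ⟨e, he⟩ := ENat.ne_top_iff_exists.1 hetop
    have hde : Nat.card A * e = d := by
      rw [← he] at hdd; exact_mod_cast hdd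
    -- The maximum with one in `dim` lets `|A| e` absorb the term `|A|` coming from the coarsest
    -- threshold.
    have he1 : 1 ≤ e := by
      have : (1 : ℕ∞) ≤ e := by rw [he]; exact le_max_left _ _
      exact_mod_cast this
    have hdim : eluderDim q (bellmanErrorsV M F D h) ((fun π => M.stateVisit π h) '' Pol)
        (1 / (K : ℝ)) ≤ e := by
      rw [he]
      refine le_trans ?_ (le_max_right _ _)
      exact le_iSup (fun h : Fin M.horizon => eluderDim q (bellmanErrorsV M F D h)
        ((fun π => M.stateVisit π h) '' Pol) (1 / (K : ℝ))) ⟨h, hh⟩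
    have hle1 : ∀ k < K, ∀ x, ∫ a, D (R.f k ω h (x, a)) (M.bellman h (R.f k ω (h + 1)) (x, a))
        ∂(uniformOn (Set.univ : Set A)) ∈ Set.Icc (0 : ℝ) 1 := by
      intro k hk x
      refine ⟨integral_nonneg fun a => (hmem k hk _).1, ?_⟩
      have hi := integral_mono (μ := uniformOn (Set.univ : Set A))
        (integrable_of_mem_Icc ((hmeas k hk).comp measurable_prodMk_left)
          fun a => hmem k hk (x, a)) (integrable_const (1 : ℝ)) fun a => (hmem k hk (x, a)).2
      simpa using hi
    have habs : ∀ k < K, ∀ m : Measure X, |∫ x, ∫ a, D (R.f k ω h (x, a))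
        (M.bellman h (R.f k ω (h + 1)) (x, a)) ∂(uniformOn (Set.univ : Set A)) ∂m| =
        ∫ x, ∫ a, D (R.f k ω h (x, a))
          (M.bellman h (R.f k ω (h + 1)) (x, a)) ∂(uniformOn (Set.univ : Set A)) ∂m :=
      fun k hk m => abs_of_nonneg (integral_nonneg fun x => (hle1 k hk x).1)
    have hmi : ∀ k < K, Measurable fun x => ∫ a, D (R.f k ω h (x, a))
        (M.bellman h (R.f k ω (h + 1)) (x, a)) ∂(uniformOn (Set.univ : Set A)) := fun k hk =>
      ((hmeas k hk).stronglyMeasurable.integral_prod_right').measurable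
    have key := sum_le_of_eluderDim_le hq hK hdim hB0
      (m := fun k => M.stateVisit (G.policy (R.f k ω)) h)
      (ψ := fun k x => ∫ a, D (R.f k ω h (x, a)) (M.bellman h (R.f k ω (h + 1)) (x, a))
        ∂(uniformOn (Set.univ : Set A)))
      (fun k hk => ⟨_, hpol k hk, rfl⟩) (fun k hk => ⟨_, hΨ k hk, rfl⟩)
      (fun k hk => by
        rw [habs k hk]
        have hi := integral_mono (μ := M.stateVisit (G.policy (R.f k ω)) h)
          (integrable_of_mem_Icc (hmi k hk) (hle1 k hk)) (integrable_const (1 : ℝ))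
          fun z => (hle1 k hk z).2
        simpa using hi)
      (fun k hk => by
        simp only [habs k hk]
        refine le_trans (le_of_eq (Finset.sum_congr rfl fun j _ => ?_)) (hE k hk h hh)
        exact (M.integral_dataLaw_true _ h (hmeas k hk) (hmem k hk)).symm)
    have hsum : ∑ k ∈ Finset.range K, M.discrepancy D (R.f k ω) (G.policy (R.f k ω)) h ≤
        Nat.card A * (1 + e + e * (B * (1 + Real.log K))) := by
      refine le_trans ?_ (mul_le_mul_of_nonneg_left key (Nat.cast_nonneg _))
      rw [Finset.mul_sum]
      refine Finset.sum_le_sum fun k hk => ?_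
      have hk := Finset.mem_range.1 hk
      rw [habs k hk]
      exact M.integral_visit_le_card_mul _ h (hmeas k hk) (hmem k hk)
    refine hsum.trans ?_
    have he1' : (1 : ℝ) ≤ e := by exact_mod_cast he1
    have h3 : (e : ℝ) * (B * (1 + Real.log K)) ≤ e * B' :=
      mul_le_mul_of_nonneg_left hBB' (by linarith)
    have h4 : (e : ℝ) ≤ e * B' := le_mul_of_one_le_right (by linarith) hB'
    have h5 : (Nat.card A : ℝ) * (1 + e + e * (B * (1 + Real.log K))) ≤
        Nat.card A * (3 * (e * B')) :=
      mul_le_mul_of_nonneg_left (by linarith) (Nat.cast_nonneg _)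
    have h6 : (Nat.card A : ℝ) * e = d := by exact_mod_cast hde
    have h7 : (Nat.card A : ℝ) * (3 * (e * B')) = 3 * (d * B') := by rw [← h6]; ring
    have h8 : (d : ℝ) * B' ≤ max 1 (d : ℝ) * B' :=
      mul_le_mul_of_nonneg_right (le_max_right _ _) (by linarith)
    linarith

end Regret

/-! ### Assembly of the two regret bounds. -/

section Main

variable {X : Type u} {A : Type v} [MeasurableSpace X] [MeasurableSpace A] {M : MDP X A}
  {F : FunctionClass X A M.horizon} {loss : ℝ → ℝ → ℝ≥0∞} {D : ℝ → ℝ → ℝ}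
  {η c b : ℝ} {G : GreedyRule F} {ν : Fin M.horizon → Measure (X × A)} {N K : ℕ} {ua : Bool}
  {Ω : Type w} [mΩ : MeasurableSpace Ω] {μ : Measure Ω} [IsProbabilityMeasure μ]

theorem FQIRun.exists_event_sum_discrepancy (R : FQIRun M F G ν N K ua loss μ)
    (hL : LossControls loss D η c b) (hF : BellmanComplete M F) (hua : ua = true → Finite A)
    [∀ h, IsProbabilityMeasure (ν h)]
    (hT : ∀ h < M.horizon, ∀ f ∈ F.cls (h + 1), ∀ z, ∀ᵐ o ∂(M.outcome h z),
      target f o ∈ Set.Icc 0 b) (hK : 0 < K) {κ : ℝ} (hκ : 0 < κ) (hN : κ * K ≤ N)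
    {Pol : Set (Policy X A)}
    (hPol : ∀ f : ℕ → X × A → ℝ, (∀ h < M.horizon, f h ∈ F.cls h) → G.policy f ∈ Pol)
    {q : ℕ} (hq : q ≠ 0) {δ : ℝ} (hδ : 0 < δ) {β : ℝ} (hβ1 : 1 ≤ β)
    (hβ : β = 2 * Real.log (M.horizon * F.size / δ)) :
    ∃ S : Set Ω, ENNReal.ofReal (1 - δ) ≤ μ S ∧ ∀ ω ∈ S, ∀ (π' : Policy X A) (B : ℝ≥0∞),
      B = (dim M F Pol ua q D (1 / (K : ℝ)) : ℝ≥0∞) + coverage M ν π' → B ≠ ⊤ →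
      ∀ h < M.horizon,
        ∑ k ∈ Finset.range K, M.discrepancy D (R.f k ω) (G.policy (R.f k ω)) h ≤
          (3 + κ⁻¹) * (B.toReal * ((1 + Real.log K) ^ 2 * β / c)) ∧
        ∑ k ∈ Finset.range K, M.discrepancy D (R.f k ω) π' h ≤
          (3 + κ⁻¹) * (B.toReal * ((1 + Real.log K) ^ 2 * β / c)) := by
  obtain ⟨S, hS, hE⟩ := R.exists_event hL hF hua hT hK hδ
  refine ⟨S, hS, fun ω hω π' B hB hBtop h hh => ?_⟩
  have hE := hE ω hω
  have hc := hL.c_pos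
  have hK' : (0 : ℝ) < K := by exact_mod_cast hK
  have hlogK := Real.log_natCast_nonneg K
  have hsize : (0 : ℝ) < F.size := by exact_mod_cast F.size_pos (R.nonempty_cls hK)
  have hH : (0 : ℝ) < M.horizon := by exact_mod_cast M.horizon_pos
  set ℓ := Real.log (K * (M.horizon * F.size / δ)) with hℓ
  have hℓ' : ℓ = Real.log K + β / 2 := by
    rw [hℓ, Real.log_mul hK'.ne' (by positivity), hβ]; ring
  set L := 1 + Real.log K with hLdef
  have hL1 : 1 ≤ L := by linarith
  have hℓ0 : 0 ≤ ℓ := by rw [hℓ']; linarith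
  have hℓL : ℓ ≤ L * β := by rw [hℓ', hLdef]; nlinarith
  -- One factor `L` pays for the union bound over rounds in `ℓ`, the other for the harmonic sum.
  set B' := L ^ 2 * β / c with hB'
  have hB'1 : 1 ≤ B' := by
    rw [hB', le_div_iff₀ hc, one_mul]
    exact hL.c_le_one.trans (one_le_mul_of_one_le_of_one_le (one_le_pow₀ hL1) hβ1)
  have hBB' : ℓ / c * L ≤ B' := by
    rw [hB', div_mul_eq_mul_div]
    refine div_le_div_of_nonneg_right ?_ hc.le
    nlinarith
  have hBB'' : ℓ / c ≤ B' := (le_mul_of_one_le_right (div_nonneg hℓ0 hc.le) hL1).trans hBB'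
  have htop := ENNReal.add_ne_top.1 (hB ▸ hBtop)
  obtain ⟨d, hd⟩ := ENat.ne_top_iff_exists.1 (ENat.toENNReal_ne_top.1 htop.1)
  have hBr : B.toReal = d + (coverage M ν π').toReal := by
    rw [hB, ENNReal.toReal_add htop.1 htop.2, ← hd]; simp
  have hC1 := one_le_coverage htop.2
  have hd0 : (0 : ℝ) ≤ d := Nat.cast_nonneg d
  have hκ' := inv_pos.2 hκ
  have hnn : 0 ≤ B.toReal * B' := by rw [hBr]; positivity
  constructor
  · have hpol := R.sum_discrepancy_policy_le hL hF hua hK hPol hq hd.symm (div_nonneg hℓ0 hc.le)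
      (ω := ω) (fun k hk h hh => ?_) hB'1 hBB' hh
    · refine hpol.trans ?_
      have h1 : max 1 (d : ℝ) ≤ B.toReal := by
        rw [hBr]; exact max_le (by linarith) (by linarith)
      have h2 := mul_le_mul_of_nonneg_right h1 (zero_le_one.trans hB'1)
      nlinarith
    · have h1 := hE k hk ⟨h, hh⟩
      have hφ := R.f_mem_cls hk ω
      have h2 : 0 ≤ N * (c * ∫ z, D (R.f k ω h z) (M.bellman h (R.f k ω (h + 1)) z)
          ∂(ν ⟨h, hh⟩)) :=
        mul_nonneg (Nat.cast_nonneg N) (mul_nonneg hc.le (integral_nonneg fun z =>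
          (hL.discrepancy_mem hF hh (hφ h hh.le) (hφ (h + 1) hh) z).1))
      rw [← Finset.mul_sum] at h1
      rw [le_div_iff₀ hc]
      simp only at h1
      linarith
  · have hcomp := R.sum_discrepancy_comparator_le hL hF hκ hK hN hE htop.2 hh
    refine hcomp.trans ?_
    have h1 : (coverage M ν π').toReal * (ℓ / c) ≤ B.toReal * B' :=
      mul_le_mul (by rw [hBr]; linarith) hBB'' (div_nonneg hℓ0 hc.le) ENNReal.toReal_nonneg
    have h2 := mul_le_mul_of_nonneg_left h1 hκ'.le
    linarith

theorem FunctionClass.one_le_two_mul_log {H : ℕ} (F : FunctionClass X A H) (hH : 0 < H)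
    (hF : 2 ≤ F.size) {δ : ℝ} (hδ : 0 < δ) (hδ1 : δ < 1) :
    1 ≤ 2 * Real.log (H * F.size / δ) := by
  have h1 : (1 : ℝ) ≤ H := by exact_mod_cast hH
  have h2 : (2 : ℝ) ≤ F.size := by exact_mod_cast hF
  have h3 : 2 ≤ (H : ℝ) * F.size / δ := by
    rw [le_div_iff₀ hδ]; nlinarith
  have := Real.log_le_log (by norm_num) h3
  linarith [Real.log_two_gt_d9]

theorem sqrt_le_self_of_one_le {x : ℝ} (hx : 1 ≤ x) : √x ≤ x := by
  rw [Real.sqrt_le_left (by linarith)]; nlinarith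

theorem FQIRun.regret_sq (R : FQIRun M F G ν N K ua sqLoss μ)
    (hF : BellmanComplete M F) (hua : ua = true → Finite A)
    [∀ h, IsProbabilityMeasure (ν h)] (hK : 0 < K) {κ : ℝ} (hκ : 0 < κ) (hN : κ * K ≤ N)
    {Pol : Set (Policy X A)}
    (hPol : ∀ f : ℕ → X × A → ℝ, (∀ h < M.horizon, f h ∈ F.cls h) → G.policy f ∈ Pol)
    {δ : ℝ} (hδ : 0 < δ) {β : ℝ} (hβ1 : 1 ≤ β)
    (hβ : β = 2 * Real.log (M.horizon * F.size / δ)) :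
    ENNReal.ofReal (1 - δ) ≤ μ {ω | ∀ (π' : Policy X A) (B : ℝ≥0∞),
      B = (dim M F Pol ua 2 sqDist (1 / (K : ℝ)) : ℝ≥0∞) + coverage M ν π' → B ≠ ⊤ →
      R.regret π' ω ≤ 200 * (3 + κ⁻¹) * (1 + Real.log K) ^ 2 *
        (M.horizon * √(K * B.toReal * β))} := by
  obtain ⟨S, hS, hE⟩ := R.exists_event_sum_discrepancy lossControls_sq hF hua
    (fun h hh f hf z => G.ae_target_mem hh hf h z) hK hκ hN hPol two_ne_zero hδ hβ1 hβ
  refine hS.trans (measure_mono fun ω hω π' B hB hBtop => ?_)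
  have hρ := hE ω hω π' B hB hBtop
  have hφ : ∀ k < K, ∀ h ≤ M.horizon, R.f k ω h ∈ F.cls h := fun k hk => R.f_mem_cls hk ω
  have h1 := hF.sum_integral_abs_le_sq hφ (fun k => G.policy (R.f k ω)) fun h hh => (hρ h hh).1
  have h2 := hF.sum_integral_abs_le_sq hφ (fun _ => π') fun h hh => (hρ h hh).2
  have h3 := R.regret_le hF π' ω
  have hL1 : 1 ≤ 1 + Real.log K := by linarith [Real.log_natCast_nonneg K]
  set L := 1 + Real.log K
  have hκ' := inv_pos.2 hκ
  set c₀ := 3 + κ⁻¹ with hc₀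
  have hc1 : 1 ≤ c₀ := by linarith
  have e : √(K * (c₀ * (B.toReal * (L ^ 2 * β / (1 / 16))))) =
      4 * √c₀ * L * √(K * B.toReal * β) := by
    rw [show K * (c₀ * (B.toReal * (L ^ 2 * β / (1 / 16)))) =
      (4 * L) ^ 2 * (c₀ * (K * B.toReal * β)) by ring, Real.sqrt_mul (by positivity),
      Real.sqrt_sq (by linarith), Real.sqrt_mul (by linarith)]
    ring
  rw [e] at h1 h2
  set s := √(K * B.toReal * β)
  have hs : 0 ≤ s := Real.sqrt_nonneg _
  have hcL : √c₀ * L ≤ c₀ * L ^ 2 :=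
    mul_le_mul (sqrt_le_self_of_one_le hc1) (le_self_pow₀ hL1 two_ne_zero) (by linarith)
      (by linarith)
  have hHs : 0 ≤ (M.horizon : ℝ) * s := by positivity
  calc R.regret π' ω ≤ 8 * ((√c₀ * L) * (M.horizon * s)) := by linarith
    _ ≤ 8 * ((c₀ * L ^ 2) * (M.horizon * s)) := by gcongr
    _ ≤ 200 * ((c₀ * L ^ 2) * (M.horizon * s)) := by gcongr; norm_num
    _ = _ := by ring

theorem FQIRun.regret_bce (R : FQIRun M F G ν N K ua bceLoss μ)
    (hF : BellmanComplete M F) (hT : TargetsLeOne M F) (hua : ua = true → Finite A)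
    [∀ h, IsProbabilityMeasure (ν h)] (hK : 0 < K) {κ : ℝ} (hκ : 0 < κ) (hN : κ * K ≤ N)
    {Pol : Set (Policy X A)}
    (hPol : ∀ f : ℕ → X × A → ℝ, (∀ h < M.horizon, f h ∈ F.cls h) → G.policy f ∈ Pol)
    {δ : ℝ} (hδ : 0 < δ) {β : ℝ} (hβ1 : 1 ≤ β)
    (hβ : β = 2 * Real.log (M.horizon * F.size / δ)) :
    ENNReal.ofReal (1 - δ) ≤ μ {ω | ∀ (π' : Policy X A) (B : ℝ≥0∞),
      B = (dim M F Pol ua 1 hellingerBer (1 / (K : ℝ)) : ℝ≥0∞) + coverage M ν π' → B ≠ ⊤ →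
      R.regret π' ω ≤ 200 * (3 + κ⁻¹) * (1 + Real.log K) ^ 2 *
        (M.horizon * √(M.value π' * K * B.toReal * β) + M.horizon ^ 2 * B.toReal * β)} := by
  obtain ⟨S, hS, hE⟩ := R.exists_event_sum_discrepancy lossControls_bce hF hua
    (fun h hh f hf z => by
      filter_upwards [G.ae_target_mem hh hf h z, hT h hh f hf z] with o h1 h2
      exact ⟨h1.1, h2⟩) hK hκ hN hPol one_ne_zero hδ hβ1 hβ
  refine hS.trans (measure_mono fun ω hω π' B hB hBtop => ?_)
  have hρ := hE ω hω π' B hB hBtop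
  have hφ : ∀ k < K, ∀ h ≤ M.horizon, R.f k ω h ∈ F.cls h := fun k hk => R.f_mem_cls hk ω
  have h1 := hF.sum_integral_abs_le_bce G hφ (fun k => G.policy (R.f k ω)) fun h hh => (hρ h hh).1
  have h2 := hF.sum_integral_abs_le_bce G hφ (fun _ => π') fun h hh => (hρ h hh).2
  have h3 := R.regret_le hF π' ω
  have hL1 : 1 ≤ 1 + Real.log K := by linarith [Real.log_natCast_nonneg K]
  set L := 1 + Real.log K
  have hκ' := inv_pos.2 hκ
  set c₀ := 3 + κ⁻¹ with hc₀
  have hc1 : 1 ≤ c₀ := by linarith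
  set P := (M.horizon : ℝ) ^ 2 * (c₀ * (B.toReal * (L ^ 2 * β / 1))) with hP
  have hP' : P = (c₀ * L ^ 2) * (M.horizon ^ 2 * B.toReal * β) := by rw [hP]; ring
  have hB0 : 0 ≤ B.toReal := ENNReal.toReal_nonneg
  have hP0 : 0 ≤ P := by rw [hP']; positivity
  have hV := M.value_nonneg π'
  have hreg : R.regret π' ω = ∑ k ∈ Finset.range K, M.value (G.policy (R.f k ω)) -
      ∑ _k ∈ Finset.range K, M.value π' := by
    rw [FQIRun.regret, Finset.sum_sub_distrib]
  have key := sub_le_of_le_sqrt_add_sqrt (x := ∑ k ∈ Finset.range K, M.value (G.policy (R.f k ω)))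
    (y := ∑ _k ∈ Finset.range K, M.value π') (Finset.sum_nonneg fun _ _ => hV) hP0
    (by rw [← hreg]; linarith)
  rw [← hreg] at key
  simp only [Finset.sum_const, Finset.card_range, nsmul_eq_mul] at key
  -- Here `P` contains `H^2`, so the mixed term acquires one factor `H` and the lower-order term
  -- two.
  have e : √(P * (K * M.value π')) =
      (√c₀ * L) * (M.horizon * √(M.value π' * K * B.toReal * β)) := by
    rw [hP', show c₀ * L ^ 2 * (M.horizon ^ 2 * B.toReal * β) * (K * M.value π') =
      (L * M.horizon) ^ 2 * (c₀ * (M.value π' * K * B.toReal * β)) by ring,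
      Real.sqrt_mul (by positivity), Real.sqrt_sq (by positivity), Real.sqrt_mul (by linarith)]
    ring
  rw [e, hP'] at key
  have hcL : √c₀ * L ≤ c₀ * L ^ 2 :=
    mul_le_mul (sqrt_le_self_of_one_le hc1) (le_self_pow₀ hL1 two_ne_zero) (by linarith)
      (by linarith)
  set s := (M.horizon : ℝ) * √(M.value π' * K * B.toReal * β) with hs
  have hs0 : 0 ≤ s := by positivity
  calc R.regret π' ω
      ≤ 20 * ((√c₀ * L) * s) + 200 * ((c₀ * L ^ 2) * (M.horizon ^ 2 * B.toReal * β)) := key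
    _ ≤ 200 * ((c₀ * L ^ 2) * s) + 200 * ((c₀ * L ^ 2) * (M.horizon ^ 2 * B.toReal * β)) := by
        gcongr; norm_num
    _ = _ := by ring

theorem FQIRun.regret_of_size_eq_one (R : FQIRun M F G ν N K ua loss μ) (hF : BellmanComplete M F)
    (hsize : F.size = 1) {δ : ℝ} (hδ : 0 < δ) {Q : Policy X A → ℝ≥0∞ → Prop}
    {bound : Policy X A → ℝ≥0∞ → ℝ} (hb : ∀ π' B, 0 ≤ bound π' B) :
    ENNReal.ofReal (1 - δ) ≤ μ {ω | ∀ (π' : Policy X A) (B : ℝ≥0∞), Q π' B → B ≠ ⊤ →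
      R.regret π' ω ≤ bound π' B} := by
  have : {ω | ∀ (π' : Policy X A) (B : ℝ≥0∞), Q π' B → B ≠ ⊤ → R.regret π' ω ≤ bound π' B} =
      Set.univ := Set.eq_univ_of_forall fun ω π' B _ _ =>
    (R.regret_nonpos_of_size_eq_one hF hsize π' ω).trans (hb π' B)
  rw [this, measure_univ, ENNReal.ofReal_le_one]
  linarith

end Main

end HybridRL

theorem mainTheorem3 (κ : ℝ) (hκ : 0 < κ) :
    ∃ (c : ℝ) (p : ℕ), 0 < c ∧
      ∀ (X : Type u) (A : Type v) [MeasurableSpace X] [MeasurableSpace A]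
        (M : HybridRL.MDP X A) (_ : M.Normalized)
        (F : HybridRL.FunctionClass X A M.horizon) (_ : HybridRL.BellmanComplete M F)
        (G : HybridRL.GreedyRule F)
        (Pol : Set (HybridRL.Policy X A))
        (_ : ∀ f : ℕ → X × A → ℝ, (∀ h < M.horizon, f h ∈ F.cls h) → G.policy f ∈ Pol)
        (ν : Fin M.horizon → Measure (X × A)) (_ : ∀ h, IsProbabilityMeasure (ν h))
        (N K : ℕ) (_ : 0 < K) (_ : κ * (K : ℝ) ≤ (N : ℝ))
        (ua : Bool) (_ : ua = true → Finite A)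
        (δ : ℝ) (_ : 0 < δ) (_ : δ < 1)
        (β : ℝ) (_ : β = 2 * Real.log ((M.horizon : ℝ) * (F.size : ℝ) / δ))
        (Ω : Type w) [MeasurableSpace Ω] (μ : Measure Ω) [IsProbabilityMeasure μ],
        (∀ R : HybridRL.FQIRun M F G ν N K ua HybridRL.sqLoss μ,
          ENNReal.ofReal (1 - δ) ≤ μ {ω | ∀ (π' : HybridRL.Policy X A) (B : ℝ≥0∞),
            B = (HybridRL.dim M F Pol ua 2 HybridRL.sqDist (1 / (K : ℝ)) : ℝ≥0∞)
                + HybridRL.coverage M ν π' →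
            B ≠ ⊤ →
            R.regret π' ω ≤ c * (1 + Real.log (K : ℝ)) ^ p *
              ((M.horizon : ℝ) * √((K : ℝ) * B.toReal * β))}) ∧
        (HybridRL.TargetsLeOne M F →
          ∀ R : HybridRL.FQIRun M F G ν N K ua HybridRL.bceLoss μ,
          ENNReal.ofReal (1 - δ) ≤ μ {ω | ∀ (π' : HybridRL.Policy X A) (B : ℝ≥0∞),
            B = (HybridRL.dim M F Pol ua 1 HybridRL.hellingerBer (1 / (K : ℝ)) : ℝ≥0∞)
                + HybridRL.coverage M ν π' →
            B ≠ ⊤ →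
            R.regret π' ω ≤ c * (1 + Real.log (K : ℝ)) ^ p *
              ((M.horizon : ℝ) * √(M.value π' * (K : ℝ) * B.toReal * β)
                + (M.horizon : ℝ) ^ 2 * B.toReal * β)}) := by
  -- `3` comes from the eluder sum, `κ⁻¹` from the offline data, and `200` from the self-bounding
  -- inequality of the cross-entropy case; the square needs only `8`.
  refine ⟨200 * (3 + κ⁻¹), 2, by positivity, ?_⟩
  intro X A _ _ M _ F hF G Pol hPol ν hν N K hK hN ua hua δ hδ hδ1 β hβ Ω _ μ _
  have hL : 0 ≤ 1 + Real.log K := by linarith [Real.log_natCast_nonneg K]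
  have hH : (1 : ℝ) ≤ M.horizon := by exact_mod_cast M.horizon_pos
  have hsmall : F.size = 1 → 0 ≤ β := fun h1 => by
    rw [hβ, h1]
    refine mul_nonneg zero_le_two (Real.log_nonneg ?_)
    rw [le_div_iff₀ hδ]
    push_cast
    linarith
  -- At least two functions give `β ≥ 2 ln 2 > 1`, which allows `ln K` to be absorbed into `(1 + ln
  -- K) β`.
  have hlarge : F.size ≠ 0 → F.size ≠ 1 → 1 ≤ β := fun h0 h1 =>
    hβ ▸ F.one_le_two_mul_log M.horizon_pos (by omega) hδ hδ1
  refine ⟨fun R => ?_, fun hT R => ?_⟩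
  · rcases eq_or_ne F.size 1 with h1 | h1
    · have := hsmall h1
      exact R.regret_of_size_eq_one hF h1 hδ fun π' B => by positivity
    · exact R.regret_sq hF hua hK hκ hN hPol hδ
        (hlarge (F.size_pos (R.nonempty_cls hK)).ne' h1) hβ
  · rcases eq_or_ne F.size 1 with h1 | h1
    · have := hsmall h1
      exact R.regret_of_size_eq_one hF h1 hδ fun π' B => by positivity
    · exact R.regret_bce hF hT hua hK hκ hN hPol hδ
        (hlarge (F.size_pos (R.nonempty_cls hK)).ne' h1) hβ
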